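/- Let $\Bbbk$ be an arbitrary field, let $H=\Bbbk^n$ with coordinates $x_1,\dots,x_n$, let $L=\Bbbk$ be a line with coordinate $y$, and let $V=H\times L$, all viewed as schemes over $\Bbbk$; identify $H$ with $H\times\{0\}\subseteq V$. Let the torus $T=\mathbb G_m^r$, with weight lattice $T^*=\mathbb Z^r$ and $\mathrm{Sym}(T^*)=\mathbb Z[t_1,\dots,t_r]$, act linearly on $V$ so that the coordinate axes are $T$-stable, the weights being $w_1,\dots,w_n\in\mathbb Z^r$ on $H$ and $w_0\in\mathbb Z^r$ on $L\cong V/H$. Write $\mathit{wt}(V/H)=\sum_j w_{0,j}t_j\in\mathrm{Sym}^1(T^*)$. For a $T$-invariant closed subscheme $Z=\mathrm{Spec}(R/I)$ of $V$, where $R=\Bbbk[x_1,\dots,x_n,y]$, the multidegree $\deg_V Z\in\mathrm{Sym}(T^*)$ is defined as follows. Grade $R$ by $\mathbb Z^r$, with $x_i$ of degree $w_i$ and $y$ of degree $w_0$, and let $$K(R/I;t)=\sum_{i,a}(-1)^i\dim_\Bbbk \mathrm{Tor}_i^R(R/I,\Bbbk)_a\,t^a$$ be the $K$-polynomial of $R/I$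 (the alternating sum of the degrees of the generators in any finite graded free resolution of $R/I$). Then $\deg_V Z$ is the sum of all terms of degree $\mathrm{codim}\,Z$ in the power series $K(R/I;1-t_1,\dots,1-t_r)$; it is $0$ if $Z=\emptyset$. Let $X\subseteq V$ be a closed subscheme that is reduced, irreducible and $T$-invariant. Let $\Pi\subseteq H$ be the scheme-theoretic closure of the image of $X$ under the projection $V\to H$. Let $\overline X$ be the closure of $X$ in $H\times\mathbb P^1$, where $\mathbb P^1=L\cup\{\infty\}$, and let $\Lambda=\overline X\cap(H\times\{\infty\})$ be the scheme-theoretic intersection, regarded as a closed subscheme of $H$. Let $d$ be the degree of the projection $X\to\Pi$, that is, $d=[\Bbbk(X):\Bbbk(\Pi)]$ if this field extension is finite, and $d=0$ otherwise. Then $\Pi$ and $\Lambda$ are $T$-invariant, $$\deg_V X=d\cdot\deg_V\Pi+\deg_V(\Lambda\times L),$$ and $$\deg_V\Pi=\deg_V(\Pi\times L)\cdot\mathit{wt}(V/H).$$ -/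

import Mathlib

open MvPolynomial

noncomputable section

namespace GVD

/- Conventions.  `k` is an arbitrary field.  The vector space `k^m`, viewed as a scheme over `k`, has
coordinate ring `MvPolynomial (Fin m) k`; its closed subschemes are given by their ideals, and a
closed subscheme is reduced and irreducible exactly when its ideal is prime.

The torus is `T = (𝔾_m)^r`.  Its weight lattice is `T^* = ℤ^r`, so that `Sym(T^*)` is
`MvPolynomial (Fin r) ℤ`, and its coordinate ring is the Laurent polynomial ring
`AddMonoidAlgebra k (Fin r → ℤ)`.  A linear action of `T` on `k^m`, in a basis of weight vectors, is
a family of weights `w : Fin m → Fin r → ℤ`: the element `t` acts on the `i`-th coordinate line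
by `t ^ w i`. -/

variable {k : Type*} [Field k] {m n r : ℕ}

/-! ### Torus actions -/

/-- The pullback of functions along the action map `T × k^m → k^m`, `(t, v) ↦ t • v`.  The coordinate
ring of `T × k^m` is that of `k^m` with the Laurent monomials of `ℤ^r` adjoined;
the coordinate `x_i` pulls back to `t ^ w i * x_i`. -/
def coaction (w : Fin m → Fin r → ℤ) :
    MvPolynomial (Fin m) k →ₐ[k] AddMonoidAlgebra (MvPolynomial (Fin m) k) (Fin r → ℤ) :=
  aeval fun i => AddMonoidAlgebra.single (w i) (X i)

/-- The closed subscheme `X` of `k^m` with ideal `I` is `T`-invariant: the action map carries `T × X`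
into `X`, i.e. functions vanishing on `X` pull back to functions vanishing on `T × X`. -/
def IsInvariant (w : Fin m → Fin r → ℤ) (I : Ideal (MvPolynomial (Fin m) k)) : Prop :=
  I.map (coaction w) ≤
    I.map (algebraMap (MvPolynomial (Fin m) k)
      (AddMonoidAlgebra (MvPolynomial (Fin m) k) (Fin r → ℤ)))

/-- A weight, as an element of `Sym^1(T^*)`. -/
def wt (a : Fin r → ℤ) : MvPolynomial (Fin r) ℤ :=
  ∑ j, C (a j) * X j

/-! ### Multidegrees

Let `R = k[x_1, …, x_m]`, graded by `ℤ^r` with `x_i` of degree `w i`, and let `M` be a finitely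
generated graded `R`-module with graded pieces `G a`.  Its `K`-polynomial is
`K(M; t) = ∑_{i,a} (-1)^i dim_k Tor_i^R(M, k)_a t^a`, the alternating sum of the degrees of the
generators in a finite graded free resolution of `M`.  `Tor_i^R(M, k)` is computed by the Koszul
complex of `M` on `x_1, …, x_m`. -/

section Koszul

variable (M : Type*) [AddCommGroup M] [Module k M] [Module (MvPolynomial (Fin m) k) M]
  [IsScalarTower k (MvPolynomial (Fin m) k) M]

/-- The differential of the Koszul complex of `M` on all the variables.  A chain
`∑_S f_S e_S`, with `S` ranging over the subsets of the variables, is the function `S ↦ f_S`; the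
differential is `e_T ↦ ∑_{j ∈ T} (-1)^{#{i ∈ T | i < j}} x_j e_{T ∖ j}`. -/
def koszulD (k : Type*) [Field k] (m : ℕ) (M : Type*) [AddCommGroup M]
    [Module (MvPolynomial (Fin m) k) M] :
    (Finset (Fin m) → M) →ₗ[MvPolynomial (Fin m) k] (Finset (Fin m) → M) :=
  LinearMap.pi fun S => ∑ j ∈ Sᶜ,
    ((-1) ^ (S.filter (· < j)).card * X j : MvPolynomial (Fin m) k) •
      LinearMap.proj (insert j S)

variable {M}

/-- The Koszul chains of homological degree `i` and internal degree `a`; the basis element `e_S` has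
homological degree `#S` and internal degree `∑_{j ∈ S} w j`. -/
def koszulPiece (w : Fin m → Fin r → ℤ) (G : (Fin r → ℤ) → Submodule k M) (i : ℕ)
    (a : Fin r → ℤ) : Submodule k (Finset (Fin m) → M) :=
  Submodule.pi Set.univ fun S => if S.card = i then G (a - ∑ j ∈ S, w j) else ⊥

/-- The Koszul cycles of homological degree `i` and internal degree `a`. -/
def koszulCycles (w : Fin m → Fin r → ℤ) (G : (Fin r → ℤ) → Submodule k M) (i : ℕ)
    (a : Fin r → ℤ) : Submodule k (Finset (Fin m) → M) :=
  LinearMap.ker ((koszulD k m M).restrictScalars k) ⊓ koszulPiece w G i a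

/-- The Koszul boundaries of homological degree `i` and internal degree `a`. -/
def koszulBoundaries (w : Fin m → Fin r → ℤ) (G : (Fin r → ℤ) → Submodule k M) (i : ℕ)
    (a : Fin r → ℤ) : Submodule k (Finset (Fin m) → M) :=
  (koszulPiece w G (i + 1) a).map ((koszulD k m M).restrictScalars k)

/-- The multigraded Betti number `β_{i,a} = dim_k Tor_i^R(M, k)_a`. -/
def betti (w : Fin m → Fin r → ℤ) (G : (Fin r → ℤ) → Submodule k M) (i : ℕ)
    (a : Fin r → ℤ) : ℕ :=
  Module.finrank k
    (koszulCycles w G i a ⧸ (koszulBoundaries w G i a).submoduleOf (koszulCycles w G i a))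

/-- The coefficient of `t^a` in the `K`-polynomial of `M`. -/
def kCoeff (w : Fin m → Fin r → ℤ) (G : (Fin r → ℤ) → Submodule k M) (a : Fin r → ℤ) : ℤ :=
  ∑ i ∈ Finset.range (m + 1), (-1) ^ i * (betti w G i a : ℤ)

end Koszul

/-- The degree `a` part of `R/I`, where the variable `x_i` has degree `w i`. -/
def gradedPiece (w : Fin m → Fin r → ℤ) (I : Ideal (MvPolynomial (Fin m) k)) (a : Fin r → ℤ) :
    Submodule k (MvPolynomial (Fin m) k ⧸ I) :=
  (weightedHomogeneousSubmodule k w a).map (Ideal.Quotient.mkₐ k I).toLinearMap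

/-- The power series `1 - t_j` is invertible. -/
theorem isUnit_one_sub_X (j : Fin r) :
    IsUnit (1 - MvPowerSeries.X j : MvPowerSeries (Fin r) ℤ) := by
  rw [MvPowerSeries.isUnit_iff_constantCoeff]
  simp

/-- The power series expansion of `(1 - t)^a = ∏_j (1 - t_j)^{a_j}`, for `a ∈ ℤ^r`. -/
def oneSubPow (a : Fin r → ℤ) : MvPowerSeries (Fin r) ℤ :=
  ((∏ j, (isUnit_one_sub_X j).unit ^ a j : (MvPowerSeries (Fin r) ℤ)ˣ) :
    MvPowerSeries (Fin r) ℤ)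

/-- The power series `K(R/I; 1 - t)`, obtained from the `K`-polynomial of `R/I` by substituting
`1 - t_j` for each `t_j`.  For `I` invariant only finitely many summands are nonzero. -/
def kSeries (w : Fin m → Fin r → ℤ) (I : Ideal (MvPolynomial (Fin m) k)) :
    MvPowerSeries (Fin r) ℤ :=
  ∑ᶠ a : Fin r → ℤ, kCoeff w (gradedPiece w I) a • oneSubPow a

/-- The multidegree in `Sym(T^*) = ℤ[t_1, …, t_r]` of the `T`-invariant closed subscheme of `k^m` with
ideal `I`: the sum of the terms of `K(R/I; 1 - t)` of degree equal to the codimension.  It is zero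
for the empty scheme, for which `R/I = 0`. -/
def multidegree (w : Fin m → Fin r → ℤ) (I : Ideal (MvPolynomial (Fin m) k)) :
    MvPolynomial (Fin r) ℤ :=
  ∑ e ∈ (Finset.univ : Finset (Fin r)).finsuppAntidiag I.height.toNat,
    monomial e (MvPowerSeries.coeff e (kSeries w I))

/-! ### Subschemes of `V = H × L`

`V = k^(n+1)`; the coordinate `X 0` is the coordinate `y` on the line `L`, and the coordinates
`X i.succ` are the coordinates `x_1, …, x_n` on the hyperplane `H = k^n`. -/

/-- Pullback of functions along the projection `V = H × L → H`. -/
def proj (k : Type*) [Field k] (n : ℕ) :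
    MvPolynomial (Fin n) k →ₐ[k] MvPolynomial (Fin (n + 1)) k :=
  rename Fin.succ

/-- The ideal of `Π ⊆ H`, the scheme-theoretic closure of the image of `X` under the projection. -/
def projPart (I : Ideal (MvPolynomial (Fin (n + 1)) k)) : Ideal (MvPolynomial (Fin n) k) :=
  I.comap (proj k n)

/-- The ideal of `Z × L ⊆ V`, for `Z ⊆ H` with ideal `J`. -/
def timesLine (J : Ideal (MvPolynomial (Fin n) k)) : Ideal (MvPolynomial (Fin (n + 1)) k) :=
  J.map (proj k n)

/-- The ideal of `Z = Z × {0} ⊆ V`, for `Z ⊆ H` with ideal `J`. -/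
def inHyperplane (J : Ideal (MvPolynomial (Fin n) k)) : Ideal (MvPolynomial (Fin (n + 1)) k) :=
  timesLine J ⊔ Ideal.span {X 0}

/-- The chart of `H × ℙ¹` at infinity is `H × Spec k[z]` with `z = 1/y`.  It meets `V` in the locus
`y ≠ 0`; this is the restriction to that locus of functions on the chart (`X 0` is `z`). -/
def chartAtInfinity (k : Type*) [Field k] (n : ℕ) :
    MvPolynomial (Fin (n + 1)) k →ₐ[k]
      Localization.Away (X 0 : MvPolynomial (Fin (n + 1)) k) :=
  aeval (Fin.cons (IsLocalization.Away.invSelf (X 0 : MvPolynomial (Fin (n + 1)) k))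
    fun i : Fin n => algebraMap (MvPolynomial (Fin (n + 1)) k) _ (X i.succ))

/-- The ideal, in the chart at infinity, of the scheme-theoretic closure of `X` in `H × ℙ¹`. -/
def closureAtInfinity (I : Ideal (MvPolynomial (Fin (n + 1)) k)) :
    Ideal (MvPolynomial (Fin (n + 1)) k) :=
  (I.map (algebraMap _ (Localization.Away (X 0 : MvPolynomial (Fin (n + 1)) k)))).comap
    (chartAtInfinity k n)

/-- The ideal of `Λ ⊆ H`, the scheme-theoretic intersection in `H × ℙ¹` of the closure of `X` with
`H × {∞} = H`: put `z = 0` in the ideal of the closure. -/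
def conePart (I : Ideal (MvPolynomial (Fin (n + 1)) k)) : Ideal (MvPolynomial (Fin n) k) :=
  (closureAtInfinity I).map
    (aeval (Fin.cons 0 X) : MvPolynomial (Fin (n + 1)) k →ₐ[k] MvPolynomial (Fin n) k)

/-! ### The degree of the projection -/

/-- Pullback of functions along `X → Π`, for `Π` the closure of the image of `X`. -/
def projQuot (I : Ideal (MvPolynomial (Fin (n + 1)) k)) :
    MvPolynomial (Fin n) k ⧸ projPart I →+* MvPolynomial (Fin (n + 1)) k ⧸ I :=
  Ideal.quotientMap I (proj k n : MvPolynomial (Fin n) k →+* MvPolynomial (Fin (n + 1)) k) le_rfl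

theorem projQuot_injective (I : Ideal (MvPolynomial (Fin (n + 1)) k)) :
    Function.Injective (projQuot I) :=
  Ideal.quotientMap_injective

instance projPart_isPrime (I : Ideal (MvPolynomial (Fin (n + 1)) k)) [I.IsPrime] :
    (projPart I).IsPrime :=
  inferInstanceAs (I.comap (proj k n)).IsPrime

/-- The inclusion `k(Π) ⊆ k(X)` of function fields. -/
def functionFieldMap (I : Ideal (MvPolynomial (Fin (n + 1)) k)) [I.IsPrime] :
    FractionRing (MvPolynomial (Fin n) k ⧸ projPart I) →+*
      FractionRing (MvPolynomial (Fin (n + 1)) k ⧸ I) :=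
  IsFractionRing.map (projQuot_injective I)

/-- The degree of the projection `X → Π`: the degree of the extension `k(X) ⊇ k(Π)` if this is
finite, and zero otherwise. -/
def projDegree (I : Ideal (MvPolynomial (Fin (n + 1)) k)) [I.IsPrime] : ℕ :=
  letI := (functionFieldMap I).toAlgebra
  Module.finrank (FractionRing (MvPolynomial (Fin n) k ⧸ projPart I))
    (FractionRing (MvPolynomial (Fin (n + 1)) k ⧸ I))

end GVD

end

/-! Write `A` for the functions on `H`, so that functions on `V` form `A[y]`. For a homogeneous
ideal `I` of `A[y]`, let `L_j` be the ideal of coefficients of `y^j` in the elements of `I` of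
`y`-degree at most `j`. These homogeneous ideals increase with `j` and stabilise from some `N` on.
The first, `L_0`, is the contraction of `I` to `A` and cuts out `Π`; the stable one is the ideal of
all leading coefficients, and it cuts out `Λ` because reversing a polynomial in `y` turns its
leading coefficient into its value at `1/y = 0` (`conePart_eq_leadingCoeff`).

With `T = (1 - t)^(w 0)`, the engine is the identity (`IsHomog.kSeries_succ`) `K(A[y]/I) = (1 - T)
∑_{j<N} T^j K(A/L_j) + T^N K(A/L_N)`. The Koszul complex in all the variables is the cone of
multiplication by `y` on the Koszul complex over `A`. Filtering `I` by `y`-degree has graded pieces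
`L_j`, and beyond degree `N` multiplication by `y` is an isomorphism on graded pieces. Weights are
arbitrary, so graded pieces can be infinite-dimensional and Hilbert series are unavailable; only
homology is counted, with lengths in `ℕ∞` until finiteness is proved by induction on the number of
variables.

Next, `K(A/J; 1 - t)` has order at least the height of `J` (`IsHomog.ordGE_kSeries`), by induction
through the same identity, using that the height of `I` is at most one more than that of `L_0` and
at most that of the leading coefficient ideal.

Now let `I` be prime. If `X = Π × L`, then `d = 0` and `Λ = Π`. Otherwise `codim X = codim Π + 1`,
and `1 - T` has lowest term `wt (w 0)`. In the part of degree `codim X`, the `j`-th summand gives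
`wt (w 0)` times the multidegree of `Π` if `L_j = L_0`; it gives `0` otherwise, because an ideal
strictly containing a prime has larger height. Comparison with the minimal polynomial of `y` over
`k(Π)` shows that `L_j = L_0` exactly for `j < d` (`projDegree_spec`). The last summand gives the
multidegree of `Λ`, since a nonempty `Λ` has the codimension of `X`: one inequality is the bound on
leading coefficients, the other is Krull's theorem for the section `z = 0` of the closure
(`height_conePart_le`). The identity also computes the series of `Π × L` and `Π × {0}`, which differ
by the factor `1 - T`; this is the second formula. -/

noncomputable section

namespace GVD

/-! ### Lengths of homology and long exact sequences for complexes inside one vector space. -/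

section HomologyLengths

variable {k : Type*} [Field k] {W W' : Type*} [AddCommGroup W] [Module k W]
  [AddCommGroup W'] [Module k W']

/-- The length of `B / (A ∩ B)`. -/
def relLen (A B : Submodule k W) : ℕ∞ := Module.length k (B ⧸ A.submoduleOf B)

theorem mem_submoduleOf_iff {A B : Submodule k W} {x : B} : x ∈ A.submoduleOf B ↔ (x : W) ∈ A :=
  Iff.rfl

theorem relLen_eq_zero {A B : Submodule k W} (h : B ≤ A) : relLen A B = 0 := by
  have : Subsingleton (B ⧸ A.submoduleOf B) := by
    rw [Submodule.Quotient.subsingleton_iff, Submodule.submoduleOf_eq_top]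
    exact h
  exact Module.length_eq_zero

theorem relLen_ne_top {A B : Submodule k W} [Module.Finite k W] : relLen A B ≠ ⊤ := by
  rw [relLen, Module.length_eq_finrank]
  exact ENat.natCast_ne_top _

theorem relLen_toNat (A B : Submodule k W) :
    (relLen A B).toNat = Module.finrank k (B ⧸ A.submoduleOf B) := by
  rw [relLen, Module.length_eq_rank]
  simp [Module.finrank]

theorem relLen_eq_length {V : Type*} [AddCommGroup V] [Module k V] {A B : Submodule k W}
    (f : B →ₗ[k] V) (hf : Function.Surjective f) (hk : ∀ x : B, f x = 0 ↔ (x : W) ∈ A) :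
    relLen A B = Module.length k V := by
  have hker : LinearMap.ker f = A.submoduleOf B := by
    ext x
    rw [LinearMap.mem_ker, hk, mem_submoduleOf_iff]
  rw [relLen, ← hker]
  exact (f.quotKerEquivOfSurjective hf).length_eq

theorem relLen_map (g : W →ₗ[k] W') {A B : Submodule k W} (hAB : A ≤ B)
    (h : B ⊓ LinearMap.ker g ≤ A) : relLen (A.map g) (B.map g) = relLen A B := by
  symm
  refine relLen_eq_length (((A.map g).submoduleOf (B.map g)).mkQ ∘ₗ g.submoduleMap B)
    ((Submodule.mkQ_surjective _).comp (g.submoduleMap_surjective B)) fun x => ?_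
  rw [LinearMap.comp_apply, Submodule.mkQ_apply, Submodule.Quotient.mk_eq_zero,
    mem_submoduleOf_iff]
  constructor
  · rintro ⟨y, hy, hxy⟩
    have h1 : (x : W) - y ∈ A := h ⟨B.sub_mem x.2 (hAB hy), by
      rw [SetLike.mem_coe, LinearMap.mem_ker, map_sub, sub_eq_zero]; exact hxy.symm⟩
    simpa using A.add_mem h1 hy
  · intro hx
    exact ⟨x, hx, rfl⟩

theorem relLen_inf_sup (A B : Submodule k W) : relLen A (A ⊔ B) = relLen (A ⊓ B) B := by
  symm
  refine relLen_eq_length ((A.submoduleOf (A ⊔ B)).mkQ ∘ₗ Submodule.inclusion le_sup_right)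
    (fun x => ?_) fun x => ?_
  · obtain ⟨⟨x, hx⟩, rfl⟩ := Submodule.mkQ_surjective _ x
    obtain ⟨a, ha, b, hb, rfl⟩ := Submodule.mem_sup.1 hx
    refine ⟨⟨b, hb⟩, ?_⟩
    rw [LinearMap.comp_apply, Submodule.mkQ_apply, Submodule.mkQ_apply, Submodule.Quotient.eq,
      mem_submoduleOf_iff]
    simpa using ha
  · rw [LinearMap.comp_apply, Submodule.mkQ_apply, Submodule.Quotient.mk_eq_zero,
      mem_submoduleOf_iff]
    simp

theorem relLen_add {A B C : Submodule k W} (hAB : A ≤ B) (hBC : B ≤ C) :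
    relLen A C = relLen A B + relLen B C := by
  have h1 : relLen A C = Module.length k (C.map A.mkQ) := by
    refine relLen_eq_length (A.mkQ.submoduleMap C) (A.mkQ.submoduleMap_surjective C) fun x => ?_
    rw [← Subtype.coe_inj, LinearMap.submoduleMap_coe_apply]
    simp
  have h2 : relLen A B = Module.length k (B.map A.mkQ) := by
    refine relLen_eq_length (A.mkQ.submoduleMap B) (A.mkQ.submoduleMap_surjective B) fun x => ?_
    rw [← Subtype.coe_inj, LinearMap.submoduleMap_coe_apply]
    simp
  have h3 : relLen (B.map A.mkQ) (C.map A.mkQ) = relLen B C := by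
    refine relLen_map _ hBC ?_
    rw [Submodule.ker_mkQ]
    exact inf_le_right.trans hAB
  rw [h1, h2, ← h3]
  have hle : B.map A.mkQ ≤ C.map A.mkQ := Submodule.map_mono hBC
  refine Module.length_eq_add_of_exact (Submodule.inclusion hle) (Submodule.mkQ _)
    (Submodule.inclusion_injective hle) (Submodule.mkQ_surjective _) ?_
  intro x
  rw [Submodule.mkQ_apply, Submodule.Quotient.mk_eq_zero, mem_submoduleOf_iff]
  exact ⟨fun hx => ⟨⟨x, hx⟩, rfl⟩, by rintro ⟨y, rfl⟩; exact y.2⟩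

/-- The length of the homology in degree `i` of the complex with chains `C i` and differential
induced by `d`. -/
def hLen (d : W →ₗ[k] W) (C : ℕ → Submodule k W) (i : ℕ) : ℕ∞ :=
  relLen ((C (i + 1)).map d) (LinearMap.ker d ⊓ C i)

/-- The submodules `C i` form a complex with respect to `d`. -/
structure IsCx (d : W →ₗ[k] W) (C : ℕ → Submodule k W) : Prop where
  sq : ∀ x, d (d x) = 0
  map_le : ∀ i, (C (i + 1)).map d ≤ C i
  zero_le : C 0 ≤ LinearMap.ker d

theorem IsCx.map_le_ker {d : W →ₗ[k] W} {C : ℕ → Submodule k W} (h : IsCx d C) (i : ℕ) :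
    (C (i + 1)).map d ≤ LinearMap.ker d ⊓ C i := by
  refine le_inf ?_ (h.map_le i)
  rintro _ ⟨x, -, rfl⟩
  exact h.sq x

/-- The length of the homology in degree `i` of the quotient complex `C / D`. -/
def quotLen (d : W →ₗ[k] W) (D C : ℕ → Submodule k W) (i : ℕ) : ℕ∞ :=
  -- For `i = 0` the truncated subtraction gives `D 0`; for complexes this is harmless, as `d` kills
  -- `C 0`.
  relLen ((C (i + 1)).map d ⊔ D i) (C i ⊓ (D (i - 1)).comap d)

/-- The rank of the connecting map from the homology of `C / D` in degree `i`. -/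
def bdryLen (d : W →ₗ[k] W) (D C : ℕ → Submodule k W) : ℕ → ℕ∞
  | 0 => 0
  | j + 1 => relLen ((D (j + 1)).map d) ((C (j + 1)).map d ⊓ D j)

/-- The dimensions in the long exact homology sequence of a pair of complexes. -/
theorem exists_long_exact {d : W →ₗ[k] W} {D C : ℕ → Submodule k W} (hD : IsCx d D)
    (hC : IsCx d C) (hDC : ∀ i, D i ≤ C i) :
    ∃ α β δ : ℕ → ℕ∞, δ 0 = 0 ∧ (∀ i, C (i + 1) = ⊥ → δ (i + 1) = 0) ∧
      (∀ i, hLen d D i = α i + δ (i + 1)) ∧ (∀ i, hLen d C i = α i + β i) ∧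
      ∀ i, quotLen d D C i = β i + δ i := by
  -- The three families are the ranks of `H(D) → H(C)`, of `H(C) → H(C/D)` and of the connecting
  -- map.
  refine ⟨fun i => relLen ((C (i + 1)).map d ⊓ D i) (LinearMap.ker d ⊓ D i),
    fun i => relLen ((C (i + 1)).map d ⊔ (LinearMap.ker d ⊓ D i)) (LinearMap.ker d ⊓ C i),
    bdryLen d D C,
    rfl, ?_, ?_, ?_, ?_⟩
  · intro i hi
    refine relLen_eq_zero ?_
    simp [hi]
  · intro i
    rw [add_comm]
    refine relLen_add (le_inf (Submodule.map_mono (hDC _)) (hD.map_le i)) ?_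
    exact inf_le_inf_right _ ((hC.map_le_ker i).trans inf_le_left)
  · intro i
    have h1 : relLen ((C (i + 1)).map d ⊓ D i) (LinearMap.ker d ⊓ D i) =
        relLen ((C (i + 1)).map d) ((C (i + 1)).map d ⊔ (LinearMap.ker d ⊓ D i)) := by
      rw [relLen_inf_sup]
      congr 1
      rw [← inf_assoc, inf_eq_left.2 ((hC.map_le_ker i).trans inf_le_left)]
    simp only [h1]
    exact relLen_add le_sup_left
      (sup_le (hC.map_le_ker i) (inf_le_inf_left _ (hDC i)))
  · intro i
    have hker : (LinearMap.ker d ⊓ C i) ⊓ ((C (i + 1)).map d ⊔ D i) =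
        (C (i + 1)).map d ⊔ (LinearMap.ker d ⊓ D i) := by
      rw [inf_comm (LinearMap.ker d), inf_assoc, inf_comm (LinearMap.ker d) (_ ⊔ _),
        sup_inf_assoc_of_le _ ((hC.map_le_ker i).trans inf_le_left), inf_comm (D i)]
      exact inf_eq_right.2 (sup_le (hC.map_le i) (inf_le_right.trans (hDC i)))
    have h1 : relLen ((C (i + 1)).map d ⊔ (LinearMap.ker d ⊓ D i)) (LinearMap.ker d ⊓ C i) =
        relLen ((C (i + 1)).map d ⊔ D i)
          (((C (i + 1)).map d ⊔ D i) ⊔ (LinearMap.ker d ⊓ C i)) := by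
      rw [relLen_inf_sup, ← hker, inf_comm]
    have h2 : ((C (i + 1)).map d ⊔ D i) ⊔ (LinearMap.ker d ⊓ C i) =
        (LinearMap.ker d ⊓ C i) ⊔ D i := by
      refine le_antisymm (sup_le (sup_le ((hC.map_le_ker i).trans le_sup_left) le_sup_right)
        le_sup_left) (sup_le le_sup_right (le_sup_right.trans le_sup_left))
    have h3 : relLen ((LinearMap.ker d ⊓ C i) ⊔ D i) (C i ⊓ (D (i - 1)).comap d) =
        bdryLen d D C i := by
      cases i with
      | zero =>
        refine relLen_eq_zero (inf_le_left.trans (le_trans ?_ le_sup_left))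
        exact le_inf hC.zero_le le_rfl
      | succ j =>
        have e1 : ((LinearMap.ker d ⊓ C (j + 1)) ⊔ D (j + 1)).map d = (D (j + 1)).map d := by
          rw [Submodule.map_sup]
          refine sup_eq_right.2 ?_
          rintro _ ⟨x, hx, rfl⟩
          rw [LinearMap.mem_ker.1 hx.1]
          exact Submodule.zero_mem _
        have e2 : (C (j + 1) ⊓ (D (j + 1 - 1)).comap d).map d = (C (j + 1)).map d ⊓ D j := by
          exact Submodule.map_inf_eq_map_inf_comap.symm
        rw [bdryLen, ← e1, ← e2]
        symm
        refine relLen_map d (sup_le (le_inf inf_le_right ?_) (le_inf (hDC _) ?_)) ?_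
        · intro x hx
          rw [Submodule.mem_comap, LinearMap.mem_ker.1 hx.1]
          exact Submodule.zero_mem _
        · exact Submodule.map_le_iff_le_comap.1 (hD.map_le j)
        · exact le_trans (le_inf inf_le_right (inf_le_left.trans inf_le_left)) le_sup_left
    rw [quotLen, ← h3]
    simp only [h1, h2]
    refine relLen_add (sup_le ((hC.map_le_ker i).trans le_sup_left) le_sup_right) ?_
    refine sup_le (le_inf inf_le_right ?_) (le_inf (hDC i) ?_)
    · intro x hx
      rw [Submodule.mem_comap, LinearMap.mem_ker.1 hx.1]
      exact Submodule.zero_mem _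
    · cases i with
      | zero =>
        intro x hx
        rw [Submodule.mem_comap, LinearMap.mem_ker.1 (hD.zero_le hx)]
        exact Submodule.zero_mem _
      | succ j => exact Submodule.map_le_iff_le_comap.1 (hD.map_le j)

/-- The alternating sum of the first `m` terms of a sequence of lengths. -/
def altSum (m : ℕ) (h : ℕ → ℕ∞) : ℤ :=
  ∑ i ∈ Finset.range m, (-1) ^ i * ((h i).toNat : ℤ)

/-- The ranks telescope: truncating the sums at `M` leaves only the rank of the connecting map in
degree `M`, with sign. Finiteness of `h` and `h'` bounds all three ranks, so passing to `toNat`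
loses nothing. -/
theorem altSum_long_exact {α β δ h h' h'' : ℕ → ℕ∞} {m : ℕ} (h0 : δ 0 = 0) (hm : δ m = 0)
    (hh' : ∀ i, h' i = α i + δ (i + 1)) (hh : ∀ i, h i = α i + β i)
    (hh'' : ∀ i, h'' i = β i + δ i) (f' : ∀ i, h' i ≠ ⊤) (f : ∀ i, h i ≠ ⊤) :
    altSum m h = altSum m h' + altSum m h'' := by
  have fα : ∀ i, α i ≠ ⊤ := fun i e => f i (by rw [hh, e, top_add])
  have fβ : ∀ i, β i ≠ ⊤ := fun i e => f i (by rw [hh, e, add_top])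
  have fδ : ∀ i, δ i ≠ ⊤ := by
    rintro (_ | i) e
    · rw [h0] at e; exact ENat.zero_ne_top e
    · exact f' i (by rw [hh', e, add_top])
  have key : ∀ M, altSum M h = altSum M h' + altSum M h'' + (-1) ^ M * ((δ M).toNat : ℤ) := by
    intro M
    induction M with
    | zero => simp [altSum, h0]
    | succ M ih =>
      simp only [altSum, Finset.sum_range_succ] at ih ⊢
      rw [ih, hh', hh, hh'', ENat.toNat_add (fα M) (fβ M), ENat.toNat_add (fβ M) (fδ M),
        ENat.toNat_add (fα M) (fδ (M + 1))]
      push_cast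
      ring
  rw [key m, hm]
  simp

variable {d : W →ₗ[k] W} {D C : ℕ → Submodule k W}

/-- Quotient complexes are never formed: a map `g` with kernel `D` on `C` models `C / D` by its
image. -/
theorem quotLen_eq_hLen (hC : IsCx d C) (hDC : ∀ i, D i ≤ C i) {d'' : W' →ₗ[k] W'}
    {C'' : ℕ → Submodule k W'} (g : W →ₗ[k] W') (hg : ∀ i, ∀ x ∈ C i, g (d x) = d'' (g x))
    (hker : ∀ i, C i ⊓ LinearMap.ker g = D i) (hmap : ∀ i, (C i).map g = C'' i) (i : ℕ) :
    quotLen d D C i = hLen d'' C'' i := by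
  have e1 : ((C (i + 1)).map d ⊔ D i).map g = (C'' (i + 1)).map d'' := by
    rw [Submodule.map_sup, ← hmap (i + 1)]
    have : (D i).map g ≤ ⊥ := by
      rw [← hker i]
      rintro _ ⟨x, hx, rfl⟩
      exact hx.2
    rw [le_bot_iff.1 this, sup_bot_eq]
    ext y
    constructor
    · rintro ⟨_, ⟨x, hx, rfl⟩, rfl⟩
      exact ⟨g x, ⟨x, hx, rfl⟩, (hg _ x hx).symm⟩
    · rintro ⟨_, ⟨x, hx, rfl⟩, rfl⟩
      exact ⟨d x, ⟨x, hx, rfl⟩, hg _ x hx⟩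
  have e2 : (C i ⊓ (D (i - 1)).comap d).map g = LinearMap.ker d'' ⊓ C'' i := by
    rw [← hmap i]
    ext y
    constructor
    · rintro ⟨x, ⟨hx, hdx⟩, rfl⟩
      refine ⟨?_, ⟨x, hx, rfl⟩⟩
      rw [SetLike.mem_coe, LinearMap.mem_ker, ← hg i x hx]
      have : d x ∈ D (i - 1) := hdx
      rw [← hker] at this
      exact this.2
    · rintro ⟨hy, ⟨x, hx, rfl⟩⟩
      refine ⟨x, ⟨hx, ?_⟩, rfl⟩
      rw [SetLike.mem_coe, LinearMap.mem_ker, ← hg i x hx] at hy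
      rw [SetLike.mem_coe, Submodule.mem_comap, ← hker]
      refine ⟨?_, hy⟩
      cases i with
      | zero =>
        rw [LinearMap.mem_ker.1 (hC.zero_le hx)]
        exact Submodule.zero_mem _
      | succ j => exact hC.map_le j ⟨x, hx, rfl⟩
  rw [quotLen, hLen, ← e1, ← e2]
  symm
  refine relLen_map g (sup_le ?_ (le_inf (hDC i) ?_)) ?_
  · refine (hC.map_le_ker i).trans (le_inf inf_le_right ?_)
    intro x hx
    rw [Submodule.mem_comap, LinearMap.mem_ker.1 hx.1]
    exact Submodule.zero_mem _
  · intro x hx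
    rw [← hker] at hx
    rw [Submodule.mem_comap, ← hker]
    refine ⟨?_, ?_⟩
    · cases i with
      | zero =>
        rw [LinearMap.mem_ker.1 (hC.zero_le hx.1)]
        exact Submodule.zero_mem _
      | succ j => exact hC.map_le j ⟨x, hx.1, rfl⟩
    · rw [SetLike.mem_coe, LinearMap.mem_ker, hg i x hx.1, LinearMap.mem_ker.1 hx.2, map_zero]
  · refine le_trans ?_ le_sup_right
    rw [← hker i]
    exact inf_le_inf_right _ inf_le_left

theorem hLen_map {d' : W' →ₗ[k] W'} (f : W →ₗ[k] W') (hf : Function.Injective f)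
    (hC : IsCx d C) (hfd : ∀ x, f (d x) = d' (f x)) (i : ℕ) :
    hLen d' (fun i => (C i).map f) i = hLen d C i := by
  have e1 : ((C (i + 1)).map d).map f = ((C (i + 1)).map f).map d' := by
    rw [← Submodule.map_comp, ← Submodule.map_comp]
    congr 1
    ext x
    exact hfd x
  have e2 : (LinearMap.ker d ⊓ C i).map f = LinearMap.ker d' ⊓ (C i).map f := by
    ext y
    constructor
    · rintro ⟨x, ⟨hx, hxC⟩, rfl⟩
      refine ⟨?_, x, hxC, rfl⟩
      rw [SetLike.mem_coe, LinearMap.mem_ker, ← hfd, LinearMap.mem_ker.1 hx, map_zero]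
    · rintro ⟨hy, x, hxC, rfl⟩
      refine ⟨x, ⟨?_, hxC⟩, rfl⟩
      rw [SetLike.mem_coe, LinearMap.mem_ker, ← hfd] at hy
      exact hf (hy.trans (map_zero f).symm)
  rw [hLen, hLen, ← e1, ← e2]
  refine relLen_map f (hC.map_le_ker i) ?_
  rw [LinearMap.ker_eq_bot.2 hf, inf_bot_eq]
  exact bot_le

theorem hLen_ne_top_of_quot (hD : IsCx d D) (hC : IsCx d C) (hDC : ∀ i, D i ≤ C i)
    (fD : ∀ i, hLen d D i ≠ ⊤) (fQ : ∀ i, quotLen d D C i ≠ ⊤) (i : ℕ) : hLen d C i ≠ ⊤ := by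
  obtain ⟨α, β, δ, -, -, h1, h2, h3⟩ := exists_long_exact hD hC hDC
  have ha := fD i
  have hb := fQ i
  rw [h1] at ha
  rw [h3] at hb
  rw [h2]
  simp only [ne_eq, ENat.add_eq_top, not_or] at ha hb ⊢
  exact ⟨ha.1, hb.1⟩

theorem altSum_quot (hD : IsCx d D) (hC : IsCx d C) (hDC : ∀ i, D i ≤ C i) {m : ℕ}
    (hm : C m = ⊥) (fD : ∀ i, hLen d D i ≠ ⊤) (fC : ∀ i, hLen d C i ≠ ⊤) :
    altSum m (hLen d C) = altSum m (hLen d D) + altSum m (quotLen d D C) := by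
  obtain ⟨α, β, δ, h0, hδ, h1, h2, h3⟩ := exists_long_exact hD hC hDC
  refine altSum_long_exact h0 ?_ h1 h2 h3 fD fC
  cases m with
  | zero => exact h0
  | succ m => exact hδ m hm

end HomologyLengths

/-! ### The Koszul complex in a fixed internal degree, and its Euler characteristic. -/

section KoszulComplex

variable {k : Type*} [Field k] {m n r : ℕ}

section

variable {M : Type*} [AddCommGroup M] [Module (MvPolynomial (Fin m) k) M]

theorem koszulD_apply (f : Finset (Fin m) → M) (S : Finset (Fin m)) :
    koszulD k m M f S = ∑ j ∈ Sᶜ,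
      ((-1) ^ (S.filter (· < j)).card * X j : MvPolynomial (Fin m) k) • f (insert j S) := by
  simp [koszulD]

/-- Terms pair off under exchange of the two removed variables: inserting the smaller variable
changes by one the count giving the sign of the larger one, and not conversely, so the two signs are
opposite. -/
theorem koszulD_koszulD (f : Finset (Fin m) → M) : koszulD k m M (koszulD k m M f) = 0 := by
  ext S
  rw [koszulD_apply]
  simp only [koszulD_apply, Finset.smul_sum, Pi.zero_apply]
  rw [Finset.sum_sigma']
  have hcard : ∀ i j : Fin m, j ∉ S → ((insert j S).filter (· < i)).card =
      (S.filter (· < i)).card + if j < i then 1 else 0 := by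
    intro i j hj
    rw [Finset.filter_insert]
    split_ifs
    · rw [Finset.card_insert_of_notMem (by simp [hj])]
    · rfl
  refine Finset.sum_involution (fun p _ => ⟨p.2, p.1⟩) ?_ ?_ ?_ ?_
  · rintro ⟨j, i⟩ h
    simp only [Finset.mem_sigma, Finset.mem_compl, Finset.mem_insert, not_or] at h
    obtain ⟨hj, hij, hi⟩ := h
    simp only
    rw [Finset.insert_comm j i, smul_smul, smul_smul, ← add_smul, hcard _ _ hj, hcard _ _ hi]
    convert zero_smul (MvPolynomial (Fin m) k) _ using 2
    rcases lt_or_gt_of_ne hij with h | h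
    · rw [if_neg h.not_gt, if_pos h]; ring
    · rw [if_neg h.not_gt, if_pos h]; ring
  · rintro ⟨j, i⟩ h - h'
    simp only [Finset.mem_sigma, Finset.mem_compl, Finset.mem_insert, not_or] at h
    simp only [Sigma.mk.injEq, heq_eq_eq] at h'
    exact h.2.1 h'.1
  · rintro ⟨j, i⟩ h
    simp only [Finset.mem_sigma, Finset.mem_compl, Finset.mem_insert, not_or] at h ⊢
    exact ⟨h.2.2, fun e => h.2.1 e.symm, h.1⟩
  · rintro ⟨j, i⟩ h
    rfl

variable [Module k M] [IsScalarTower k (MvPolynomial (Fin m) k) M]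

/-- The differential of the Koszul complex, as a `k`-linear map. -/
abbrev koszulDk (k : Type*) [Field k] (m : ℕ) (M : Type*) [AddCommGroup M]
    [Module (MvPolynomial (Fin m) k) M] [Module k M]
    [IsScalarTower k (MvPolynomial (Fin m) k) M] :
    (Finset (Fin m) → M) →ₗ[k] (Finset (Fin m) → M) :=
  (koszulD k m M).restrictScalars k

theorem mem_koszulPiece {w : Fin m → Fin r → ℤ} {G : (Fin r → ℤ) → Submodule k M} {i : ℕ}
    {a : Fin r → ℤ} {f : Finset (Fin m) → M} :
    f ∈ koszulPiece w G i a ↔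
      ∀ S, (S.card = i → f S ∈ G (a - ∑ j ∈ S, w j)) ∧ (S.card ≠ i → f S = 0) := by
  simp only [koszulPiece, Submodule.mem_pi, Set.mem_univ, true_implies]
  refine forall_congr' fun S => ?_
  split_ifs with h <;> simp [h]

theorem koszulPiece_mono {w : Fin m → Fin r → ℤ} {F G : (Fin r → ℤ) → Submodule k M}
    (h : ∀ a, F a ≤ G a) (i : ℕ) (a : Fin r → ℤ) : koszulPiece w F i a ≤ koszulPiece w G i a := by
  intro f hf
  rw [mem_koszulPiece] at hf ⊢
  exact fun S => ⟨fun hS => h _ ((hf S).1 hS), (hf S).2⟩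

theorem koszulPiece_eq_bot {w : Fin m → Fin r → ℤ} {G : (Fin r → ℤ) → Submodule k M} {i : ℕ}
    (hi : m < i) (a : Fin r → ℤ) : koszulPiece w G i a = ⊥ := by
  rw [eq_bot_iff]
  intro f hf
  rw [mem_koszulPiece] at hf
  rw [Submodule.mem_bot]
  ext S
  refine (hf S).2 fun hS => ?_
  have := S.card_le_univ
  rw [Fintype.card_fin] at this
  omega

theorem koszulPiece_isCx {w : Fin m → Fin r → ℤ} {G : (Fin r → ℤ) → Submodule k M}
    (hG : ∀ j a, ∀ x ∈ G a, (X j : MvPolynomial (Fin m) k) • x ∈ G (a + w j)) (a : Fin r → ℤ) :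
    IsCx (koszulDk k m M) fun i => koszulPiece w G i a where
  sq x := koszulD_koszulD x
  map_le i := by
    rintro _ ⟨f, hf, rfl⟩
    rw [SetLike.mem_coe, mem_koszulPiece] at hf
    rw [mem_koszulPiece]
    intro S
    rw [LinearMap.restrictScalars_apply, koszulD_apply]
    constructor
    · intro hS
      refine Submodule.sum_mem _ fun j hj => ?_
      rw [Finset.mem_compl] at hj
      have h1 := hG j _ _ ((hf (insert j S)).1 (by rw [Finset.card_insert_of_notMem hj, hS]))
      rw [Finset.sum_insert hj, show a - (w j + ∑ x ∈ S, w x) + w j = a - ∑ x ∈ S, w x by abel]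
        at h1
      rw [mul_smul]
      rcases neg_one_pow_eq_or (MvPolynomial (Fin m) k) (S.filter (· < j)).card with e | e
      · rwa [e, one_smul]
      · rw [e, neg_smul, one_smul]
        exact Submodule.neg_mem _ h1
    · intro hS
      refine Finset.sum_eq_zero fun j hj => ?_
      rw [Finset.mem_compl] at hj
      rw [(hf (insert j S)).2 (by rw [Finset.card_insert_of_notMem hj]; omega), smul_zero]
  zero_le := by
    intro f hf
    rw [mem_koszulPiece] at hf
    rw [LinearMap.mem_ker]
    ext S
    rw [LinearMap.restrictScalars_apply, koszulD_apply]
    refine Finset.sum_eq_zero fun j hj => ?_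
    rw [Finset.mem_compl] at hj
    rw [(hf (insert j S)).2 (by rw [Finset.card_insert_of_notMem hj]; omega), smul_zero]

/-- The length of the Koszul homology of degree `i`, in internal degree `a`. -/
def kosLen (w : Fin m → Fin r → ℤ) (G : (Fin r → ℤ) → Submodule k M) (a : Fin r → ℤ) (i : ℕ) :
    ℕ∞ :=
  hLen (koszulDk k m M) (fun i => koszulPiece w G i a) i

theorem kCoeff_eq_altSum (w : Fin m → Fin r → ℤ) (G : (Fin r → ℤ) → Submodule k M)
    (a : Fin r → ℤ) : kCoeff w G a = altSum (m + 1) (kosLen w G a) := by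
  refine Finset.sum_congr rfl fun i _ => ?_
  rw [betti, kosLen, hLen, relLen_toNat]
  rfl

theorem kosLen_eq_zero (w : Fin m → Fin r → ℤ) (G : (Fin r → ℤ) → Submodule k M)
    (a : Fin r → ℤ) {i : ℕ} (hi : m < i) : kosLen w G a i = 0 := by
  refine relLen_eq_zero ?_
  simp only [koszulPiece_eq_bot hi, inf_bot_eq]
  exact bot_le

/-- A cone on this complex reaches one homological degree higher; the extra vanishing term puts both
sums over the same range. -/
theorem altSum_kosLen_add_two (w : Fin m → Fin r → ℤ) (G : (Fin r → ℤ) → Submodule k M)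
    (a : Fin r → ℤ) : altSum (m + 2) (kosLen w G a) = kCoeff w G a := by
  rw [kCoeff_eq_altSum, altSum, Finset.sum_range_succ, kosLen_eq_zero w G a (Nat.lt_succ_self m)]
  simp [altSum]

end

/-- Multiplicativity of Koszul homology in short exact sequences. -/
theorem kosLen_exact {M M' : Type*} [AddCommGroup M] [Module (MvPolynomial (Fin m) k) M]
    [Module k M] [IsScalarTower k (MvPolynomial (Fin m) k) M] [AddCommGroup M']
    [Module (MvPolynomial (Fin m) k) M'] [Module k M']
    [IsScalarTower k (MvPolynomial (Fin m) k) M']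
    {w : Fin m → Fin r → ℤ} {F G : (Fin r → ℤ) → Submodule k M}
    {Q : (Fin r → ℤ) → Submodule k M'} (c : Fin r → ℤ)
    (hF : ∀ j a, ∀ x ∈ F a, (X j : MvPolynomial (Fin m) k) • x ∈ F (a + w j))
    (hG : ∀ j a, ∀ x ∈ G a, (X j : MvPolynomial (Fin m) k) • x ∈ G (a + w j))
    (g : M →ₗ[MvPolynomial (Fin m) k] M')
    (hk : ∀ a x, x ∈ F a ↔ x ∈ G a ∧ g x = 0)
    (hQ : ∀ a y, y ∈ Q (a - c) ↔ ∃ x ∈ G a, g x = y) (a : Fin r → ℤ)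
    (fF : ∀ i, kosLen w F a i ≠ ⊤) :
    ((∀ i, kosLen w Q (a - c) i ≠ ⊤) → ∀ i, kosLen w G a i ≠ ⊤) ∧
    ((∀ i, kosLen w G a i ≠ ⊤) → kCoeff w G a = kCoeff w F a + kCoeff w Q (a - c)) := by
  have hD := koszulPiece_isCx hF a
  have hC := koszulPiece_isCx hG a
  have hDC : ∀ i, koszulPiece w F i a ≤ koszulPiece w G i a := fun i =>
    koszulPiece_mono (fun a x hx => ((hk a x).1 hx).1) i a
  have hq : ∀ i, quotLen (koszulDk k m M) (fun i => koszulPiece w F i a)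
      (fun i => koszulPiece w G i a) i = kosLen w Q (a - c) i := by
    refine fun i => quotLen_eq_hLen hC hDC ((g.restrictScalars k).compLeft _) ?_ ?_ ?_ i
    · intro i f _
      ext S
      simp only [LinearMap.compLeft_apply, Function.comp_apply, LinearMap.restrictScalars_apply,
        koszulD_apply, map_sum, map_smul]
    · intro i
      ext f
      rw [Submodule.mem_inf, mem_koszulPiece, mem_koszulPiece, LinearMap.mem_ker, funext_iff]
      simp only [LinearMap.compLeft_apply, Function.comp_apply, LinearMap.restrictScalars_apply,
        Pi.zero_apply, hk]
      constructor
      · rintro ⟨h1, h2⟩ S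
        exact ⟨fun hS => ⟨(h1 S).1 hS, h2 S⟩, (h1 S).2⟩
      · intro h
        refine ⟨fun S => ⟨fun hS => ((h S).1 hS).1, (h S).2⟩, fun S => ?_⟩
        by_cases hS : S.card = i
        · exact ((h S).1 hS).2
        · rw [(h S).2 hS, map_zero]
    · intro i
      ext f
      have e : ∀ S : Finset (Fin m), a - c - ∑ j ∈ S, w j = a - ∑ j ∈ S, w j - c := fun S => by
        abel
      rw [mem_koszulPiece]
      simp only [e, hQ]
      constructor
      · rintro ⟨f, hf, rfl⟩ S
        rw [SetLike.mem_coe, mem_koszulPiece] at hf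
        refine ⟨fun hS => ⟨f S, (hf S).1 hS, rfl⟩, fun hS => ?_⟩
        rw [LinearMap.compLeft_apply, Function.comp_apply, (hf S).2 hS, map_zero]
      · intro h
        choose! f hf hgf using fun S => (h S).1
        refine ⟨fun S => if S.card = i then f S else 0, ?_, ?_⟩
        · rw [SetLike.mem_coe, mem_koszulPiece]
          intro S
          refine ⟨fun hS => ?_, fun hS => if_neg hS⟩
          rw [if_pos hS]
          exact hf S hS
        · ext S
          rw [LinearMap.compLeft_apply, Function.comp_apply]
          split_ifs with hS
          · exact hgf S hS
          · rw [map_zero, (h S).2 hS]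
  constructor
  · intro fQ
    exact hLen_ne_top_of_quot hD hC hDC fF fun i => by rw [hq]; exact fQ i
  · intro fG
    rw [kCoeff_eq_altSum, kCoeff_eq_altSum, kCoeff_eq_altSum]
    have := altSum_quot hD hC hDC (m := m + 1) (koszulPiece_eq_bot (Nat.lt_succ_self m) a) fF fG
    rwa [funext hq] at this

end KoszulComplex

/-! ### The Koszul complex on `n + 1` variables as the cone of multiplication by the first variable.
-/

section Cone

variable {k : Type*} [Field k] {n r : ℕ}

theorem hLen_neg {W : Type*} [AddCommGroup W] [Module k W] (d : W →ₗ[k] W)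
    (C : ℕ → Submodule k W) (i : ℕ) : hLen (-d) C i = hLen d C i := by
  have e1 : LinearMap.ker (-d) = LinearMap.ker d := by
    ext x
    simp
  rw [hLen, hLen, e1, Submodule.map_neg]

/-- The complex `C`, shifted by one homological degree. -/
def shiftCx {W : Type*} [AddCommGroup W] [Module k W] (C : ℕ → Submodule k W) :
    ℕ → Submodule k W
  | 0 => ⊥
  | i + 1 => C i

theorem hLen_shiftCx_zero {W : Type*} [AddCommGroup W] [Module k W] (d : W →ₗ[k] W)
    (C : ℕ → Submodule k W) : hLen d (shiftCx C) 0 = 0 :=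
  relLen_eq_zero (by simp [shiftCx])

theorem altSum_succ (m : ℕ) (h : ℕ → ℕ∞) :
    altSum (m + 1) h = (h 0).toNat - altSum m fun i => h (i + 1) := by
  rw [altSum, Finset.sum_range_succ', altSum, sub_eq_neg_add, ← Finset.sum_neg_distrib]
  congr 1
  · exact Finset.sum_congr rfl fun i _ => by ring
  · simp

variable {N M : Type*} [AddCommGroup N] [Module (MvPolynomial (Fin (n + 1)) k) N] [Module k N]
  [IsScalarTower k (MvPolynomial (Fin (n + 1)) k) N]
  [AddCommGroup M] [Module (MvPolynomial (Fin n) k) M] [Module k M]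
  [IsScalarTower k (MvPolynomial (Fin n) k) M]

/-- The differential of the cone of `y` on the Koszul complex of `M`. -/
def coneD (y : M →ₗ[MvPolynomial (Fin n) k] M) :
    ((Finset (Fin n) → M) × (Finset (Fin n) → M)) →ₗ[k]
      ((Finset (Fin n) → M) × (Finset (Fin n) → M)) :=
  LinearMap.prod
    ((koszulDk k n M).coprod ((y.restrictScalars k).compLeft _))
    (-(koszulDk k n M) ∘ₗ LinearMap.snd k _ _)

theorem coneD_apply (y : M →ₗ[MvPolynomial (Fin n) k] M)
    (p : (Finset (Fin n) → M) × (Finset (Fin n) → M)) :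
    coneD y p = (koszulD k n M p.1 + y ∘ p.2, -koszulD k n M p.2) := rfl

theorem koszulD_comp {M M' : Type*} [AddCommGroup M] [Module (MvPolynomial (Fin n) k) M]
    [AddCommGroup M'] [Module (MvPolynomial (Fin n) k) M']
    (y : M →ₗ[MvPolynomial (Fin n) k] M') (f : Finset (Fin n) → M) :
    koszulD k n M' (y ∘ f) = y ∘ koszulD k n M f := by
  ext S
  simp only [koszulD_apply, Function.comp_apply, map_sum, map_smul]

/-- The piece of the cone of homological degree `i` and internal degree `a`. -/
def conePiece (w : Fin (n + 1) → Fin r → ℤ) (G G' : (Fin r → ℤ) → Submodule k M)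
    (a : Fin r → ℤ) (i : ℕ) : Submodule k ((Finset (Fin n) → M) × (Finset (Fin n) → M)) :=
  (koszulPiece (fun j => w j.succ) G i a).prod
    (shiftCx (fun i => koszulPiece (fun j => w j.succ) G' i (a - w 0)) i)

variable {w : Fin (n + 1) → Fin r → ℤ} {y : M →ₗ[MvPolynomial (Fin n) k] M}

theorem conePiece_isCx {G G' : (Fin r → ℤ) → Submodule k M}
    (hG : ∀ j a, ∀ x ∈ G a, (X j : MvPolynomial (Fin n) k) • x ∈ G (a + w j.succ))
    (hG' : ∀ j a, ∀ x ∈ G' a, (X j : MvPolynomial (Fin n) k) • x ∈ G' (a + w j.succ))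
    (hy : ∀ a, ∀ x ∈ G' a, y x ∈ G (a + w 0)) (a : Fin r → ℤ) :
    IsCx (coneD y) (conePiece w G G' a) where
  sq p := by
    rw [coneD_apply, coneD_apply]
    simp only [map_add, koszulD_koszulD, koszulD_comp, map_neg, neg_zero]
    ext S <;> simp
  map_le i := by
    rintro _ ⟨⟨u, v⟩, ⟨hu, hv⟩, rfl⟩
    have cG := koszulPiece_isCx (w := fun j => w j.succ) hG a
    have cG' := koszulPiece_isCx (w := fun j => w j.succ) hG' (a - w 0)
    rw [coneD_apply]
    refine ⟨Submodule.add_mem _ (cG.map_le i ⟨u, hu, rfl⟩) ?_, ?_⟩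
    · change v ∈ koszulPiece (fun j => w j.succ) G' i (a - w 0) at hv
      rw [mem_koszulPiece] at hv ⊢
      intro S
      refine ⟨fun hS => ?_, fun hS => ?_⟩
      · have := hy _ _ ((hv S).1 hS)
        rwa [show a - w 0 - ∑ j ∈ S, w j.succ + w 0 = a - ∑ j ∈ S, w j.succ by abel] at this
      · simp [(hv S).2 hS]
    · refine Submodule.neg_mem _ ?_
      cases i with
      | zero => exact cG'.zero_le hv
      | succ i => exact cG'.map_le i ⟨v, hv, rfl⟩
  zero_le := by
    rintro ⟨u, v⟩ ⟨hu, hv⟩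
    have cG := koszulPiece_isCx (w := fun j => w j.succ) hG a
    change v ∈ (⊥ : Submodule k (Finset (Fin n) → M)) at hv
    rw [Submodule.mem_bot] at hv
    subst hv
    rw [LinearMap.mem_ker, coneD_apply]
    have := cG.zero_le hu
    rw [LinearMap.mem_ker] at this
    change koszulD k n M u = 0 at this
    ext S <;> simp [this]

theorem conePiece_eq_bot (G G' : (Fin r → ℤ) → Submodule k M) (a : Fin r → ℤ) :
    conePiece w G G' a (n + 2) = ⊥ := by
  rw [conePiece, koszulPiece_eq_bot (by omega), shiftCx, koszulPiece_eq_bot (by omega),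
    Submodule.prod_bot]

/-- The homology of a cone, when `y` is not required to preserve a grading filtration. -/
theorem coneLen_of_kosLen {G G' : (Fin r → ℤ) → Submodule k M}
    (hG : ∀ j a, ∀ x ∈ G a, (X j : MvPolynomial (Fin n) k) • x ∈ G (a + w j.succ))
    (hG' : ∀ j a, ∀ x ∈ G' a, (X j : MvPolynomial (Fin n) k) • x ∈ G' (a + w j.succ))
    (hy : ∀ a, ∀ x ∈ G' a, y x ∈ G (a + w 0)) (a : Fin r → ℤ)
    (f : ∀ i, kosLen (fun j => w j.succ) G a i ≠ ⊤)
    (f' : ∀ i, kosLen (fun j => w j.succ) G' (a - w 0) i ≠ ⊤) :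
    (∀ i, hLen (coneD y) (conePiece w G G' a) i ≠ ⊤) ∧
      altSum (n + 2) (hLen (coneD y) (conePiece w G G' a)) =
        kCoeff (fun j => w j.succ) G a - kCoeff (fun j => w j.succ) G' (a - w 0) := by
  have cG := koszulPiece_isCx (w := fun j => w j.succ) hG a
  have cC := conePiece_isCx hG hG' hy a
  -- The first summand is a subcomplex, isomorphic to the Koszul complex of `G`; the quotient is
  -- that of `G'`, shifted by one and with negated differential. The shift produces the minus sign
  -- in the Euler characteristic.
  let D : ℕ → Submodule k ((Finset (Fin n) → M) × (Finset (Fin n) → M)) := fun i =>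
    (koszulPiece (fun j => w j.succ) G i a).map (LinearMap.inl k _ _)
  have hinl : ∀ x, LinearMap.inl k (Finset (Fin n) → M) (Finset (Fin n) → M)
      (koszulDk k n M x) = coneD y (LinearMap.inl k _ _ x) := by
    intro x
    rw [coneD_apply]
    ext S <;> simp
  have hDlen : ∀ i, hLen (coneD y) D i = kosLen (fun j => w j.succ) G a i :=
    fun i => hLen_map (d := koszulDk k n M) (d' := coneD y)
      (C := fun i => koszulPiece (fun j => w j.succ) G i a)
      (LinearMap.inl k _ _) LinearMap.inl_injective cG hinl i
  have hmemD : ∀ i p, p ∈ D i ↔ p.1 ∈ koszulPiece (fun j => w j.succ) G i a ∧ p.2 = 0 := by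
    rintro i ⟨u, v⟩
    constructor
    · rintro ⟨x, hx, e⟩
      simp only [LinearMap.inl_apply, Prod.mk.injEq] at e
      obtain ⟨rfl, rfl⟩ := e
      exact ⟨hx, rfl⟩
    · rintro ⟨hu, rfl⟩
      exact ⟨u, hu, rfl⟩
  have cD : IsCx (coneD y) D := by
    refine ⟨cC.sq, ?_, ?_⟩
    · rintro i _ ⟨_, ⟨x, hx, rfl⟩, rfl⟩
      exact ⟨_, cG.map_le i ⟨x, hx, rfl⟩, hinl x⟩
    · rintro _ ⟨x, hx, rfl⟩
      rw [LinearMap.mem_ker, ← hinl, LinearMap.mem_ker.1 (cG.zero_le hx), map_zero]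
  have hDC : ∀ i, D i ≤ conePiece w G G' a i := by
    rintro i _ ⟨x, hx, rfl⟩
    exact ⟨hx, Submodule.zero_mem _⟩
  have hq : ∀ i, quotLen (coneD y) D (conePiece w G G' a) i =
      hLen (koszulDk k n M)
        (shiftCx fun i => koszulPiece (fun j => w j.succ) G' i (a - w 0)) i := by
    intro i
    rw [← hLen_neg]
    refine quotLen_eq_hLen cC hDC (LinearMap.snd k _ _) (fun _ _ _ => rfl) ?_ ?_ i
    · intro i
      ext ⟨u, v⟩
      rw [hmemD, Submodule.mem_inf, LinearMap.mem_ker]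
      constructor
      · rintro ⟨⟨h1, -⟩, h2⟩
        exact ⟨h1, h2⟩
      · rintro ⟨h1, h2⟩
        refine ⟨⟨h1, ?_⟩, h2⟩
        change v = 0 at h2
        subst h2
        exact Submodule.zero_mem _
    · intro i
      ext v
      constructor
      · rintro ⟨p, hp, rfl⟩
        exact hp.2
      · intro hv
        exact ⟨(0, v), ⟨Submodule.zero_mem _, hv⟩, rfl⟩
  have fD : ∀ i, hLen (coneD y) D i ≠ ⊤ := fun i => by rw [hDlen]; exact f i
  have fQ : ∀ i, quotLen (coneD y) D (conePiece w G G' a) i ≠ ⊤ := by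
    intro i
    rw [hq]
    cases i with
    | zero => rw [hLen_shiftCx_zero]; exact ENat.zero_ne_top
    | succ i => exact f' i
  have fC := hLen_ne_top_of_quot cD cC hDC fD fQ
  refine ⟨fC, ?_⟩
  rw [altSum_quot cD cC hDC (conePiece_eq_bot G G' a) fD fC, funext hDlen, altSum_kosLen_add_two,
    funext hq, altSum_succ, hLen_shiftCx_zero, kCoeff_eq_altSum (fun j => w j.succ) G']
  simp only [ENat.toNat_zero, Nat.cast_zero, zero_sub, ← sub_eq_add_neg]
  rfl

/-- The homology of a cone may be computed on a piece of a filtration, if multiplication by `y` is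
an isomorphism on the quotients. -/
theorem coneLen_of_filtration {F F' G : (Fin r → ℤ) → Submodule k M}
    (hF : ∀ j a, ∀ x ∈ F a, (X j : MvPolynomial (Fin n) k) • x ∈ F (a + w j.succ))
    (hF' : ∀ j a, ∀ x ∈ F' a, (X j : MvPolynomial (Fin n) k) • x ∈ F' (a + w j.succ))
    (hG : ∀ j a, ∀ x ∈ G a, (X j : MvPolynomial (Fin n) k) • x ∈ G (a + w j.succ))
    (hyF : ∀ a, ∀ x ∈ F' a, y x ∈ F (a + w 0)) (hyG : ∀ a, ∀ x ∈ G a, y x ∈ G (a + w 0))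
    (hFG : ∀ a, F a ≤ G a) (hFG' : ∀ a, F' a ≤ G a)
    (hinj : ∀ a, ∀ x ∈ G a, y x ∈ F (a + w 0) → x ∈ F' a)
    (hsurj : ∀ a, ∀ x ∈ G a, ∃ x₀ ∈ F a, ∃ x' ∈ G (a - w 0), x = x₀ + y x')
    (a : Fin r → ℤ)
    (f : ∀ i, kosLen (fun j => w j.succ) F a i ≠ ⊤)
    (f' : ∀ i, kosLen (fun j => w j.succ) F' (a - w 0) i ≠ ⊤) :
    (∀ i, hLen (coneD y) (conePiece w G G a) i ≠ ⊤) ∧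
      altSum (n + 2) (hLen (coneD y) (conePiece w G G a)) =
        kCoeff (fun j => w j.succ) F a - kCoeff (fun j => w j.succ) F' (a - w 0) := by
  have cD := conePiece_isCx hF hF' hyF a
  have cC := conePiece_isCx hG hG hyG a
  obtain ⟨fD, eD⟩ := coneLen_of_kosLen hF hF' hyF a f f'
  have hDC : ∀ i, conePiece w F F' a i ≤ conePiece w G G a i := by
    intro i
    refine Submodule.prod_mono (koszulPiece_mono hFG i a) ?_
    cases i with
    | zero => exact le_rfl
    | succ i => exact koszulPiece_mono hFG' i _
  have hq : ∀ i, quotLen (coneD y) (conePiece w F F' a) (conePiece w G G a) i = 0 := by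
    intro i
    refine relLen_eq_zero ?_
    rintro ⟨u, v⟩ ⟨⟨hu, hv⟩, hd⟩
    simp only at hu hv
    rw [SetLike.mem_coe, mem_koszulPiece] at hu
    choose! u₀ hu₀ v' hv' e using fun S hS => hsurj _ _ ((hu S).1 hS)
    -- The quotient complex is acyclic. Writing `u = u₀ + y v'`, subtraction of the boundary of `(0,
    -- v')` brings the first entry into `F`. Since the differential of the difference still lies in
    -- the subcomplex, `y` then maps its second entry into `F`, and `hinj` puts that entry in `F'`.
    let c' : (Finset (Fin n) → M) × (Finset (Fin n) → M) :=
      (0, fun S => if S.card = i then v' S else 0)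
    have hc' : c' ∈ conePiece w G G a (i + 1) := by
      refine ⟨Submodule.zero_mem _, ?_⟩
      change _ ∈ koszulPiece (fun j => w j.succ) G i (a - w 0)
      rw [mem_koszulPiece]
      intro S
      refine ⟨fun hS => ?_, fun hS => if_neg hS⟩
      change (if S.card = i then v' S else 0) ∈ _
      rw [if_pos hS, show a - w 0 - ∑ j ∈ S, w j.succ = a - ∑ j ∈ S, w j.succ - w 0 by abel]
      exact hv' S hS
    have hd' : coneD y ((u, v) - coneD y c') ∈ conePiece w F F' a (i - 1) := by
      rw [map_sub, cC.sq, sub_zero]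
      exact hd
    have hcG : (u, v) - coneD y c' ∈ conePiece w G G a i :=
      Submodule.sub_mem _ ⟨by rw [SetLike.mem_coe, mem_koszulPiece]; exact hu, hv⟩
        (cC.map_le i ⟨c', hc', rfl⟩)
    have hmem : (u, v) - coneD y c' ∈ conePiece w F F' a i := by
      have h1 : ((u, v) - coneD y c').1 ∈ koszulPiece (fun j => w j.succ) F i a := by
        rw [mem_koszulPiece]
        intro S
        have hS1 : ((u, v) - coneD y c').1 S = u S - y (if S.card = i then v' S else 0) := by
          rw [coneD_apply]
          simp [c']
        rw [hS1]
        refine ⟨fun hS => ?_, fun hS => ?_⟩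
        · rw [if_pos hS, e S hS, add_sub_cancel_right]
          exact hu₀ S hS
        · rw [if_neg hS, (hu S).2 hS, map_zero, sub_zero]
      refine ⟨h1, ?_⟩
      cases i with
      | zero => exact hcG.2
      | succ i =>
        generalize (u, v) - coneD y c' = p at hd' hcG h1
        obtain ⟨p1, p2⟩ := p
        rw [coneD_apply] at hd'
        have h2 := hd'.1
        have h3 : p2 ∈ koszulPiece (fun j => w j.succ) G i (a - w 0) := hcG.2
        have h4 := (koszulPiece_isCx (w := fun j => w j.succ) hF a).map_le i ⟨p1, h1, rfl⟩
        have h5 := Submodule.sub_mem _ h2 h4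
        change p2 ∈ koszulPiece (fun j => w j.succ) F' i (a - w 0)
        rw [mem_koszulPiece] at h3 h5 ⊢
        intro S
        refine ⟨fun hS => ?_, (h3 S).2⟩
        refine hinj _ _ ((h3 S).1 hS) ?_
        have := (h5 S).1 hS
        rw [show a - w 0 - ∑ j ∈ S, w j.succ + w 0 = a - ∑ j ∈ S, w j.succ by abel]
        simpa using this
    exact Submodule.mem_sup.2 ⟨_, ⟨c', hc', rfl⟩, _, hmem, by abel⟩
  have fC := hLen_ne_top_of_quot cD cC hDC fD fun i => by rw [hq]; exact ENat.zero_ne_top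
  refine ⟨fC, ?_⟩
  rw [altSum_quot cD cC hDC (conePiece_eq_bot G G a) fD fC, eD, funext hq]
  simp [altSum]

/-- The subset of the last `n` variables contained in a set of variables. -/
def predSet (T : Finset (Fin (n + 1))) : Finset (Fin n) := Finset.univ.filter fun i => i.succ ∈ T

theorem predSet_map (S : Finset (Fin n)) : predSet (S.map (Fin.succEmb n)) = S := by
  ext i
  simp [predSet]

theorem predSet_insert_zero (T : Finset (Fin (n + 1))) : predSet (insert 0 T) = predSet T := by
  ext i
  simp [predSet, Fin.succ_ne_zero]

theorem map_predSet {T : Finset (Fin (n + 1))} (h : 0 ∉ T) :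
    (predSet T).map (Fin.succEmb n) = T := by
  ext i
  refine Fin.cases ?_ (fun i => ?_) i
  · simp [h, Fin.succ_ne_zero]
  · simp [predSet]

theorem insert_map_predSet {T : Finset (Fin (n + 1))} (h : 0 ∈ T) :
    insert 0 ((predSet T).map (Fin.succEmb n)) = T := by
  ext i
  refine Fin.cases ?_ (fun i => ?_) i
  · simp [h]
  · simp [predSet, Fin.succ_ne_zero]

theorem zero_notMem_map (S : Finset (Fin n)) : 0 ∉ S.map (Fin.succEmb n) := by
  simp [Fin.succ_ne_zero]

/-- Decomposition of the Koszul chains on `n + 1` variables. -/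
def splitChains (φ : N ≃ₗ[k] M) : (Finset (Fin (n + 1)) → N) ≃ₗ[k]
    ((Finset (Fin n) → M) × (Finset (Fin n) → M)) where
  toFun f := (fun S => φ (f (S.map (Fin.succEmb n))),
    fun S => φ (f (insert 0 (S.map (Fin.succEmb n)))))
  map_add' f g := by ext S <;> simp
  map_smul' c f := by ext S <;> simp
  invFun p T := if 0 ∈ T then φ.symm (p.2 (predSet T)) else φ.symm (p.1 (predSet T))
  left_inv f := by
    ext T
    simp only [LinearEquiv.symm_apply_apply]
    split_ifs with h
    · rw [insert_map_predSet h]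
    · rw [map_predSet h]
  right_inv p := by
    ext S
    · simp [predSet_map]
    · simp [predSet_insert_zero, predSet_map]

/-- The variable `0` is smallest: removing it carries the sign `+1`, and its presence in a set flips
the sign of every other removal. That flip is the minus sign in `coneD`. -/
theorem splitChains_koszulD (φ : N ≃ₗ[k] M)
    (hφ0 : ∀ f, φ ((X 0 : MvPolynomial (Fin (n + 1)) k) • f) = y (φ f))
    (hφ : ∀ (j : Fin n) f, φ ((X j.succ : MvPolynomial (Fin (n + 1)) k) • f) =
      (X j : MvPolynomial (Fin n) k) • φ f)
    (f : Finset (Fin (n + 1)) → N) :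
    splitChains φ (koszulDk k (n + 1) N f) = coneD y (splitChains φ f) := by
  have hpow : ∀ (c : ℕ) (j : Fin n) (x : N),
      φ (((-1) ^ c * X j.succ : MvPolynomial (Fin (n + 1)) k) • x) =
        ((-1) ^ c * X j : MvPolynomial (Fin n) k) • φ x := by
    intro c j x
    rw [mul_smul, mul_smul]
    rcases Nat.even_or_odd c with h | h
    · rw [h.neg_one_pow, h.neg_one_pow, one_smul, one_smul, hφ]
    · rw [h.neg_one_pow, h.neg_one_pow, neg_smul, neg_smul, one_smul, one_smul, map_neg, hφ]
  have hfil : ∀ (S : Finset (Fin n)) (j : Fin n),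
      ((S.map (Fin.succEmb n)).filter (· < j.succ)).card = (S.filter (· < j)).card := by
    intro S j
    rw [Finset.filter_map, Finset.card_map]
    congr 1
    ext i
    rw [Finset.mem_filter, Finset.mem_filter, Function.comp_apply, Fin.coe_succEmb,
      Fin.succ_lt_succ_iff]
  have hcompl : ∀ S : Finset (Fin n), (S.map (Fin.succEmb n))ᶜ =
      insert 0 (Sᶜ.map (Fin.succEmb n)) := by
    intro S
    ext i
    refine Fin.cases ?_ (fun i => ?_) i
    · simp [Fin.succ_ne_zero]
    · simp [Fin.succ_ne_zero]
  have hcompl' : ∀ S : Finset (Fin n), (insert 0 (S.map (Fin.succEmb n)))ᶜ =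
      Sᶜ.map (Fin.succEmb n) := by
    intro S
    ext i
    refine Fin.cases ?_ (fun i => ?_) i
    · simp [Fin.succ_ne_zero]
    · simp [Fin.succ_ne_zero]
  rw [coneD_apply]
  refine Prod.ext ?_ ?_
  · ext S
    change φ (koszulD k (n + 1) N f (S.map (Fin.succEmb n))) = koszulD k n M _ S + y (φ _)
    rw [koszulD_apply, koszulD_apply, hcompl, Finset.sum_insert (zero_notMem_map _),
      Finset.sum_map, map_add, map_sum, add_comm]
    congr 1
    · refine Finset.sum_congr rfl fun j _ => ?_
      rw [Fin.coe_succEmb, hpow, hfil]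
      simp [splitChains]
    · simp [hφ0]
  · ext S
    change φ (koszulD k (n + 1) N f (insert 0 (S.map (Fin.succEmb n)))) = -koszulD k n M _ S
    rw [koszulD_apply, koszulD_apply, hcompl', Finset.sum_map, map_sum, ← Finset.sum_neg_distrib]
    refine Finset.sum_congr rfl fun j _ => ?_
    rw [Fin.coe_succEmb, hpow, Finset.filter_insert, if_pos (Fin.succ_pos j),
      Finset.card_insert_of_notMem (by simp [Fin.succ_ne_zero]), hfil, Finset.insert_comm,
      ← neg_smul]
    simp [splitChains, pow_succ]

theorem splitChains_koszulPiece (φ : N ≃ₗ[k] M) (G : (Fin r → ℤ) → Submodule k N) (i : ℕ)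
    (a : Fin r → ℤ) :
    (koszulPiece w G i a).map (splitChains (n := n) φ).toLinearMap =
      conePiece w (fun a => (G a).map (φ : N →ₗ[k] M)) (fun a => (G a).map (φ : N →ₗ[k] M)) a
        i := by
  have hmem : ∀ a x, φ x ∈ (G a).map (φ : N →ₗ[k] M) ↔ x ∈ G a := fun a x =>
    ⟨fun ⟨_, hy, e⟩ => φ.injective e ▸ hy, fun h => ⟨x, h, rfl⟩⟩
  ext p
  obtain ⟨f, rfl⟩ := (splitChains φ).surjective p
  rw [Submodule.mem_map_equiv, LinearEquiv.symm_apply_apply, conePiece, Submodule.mem_prod,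
    mem_koszulPiece, mem_koszulPiece]
  have hsum : ∀ S : Finset (Fin n), ∑ j ∈ S.map (Fin.succEmb n), w j = ∑ j ∈ S, w j.succ :=
    fun S => Finset.sum_map _ _ _
  have hsum' : ∀ S : Finset (Fin n), ∑ j ∈ insert 0 (S.map (Fin.succEmb n)), w j =
      w 0 + ∑ j ∈ S, w j.succ := fun S => by
    rw [Finset.sum_insert (zero_notMem_map _), hsum]
  have hc : ∀ S : Finset (Fin n), (S.map (Fin.succEmb n)).card = S.card :=
    fun S => Finset.card_map _
  have hc' : ∀ S : Finset (Fin n), (insert 0 (S.map (Fin.succEmb n))).card = S.card + 1 :=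
    fun S => by rw [Finset.card_insert_of_notMem (zero_notMem_map _), hc]
  have key1 : ∀ S : Finset (Fin n),
      (((splitChains φ) f).1 S ∈ (G (a - ∑ j ∈ S, w j.succ)).map (φ : N →ₗ[k] M) ↔
        f (S.map (Fin.succEmb n)) ∈ G (a - ∑ j ∈ S.map (Fin.succEmb n), w j)) ∧
      (((splitChains φ) f).1 S = 0 ↔ f (S.map (Fin.succEmb n)) = 0) := by
    intro S
    rw [hsum]
    exact ⟨hmem _ _, φ.map_eq_zero_iff⟩
  have key2 : ∀ S : Finset (Fin n),
      (((splitChains φ) f).2 S ∈ (G (a - w 0 - ∑ j ∈ S, w j.succ)).map (φ : N →ₗ[k] M) ↔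
        f (insert 0 (S.map (Fin.succEmb n))) ∈
          G (a - ∑ j ∈ insert 0 (S.map (Fin.succEmb n)), w j)) ∧
      (((splitChains φ) f).2 S = 0 ↔ f (insert 0 (S.map (Fin.succEmb n))) = 0) := by
    intro S
    rw [hsum', ← sub_sub]
    exact ⟨hmem _ _, φ.map_eq_zero_iff⟩
  have hall : ∀ P : Finset (Fin (n + 1)) → Prop, (∀ T, P T) ↔
      (∀ S : Finset (Fin n), P (S.map (Fin.succEmb n))) ∧
        ∀ S : Finset (Fin n), P (insert 0 (S.map (Fin.succEmb n))) := by
    intro P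
    refine ⟨fun h => ⟨fun S => h _, fun S => h _⟩, fun h T => ?_⟩
    by_cases hT : 0 ∈ T
    · rw [← insert_map_predSet hT]; exact h.2 _
    · rw [← map_predSet hT]; exact h.1 _
  rw [hall]
  refine and_congr (forall_congr' fun S => ?_) ?_
  · rw [(key1 S).1, (key1 S).2, hc]
  · cases i with
    | zero =>
      simp only [shiftCx, Submodule.mem_bot, _root_.funext_iff, Pi.zero_apply]
      refine forall_congr' fun S => ?_
      rw [(key2 S).2, hc']
      simp
    | succ i =>
      rw [shiftCx, mem_koszulPiece]
      refine forall_congr' fun S => ?_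
      rw [(key2 S).1, (key2 S).2, hc']
      simp

end Cone

/-! ### Homogeneous ideals, leading coefficient ideals in `x_0`, and the filtration by `x_0`-degree.
-/

section Homogeneous

variable {k : Type*} [Field k] {m n r : ℕ}

/-- The ideal `I` is homogeneous for the grading with `x_i` of degree `w i`. -/
def IsHomog (w : Fin m → Fin r → ℤ) (I : Ideal (MvPolynomial (Fin m) k)) : Prop :=
  ∀ f ∈ I, ∀ a, weightedHomogeneousComponent w a f ∈ I

theorem coaction_monomial (w : Fin m → Fin r → ℤ) (d : Fin m →₀ ℕ) (c : k) :
    coaction w (monomial d c) = AddMonoidAlgebra.single (Finsupp.weight w d) (monomial d c) := by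
  rw [coaction, aeval_monomial, Finsupp.prod]
  simp only [AddMonoidAlgebra.single_pow]
  have h : ∀ s : Finset (Fin m), ∏ i ∈ s, AddMonoidAlgebra.single (d i • w i) (X i ^ d i) =
      AddMonoidAlgebra.single (∑ i ∈ s, d i • w i)
        (∏ i ∈ s, X i ^ d i : MvPolynomial (Fin m) k) := by
    intro s
    induction s using Finset.induction_on with
    | empty => simp [AddMonoidAlgebra.one_def]
    | insert i s hi ih =>
      rw [Finset.prod_insert hi, Finset.prod_insert hi, Finset.sum_insert hi, ih,
        AddMonoidAlgebra.single_mul_single]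
  rw [h, AddMonoidAlgebra.coe_algebraMap, Function.comp_apply,
    AddMonoidAlgebra.single_mul_single, zero_add, monomial_eq, Finsupp.weight_apply]
  rfl

theorem coeff_coaction (w : Fin m → Fin r → ℤ) (f : MvPolynomial (Fin m) k) (a : Fin r → ℤ) :
    (coaction w f).coeff a = weightedHomogeneousComponent w a f := by
  classical
  induction f using MvPolynomial.induction_on' with
  | add p q hp hq => rw [map_add, AddMonoidAlgebra.coeff_add, Finsupp.add_apply, hp, hq, map_add]
  | monomial d c =>
    rw [coaction_monomial, AddMonoidAlgebra.coeff_single]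
    ext e
    rw [coeff_weightedHomogeneousComponent, Finsupp.single_apply]
    split_ifs with h1 h2 h2
    · rfl
    · rw [coeff_monomial, if_neg]
      rintro rfl
      exact h2 h1
    · rw [coeff_monomial, if_neg, coeff_zero]
      rintro rfl
      exact h1 h2
    · rfl

/-- The coefficient of `t^a` in the pullback of `f` is its component of weight `a`
(`coeff_coaction`), and a Laurent polynomial lies in the extension of `I` exactly when all its
coefficients lie in `I`. -/
theorem isInvariant_iff_isHomog (w : Fin m → Fin r → ℤ) (I : Ideal (MvPolynomial (Fin m) k)) :
    IsInvariant w I ↔ IsHomog w I := by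
  constructor
  · intro h f hf a
    have hker : I.map (algebraMap (MvPolynomial (Fin m) k)
        (AddMonoidAlgebra (MvPolynomial (Fin m) k) (Fin r → ℤ))) ≤
        RingHom.ker (AddMonoidAlgebra.mapRingHom (Fin r → ℤ) (Ideal.Quotient.mk I)) := by
      rw [Ideal.map_le_iff_le_comap]
      intro g hg
      rw [Ideal.mem_comap, RingHom.mem_ker]
      ext b
      rw [AddMonoidAlgebra.coeff_mapRingHom, AddMonoidAlgebra.coe_algebraMap, Function.comp_apply,
        AddMonoidAlgebra.coeff_single]
      by_cases hb : b = 0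
      · subst hb
        simpa using Ideal.Quotient.eq_zero_iff_mem.2 hg
      · simp [Ne.symm hb]
    have h1 := hker (h (Ideal.mem_map_of_mem _ hf))
    rw [RingHom.mem_ker] at h1
    have h2 := congrArg (fun g => g.coeff a) h1
    simp only [AddMonoidAlgebra.coeff_mapRingHom] at h2
    rw [← coeff_coaction]
    exact Ideal.Quotient.eq_zero_iff_mem.1 h2
  · intro h
    rw [IsInvariant, Ideal.map_le_iff_le_comap]
    intro f hf
    rw [Ideal.mem_comap, ← AddMonoidAlgebra.sum_coeff_single (coaction w f)]
    refine Ideal.sum_mem _ fun a _ => ?_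
    have e : AddMonoidAlgebra.single a ((coaction w f).coeff a) =
        AddMonoidAlgebra.single a 1 * algebraMap (MvPolynomial (Fin m) k)
          (AddMonoidAlgebra (MvPolynomial (Fin m) k) (Fin r → ℤ))
          (weightedHomogeneousComponent w a f) := by
      rw [AddMonoidAlgebra.coe_algebraMap, Function.comp_apply,
        AddMonoidAlgebra.single_mul_single, coeff_coaction]
      simp
    simp only [e]
    exact Ideal.mul_mem_left _ _ (Ideal.mem_map_of_mem _ (h f hf a))

/-- The part of degree `a` of the ideal `I`. -/
def idealPiece (w : Fin m → Fin r → ℤ) (I : Ideal (MvPolynomial (Fin m) k)) (a : Fin r → ℤ) :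
    Submodule k (MvPolynomial (Fin m) k) :=
  I.restrictScalars k ⊓ weightedHomogeneousSubmodule k w a

theorem mem_idealPiece {w : Fin m → Fin r → ℤ} {I : Ideal (MvPolynomial (Fin m) k)}
    {a : Fin r → ℤ} {f : MvPolynomial (Fin m) k} :
    f ∈ idealPiece w I a ↔ f ∈ I ∧ IsWeightedHomogeneous w f a := Iff.rfl

theorem X_smul_mem_idealPiece {w : Fin m → Fin r → ℤ} {I : Ideal (MvPolynomial (Fin m) k)}
    (j : Fin m) (a : Fin r → ℤ) (f : MvPolynomial (Fin m) k) (hf : f ∈ idealPiece w I a) :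
    (X j : MvPolynomial (Fin m) k) • f ∈ idealPiece w I (a + w j) := by
  rw [mem_idealPiece] at hf ⊢
  refine ⟨Ideal.mul_mem_left _ _ hf.1, ?_⟩
  rw [add_comm]
  exact (isWeightedHomogeneous_X k w j).mul hf.2

theorem gradedPiece_smul {w : Fin m → Fin r → ℤ} {I : Ideal (MvPolynomial (Fin m) k)}
    (a : Fin r → ℤ) (y : MvPolynomial (Fin m) k ⧸ I) :
    y ∈ gradedPiece w I a ↔ ∃ x ∈ idealPiece w ⊤ a, I.mkQ x = y := by
  constructor
  · rintro ⟨x, hx, rfl⟩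
    exact ⟨x, ⟨trivial, hx⟩, rfl⟩
  · rintro ⟨x, hx, rfl⟩
    exact ⟨x, hx.2, rfl⟩

/-- The `K`-polynomial of `R / I` from those of `R` and `I`. -/
theorem kCoeff_gradedPiece {w : Fin m → Fin r → ℤ} {I : Ideal (MvPolynomial (Fin m) k)}
    (a : Fin r → ℤ) (f : ∀ i, kosLen w (idealPiece w I) a i ≠ ⊤)
    (f' : ∀ i, kosLen w (idealPiece w (⊤ : Ideal (MvPolynomial (Fin m) k))) a i ≠ ⊤) :
    kCoeff w (gradedPiece w I) a = kCoeff w (idealPiece w (⊤ : Ideal (MvPolynomial (Fin m) k))) a -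
      kCoeff w (idealPiece w I) a := by
  have := (kosLen_exact (F := idealPiece w I)
    (G := idealPiece w (⊤ : Ideal (MvPolynomial (Fin m) k))) (Q := gradedPiece w I) 0
    X_smul_mem_idealPiece X_smul_mem_idealPiece (Submodule.mkQ I) ?_ ?_ a f).2 f'
  · rw [this, sub_zero]
    ring
  · intro a x
    rw [mem_idealPiece, mem_idealPiece, Submodule.mkQ_apply, Submodule.Quotient.mk_eq_zero]
    simp [and_comm]
  · intro a y
    rw [sub_zero]
    exact gradedPiece_smul a y

/-- The ideal `I`, in the ring of polynomials in `x_0` over the polynomials in the other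
variables. -/
def polyIdeal (I : Ideal (MvPolynomial (Fin (n + 1)) k)) :
    Ideal (Polynomial (MvPolynomial (Fin n) k)) :=
  I.comap (MvPolynomial.finSuccEquiv k n).symm

theorem mem_polyIdeal {I : Ideal (MvPolynomial (Fin (n + 1)) k)}
    {f : Polynomial (MvPolynomial (Fin n) k)} :
    f ∈ polyIdeal I ↔ (MvPolynomial.finSuccEquiv k n).symm f ∈ I := Iff.rfl

theorem finSuccEquiv_mem_polyIdeal {I : Ideal (MvPolynomial (Fin (n + 1)) k)}
    {f : MvPolynomial (Fin (n + 1)) k} :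
    MvPolynomial.finSuccEquiv k n f ∈ polyIdeal I ↔ f ∈ I := by
  rw [mem_polyIdeal, AlgEquiv.symm_apply_apply]

theorem weight_cons (w : Fin (n + 1) → Fin r → ℤ) (i : ℕ) (d : Fin n →₀ ℕ) :
    Finsupp.weight w (d.cons i) = i • w 0 + Finsupp.weight (fun j : Fin n => w j.succ) d := by
  rw [Finsupp.weight_apply, Finsupp.weight_apply, Finsupp.sum_fintype _ _ (by simp),
    Finsupp.sum_fintype _ _ (by simp), Fin.sum_univ_succ]
  simp

/-- The component of degree `a` of a polynomial in `x_0`. -/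
def polyComp (w : Fin (n + 1) → Fin r → ℤ) (a : Fin r → ℤ)
    (f : Polynomial (MvPolynomial (Fin n) k)) : Polynomial (MvPolynomial (Fin n) k) :=
  MvPolynomial.finSuccEquiv k n
    (weightedHomogeneousComponent w a ((MvPolynomial.finSuccEquiv k n).symm f))

theorem coeff_polyComp (w : Fin (n + 1) → Fin r → ℤ) (a : Fin r → ℤ)
    (f : Polynomial (MvPolynomial (Fin n) k)) (i : ℕ) :
    (polyComp w a f).coeff i =
      weightedHomogeneousComponent (fun j : Fin n => w j.succ) (a - i • w 0) (f.coeff i) := by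
  classical
  ext d
  rw [polyComp, finSuccEquiv_coeff_coeff, coeff_weightedHomogeneousComponent,
    coeff_weightedHomogeneousComponent, weight_cons, ← finSuccEquiv_coeff_coeff,
    AlgEquiv.apply_symm_apply]
  refine if_congr ?_ rfl rfl
  rw [eq_sub_iff_add_eq, add_comm]

theorem isWeightedHomogeneous_iff_coeff (w : Fin (n + 1) → Fin r → ℤ) (a : Fin r → ℤ)
    (f : MvPolynomial (Fin (n + 1)) k) :
    IsWeightedHomogeneous w f a ↔ ∀ i, IsWeightedHomogeneous (fun j : Fin n => w j.succ)
      ((MvPolynomial.finSuccEquiv k n f).coeff i) (a - i • w 0) := by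
  constructor
  · intro h i d hd
    rw [finSuccEquiv_coeff_coeff] at hd
    have := h hd
    rw [weight_cons] at this
    rw [← this, add_sub_cancel_left]
  · intro h d hd
    rw [← Finsupp.cons_tail d] at hd ⊢
    rw [← finSuccEquiv_coeff_coeff] at hd
    rw [weight_cons, h _ hd, add_sub_cancel]

theorem IsHomog.polyComp_mem {w : Fin (n + 1) → Fin r → ℤ}
    {I : Ideal (MvPolynomial (Fin (n + 1)) k)} (h : IsHomog w I)
    {f : Polynomial (MvPolynomial (Fin n) k)} (hf : f ∈ polyIdeal I) (a : Fin r → ℤ) :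
    polyComp w a f ∈ polyIdeal I :=
  finSuccEquiv_mem_polyIdeal.2 (h _ (mem_polyIdeal.1 hf) a)

theorem mem_leadingCoeffNth_iff_coeff {A : Type*} [CommRing A] {J : Ideal (Polynomial A)} {i : ℕ}
    {x : A} : x ∈ J.leadingCoeffNth i ↔ ∃ p ∈ J, p.degree < (i + 1 : ℕ) ∧ p.coeff i = x := by
  have hd : ∀ p : Polynomial A, p.degree < (i + 1 : ℕ) ↔ p.degree ≤ i := fun p => by
    rw [Polynomial.degree_lt_iff_coeff_zero, Polynomial.degree_le_iff_coeff_zero]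
    refine forall_congr' fun m => ?_
    rw [Nat.cast_lt]
    exact Iff.rfl
  rw [Ideal.leadingCoeffNth]
  simp only [Submodule.mem_map, Submodule.mem_inf, Ideal.degreeLE, hd]
  constructor
  · rintro ⟨p, ⟨h1, h2⟩, rfl⟩
    exact ⟨p, h2, Polynomial.mem_degreeLE.1 h1, rfl⟩
  · rintro ⟨p, h1, h2, rfl⟩
    exact ⟨p, ⟨Polynomial.mem_degreeLE.2 h2, h1⟩, rfl⟩

theorem degree_polyComp_lt {w : Fin (n + 1) → Fin r → ℤ} {a : Fin r → ℤ}
    {f : Polynomial (MvPolynomial (Fin n) k)} {N : ℕ} (h : f.degree < N) :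
    (polyComp w a f).degree < N := by
  rw [Polynomial.degree_lt_iff_coeff_zero] at h ⊢
  intro i hi
  rw [coeff_polyComp, h i hi, map_zero]

theorem IsHomog.leadingCoeffNth {w : Fin (n + 1) → Fin r → ℤ}
    {I : Ideal (MvPolynomial (Fin (n + 1)) k)} (h : IsHomog w I) (i : ℕ) :
    IsHomog (fun j : Fin n => w j.succ) ((polyIdeal I).leadingCoeffNth i) := by
  intro x hx a
  rw [mem_leadingCoeffNth_iff_coeff] at hx ⊢
  obtain ⟨p, hp, hd, rfl⟩ := hx
  -- The power `x_0^i` has degree `i • w 0`, so in this component of `p` the coefficient of `x_0^i`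
  -- has degree `a`.
  refine ⟨polyComp w (a + i • w 0) p, h.polyComp_mem hp _, degree_polyComp_lt hd, ?_⟩
  rw [coeff_polyComp, add_sub_cancel_right]

theorem exists_stable_leadingCoeffNth {A : Type*} [CommRing A] [IsNoetherianRing A]
    (J : Ideal (Polynomial A)) :
    ∃ N, ∀ i, N ≤ i → J.leadingCoeffNth i = J.leadingCoeffNth N := by
  obtain ⟨N, hN⟩ := monotone_stabilizes_iff_noetherian.2 (inferInstance : IsNoetherianRing A)
    ⟨J.leadingCoeffNth, fun _ _ => J.leadingCoeffNth_mono⟩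
  exact ⟨N, fun i hi => (hN i hi).symm⟩

theorem leadingCoeff_eq_of_stable {A : Type*} [CommRing A] {J : Ideal (Polynomial A)} {N : ℕ}
    (hN : ∀ i, N ≤ i → J.leadingCoeffNth i = J.leadingCoeffNth N) :
    J.leadingCoeff = J.leadingCoeffNth N := by
  refine le_antisymm (iSup_le fun i => ?_) (le_iSup _ N)
  rcases le_total i N with h | h
  · exact J.leadingCoeffNth_mono h
  · exact (hN i h).le

/-- Elements of `J` of degree at most `d` in `x_0`, modulo `x_0 J`. -/
theorem exists_eq_add_X_mul {A : Type*} [CommRing A] {J : Ideal (Polynomial A)} {N : ℕ}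
    (hN : ∀ i, N ≤ i → J.leadingCoeffNth i = J.leadingCoeffNth N)
    (f : Polynomial A) (hf : f ∈ J) :
    ∃ f₀ ∈ J, f₀.degree < (N + 1 : ℕ) ∧ ∃ f' ∈ J, f = f₀ + Polynomial.X * f' := by
  have key : ∀ d : ℕ, ∀ f ∈ J, f.degree < (N + 1 + d : ℕ) →
      ∃ f₀ ∈ J, f₀.degree < (N + 1 : ℕ) ∧ ∃ f' ∈ J, f = f₀ + Polynomial.X * f' := by
    intro d
    induction d with
    | zero => exact fun f hf hd => ⟨f, hf, hd, 0, J.zero_mem, by simp⟩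
    | succ d ih =>
      intro f hf hd
      -- By stability the top coefficient of `f` is already attained one degree lower, by some `g ∈
      -- J`; then `f - X g` has smaller degree and the induction applies.
      have h1 : f.coeff (N + 1 + d) ∈ J.leadingCoeffNth (N + d) := by
        rw [hN (N + d) (by omega), ← hN (N + 1 + d) (by omega), mem_leadingCoeffNth_iff_coeff]
        exact ⟨f, hf, hd, rfl⟩
      rw [mem_leadingCoeffNth_iff_coeff] at h1
      obtain ⟨g, hg, hgd, hgc⟩ := h1
      obtain ⟨f₀, hf₀, hd₀, f', hf', e⟩ := ih (f - Polynomial.X * g)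
        (J.sub_mem hf (J.mul_mem_left _ hg)) (by
          rw [Polynomial.degree_lt_iff_coeff_zero] at hd hgd ⊢
          intro i hi
          obtain ⟨i, rfl⟩ : ∃ j, i = j + 1 := ⟨i - 1, by omega⟩
          rw [Polynomial.coeff_sub, Polynomial.coeff_X_mul]
          rcases eq_or_lt_of_le hi with h | h
          · rw [← h, ← hgc, show N + d = i by omega, sub_self]
          · rw [hd _ (by omega), hgd _ (by omega), sub_self])
      refine ⟨f₀, hf₀, hd₀, f' + g, J.add_mem hf' hg, ?_⟩
      rw [mul_add, ← add_assoc, ← e]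
      ring
  refine key (f.natDegree + 1) f hf ?_
  refine lt_of_le_of_lt Polynomial.degree_le_natDegree ?_
  exact_mod_cast (by omega : f.natDegree < N + 1 + (f.natDegree + 1))

/-- The part of degree `a` of the ideal `J` of polynomials in `x_0`. -/
def polyPiece (w : Fin (n + 1) → Fin r → ℤ) (J : Ideal (Polynomial (MvPolynomial (Fin n) k)))
    (a : Fin r → ℤ) : Submodule k (Polynomial (MvPolynomial (Fin n) k)) where
  carrier := {f | f ∈ J ∧
    ∀ i, f.coeff i ∈ weightedHomogeneousSubmodule k (fun j : Fin n => w j.succ) (a - i • w 0)}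
  add_mem' := fun {f g} hf hg => ⟨J.add_mem hf.1 hg.1, fun i => by
    rw [Polynomial.coeff_add]; exact Submodule.add_mem _ (hf.2 i) (hg.2 i)⟩
  zero_mem' := ⟨J.zero_mem, fun i => by
    rw [Polynomial.coeff_zero]; exact Submodule.zero_mem _⟩
  smul_mem' := fun c f hf => ⟨Submodule.smul_of_tower_mem J c hf.1, fun i => by
    rw [Polynomial.coeff_smul]; exact Submodule.smul_mem _ _ (hf.2 i)⟩

theorem mem_polyPiece {w : Fin (n + 1) → Fin r → ℤ}
    {J : Ideal (Polynomial (MvPolynomial (Fin n) k))} {a : Fin r → ℤ}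
    {f : Polynomial (MvPolynomial (Fin n) k)} :
    f ∈ polyPiece w J a ↔ f ∈ J ∧
      ∀ i, IsWeightedHomogeneous (fun j : Fin n => w j.succ) (f.coeff i) (a - i • w 0) := Iff.rfl

theorem polyComp_mem_polyPiece {w : Fin (n + 1) → Fin r → ℤ}
    {I : Ideal (MvPolynomial (Fin (n + 1)) k)} (h : IsHomog w I)
    {f : Polynomial (MvPolynomial (Fin n) k)} (hf : f ∈ polyIdeal I) (a : Fin r → ℤ) :
    polyComp w a f ∈ polyPiece w (polyIdeal I) a := by
  refine ⟨h.polyComp_mem hf a, fun i => ?_⟩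
  rw [coeff_polyComp]
  exact weightedHomogeneousComponent_mem _ _ _

theorem polyComp_eq_self {w : Fin (n + 1) → Fin r → ℤ}
    {J : Ideal (Polynomial (MvPolynomial (Fin n) k))} {a : Fin r → ℤ}
    {f : Polynomial (MvPolynomial (Fin n) k)} (hf : f ∈ polyPiece w J a) : polyComp w a f = f := by
  ext1 i
  rw [coeff_polyComp]
  exact (hf.2 i : IsWeightedHomogeneous _ _ _).weightedHomogeneousComponent_same

/-- The part of degree `a` of the ideal `J`, restricted to polynomials of degree less than `N`. -/
def filtPiece (w : Fin (n + 1) → Fin r → ℤ) (J : Ideal (Polynomial (MvPolynomial (Fin n) k)))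
    (N : ℕ) (a : Fin r → ℤ) : Submodule k (Polynomial (MvPolynomial (Fin n) k)) :=
  polyPiece w J a ⊓ (Polynomial.degreeLT (MvPolynomial (Fin n) k) N).restrictScalars k

theorem mem_filtPiece {w : Fin (n + 1) → Fin r → ℤ}
    {J : Ideal (Polynomial (MvPolynomial (Fin n) k))} {a : Fin r → ℤ} {N : ℕ}
    {f : Polynomial (MvPolynomial (Fin n) k)} :
    f ∈ filtPiece w J N a ↔ f ∈ polyPiece w J a ∧ f.degree < N := by
  rw [filtPiece, Submodule.mem_inf, Submodule.restrictScalars_mem, Polynomial.mem_degreeLT]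

theorem X_smul_mem_polyPiece {w : Fin (n + 1) → Fin r → ℤ}
    {J : Ideal (Polynomial (MvPolynomial (Fin n) k))} (j : Fin n) (a : Fin r → ℤ)
    (f : Polynomial (MvPolynomial (Fin n) k)) (hf : f ∈ polyPiece w J a) :
    (X j : MvPolynomial (Fin n) k) • f ∈ polyPiece w J (a + w j.succ) := by
  rw [mem_polyPiece] at hf ⊢
  refine ⟨Submodule.smul_of_tower_mem J _ hf.1, fun i => ?_⟩
  rw [Polynomial.coeff_smul, smul_eq_mul,
    show a + w j.succ - i • w 0 = w j.succ + (a - i • w 0) by abel]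
  exact (isWeightedHomogeneous_X k (fun j : Fin n => w j.succ) j).mul (hf.2 i)

theorem X_smul_mem_filtPiece {w : Fin (n + 1) → Fin r → ℤ}
    {J : Ideal (Polynomial (MvPolynomial (Fin n) k))} {N : ℕ} (j : Fin n) (a : Fin r → ℤ)
    (f : Polynomial (MvPolynomial (Fin n) k)) (hf : f ∈ filtPiece w J N a) :
    (X j : MvPolynomial (Fin n) k) • f ∈ filtPiece w J N (a + w j.succ) := by
  rw [mem_filtPiece] at hf ⊢
  refine ⟨X_smul_mem_polyPiece j a f hf.1, ?_⟩
  rw [Polynomial.degree_lt_iff_coeff_zero] at *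
  intro i hi
  rw [Polynomial.coeff_smul, hf.2 i hi, smul_zero]

theorem X_mul_mem_polyPiece {w : Fin (n + 1) → Fin r → ℤ}
    {J : Ideal (Polynomial (MvPolynomial (Fin n) k))} (a : Fin r → ℤ)
    (f : Polynomial (MvPolynomial (Fin n) k)) (hf : f ∈ polyPiece w J a) :
    Polynomial.X * f ∈ polyPiece w J (a + w 0) := by
  rw [mem_polyPiece] at hf ⊢
  refine ⟨J.mul_mem_left _ hf.1, fun i => ?_⟩
  cases i with
  | zero =>
    rw [Polynomial.coeff_X_mul_zero]
    exact isWeightedHomogeneous_zero _ _ _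
  | succ i =>
    rw [Polynomial.coeff_X_mul, show a + w 0 - (i + 1) • w 0 = a - i • w 0 by
      rw [add_smul, one_smul]; abel]
    exact hf.2 i

theorem degree_X_mul_lt_iff {A : Type*} [CommRing A] {f : Polynomial A} {N : ℕ} :
    (Polynomial.X * f).degree < ((N + 1 : ℕ) : WithBot ℕ) ↔ f.degree < N := by
  rw [Polynomial.degree_lt_iff_coeff_zero, Polynomial.degree_lt_iff_coeff_zero]
  constructor
  · intro h i hi
    rw [← Polynomial.coeff_X_mul]
    exact h _ (by omega)
  · intro h i hi
    obtain ⟨i, rfl⟩ : ∃ j, i = j + 1 := ⟨i - 1, by omega⟩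
    rw [Polynomial.coeff_X_mul]
    exact h _ (by omega)

/-- The Euler characteristic of the Koszul complex of the polynomials of bounded degree in an
ideal. -/
theorem kCoeff_filtPiece {w : Fin (n + 1) → Fin r → ℤ}
    {I : Ideal (MvPolynomial (Fin (n + 1)) k)} (hI : IsHomog w I)
    (f : ∀ j a i, kosLen (fun j : Fin n => w j.succ) (idealPiece (fun j : Fin n => w j.succ)
      ((polyIdeal I).leadingCoeffNth j)) a i ≠ ⊤) (a : Fin r → ℤ) (N : ℕ) :
    (∀ i, kosLen (fun j : Fin n => w j.succ) (filtPiece w (polyIdeal I) N) a i ≠ ⊤) ∧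
    kCoeff (fun j : Fin n => w j.succ) (filtPiece w (polyIdeal I) N) a =
      ∑ j ∈ Finset.range N, kCoeff (fun j : Fin n => w j.succ)
        (idealPiece (fun j : Fin n => w j.succ) ((polyIdeal I).leadingCoeffNth j))
          (a - j • w 0) := by
  induction N with
  | zero =>
    have hbot : filtPiece w (polyIdeal I) 0 = fun _ => ⊥ := by
      ext1 a
      rw [eq_bot_iff]
      intro p hp
      rw [mem_filtPiece] at hp
      simpa using hp.2
    have hz : kosLen (fun j : Fin n => w j.succ) (filtPiece w (polyIdeal I) 0) a = 0 := by
      ext1 i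
      have : koszulPiece (fun j : Fin n => w j.succ) (filtPiece w (polyIdeal I) 0) i a = ⊥ := by
        rw [eq_bot_iff, hbot]
        intro p hp
        rw [mem_koszulPiece] at hp
        rw [Submodule.mem_bot]
        ext1 S
        by_cases hS : S.card = i
        · exact (hp S).1 hS
        · exact (hp S).2 hS
      refine relLen_eq_zero ?_
      simp only [this, inf_bot_eq]
      exact bot_le
    refine ⟨fun i => by rw [hz]; exact ENat.zero_ne_top, ?_⟩
    rw [kCoeff_eq_altSum, hz]
    simp [altSum]
  | succ N ih =>
    -- Taking the coefficient of `x_0^N` identifies degree at most `N` modulo degree less than `N`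
    -- with the `N`-th leading coefficient ideal, its grading shifted by `N • w 0`.
    have := kosLen_exact (w := fun j : Fin n => w j.succ) (F := filtPiece w (polyIdeal I) N)
      (G := filtPiece w (polyIdeal I) (N + 1))
      (Q := idealPiece (fun j : Fin n => w j.succ) ((polyIdeal I).leadingCoeffNth N)) (N • w 0)
      X_smul_mem_filtPiece X_smul_mem_filtPiece (Polynomial.lcoeff (MvPolynomial (Fin n) k) N)
      ?_ ?_ a ih.1
    · have h1 := this.1 (f N _)
      refine ⟨h1, ?_⟩
      rw [this.2 h1, ih.2, Finset.sum_range_succ]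
    · intro a p
      rw [mem_filtPiece, mem_filtPiece, Polynomial.lcoeff_apply, and_assoc]
      refine and_congr_right fun _ => ?_
      rw [Polynomial.degree_lt_iff_coeff_zero, Polynomial.degree_lt_iff_coeff_zero]
      constructor
      · exact fun h => ⟨fun i hi => h i (by omega), h N le_rfl⟩
      · rintro ⟨h1, h2⟩ i hi
        rcases eq_or_lt_of_le hi with rfl | h
        · exact h2
        · exact h1 i h
    · intro a y
      rw [mem_idealPiece, mem_leadingCoeffNth_iff_coeff]
      constructor
      · rintro ⟨⟨p, hp, hd, rfl⟩, hy⟩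
        refine ⟨polyComp w a p, mem_filtPiece.2
          ⟨polyComp_mem_polyPiece hI hp a, degree_polyComp_lt hd⟩, ?_⟩
        rw [Polynomial.lcoeff_apply, coeff_polyComp]
        exact hy.weightedHomogeneousComponent_same
      · rintro ⟨p, hp, rfl⟩
        rw [mem_filtPiece] at hp
        exact ⟨⟨p, hp.1.1, hp.2, rfl⟩, hp.1.2 N⟩

theorem map_idealPiece (w : Fin (n + 1) → Fin r → ℤ) (I : Ideal (MvPolynomial (Fin (n + 1)) k))
    (a : Fin r → ℤ) :
    (idealPiece w I a).map (MvPolynomial.finSuccEquiv k n).toLinearEquiv.toLinearMap =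
      polyPiece w (polyIdeal I) a := by
  ext p
  obtain ⟨f, rfl⟩ := (MvPolynomial.finSuccEquiv k n).surjective p
  rw [mem_polyPiece, finSuccEquiv_mem_polyIdeal, ← isWeightedHomogeneous_iff_coeff,
    ← mem_idealPiece]
  constructor
  · rintro ⟨g, hg, e⟩
    rwa [← (MvPolynomial.finSuccEquiv k n).injective e]
  · exact fun h => ⟨f, h, rfl⟩

/-- The `K`-polynomial of an ideal, in terms of the ideals of leading coefficients with respect to
the first variable. -/
theorem kCoeff_idealPiece_succ {w : Fin (n + 1) → Fin r → ℤ}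
    {I : Ideal (MvPolynomial (Fin (n + 1)) k)} (hI : IsHomog w I)
    (f : ∀ j a i, kosLen (fun j : Fin n => w j.succ) (idealPiece (fun j : Fin n => w j.succ)
      ((polyIdeal I).leadingCoeffNth j)) a i ≠ ⊤) {N : ℕ}
    (hN : ∀ i, N ≤ i → (polyIdeal I).leadingCoeffNth i = (polyIdeal I).leadingCoeffNth N)
    (a : Fin r → ℤ) :
    (∀ i, kosLen w (idealPiece w I) a i ≠ ⊤) ∧
    kCoeff w (idealPiece w I) a =
      ∑ j ∈ Finset.range (N + 1), kCoeff (fun j : Fin n => w j.succ)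
        (idealPiece (fun j : Fin n => w j.succ) ((polyIdeal I).leadingCoeffNth j))
          (a - j • w 0) -
      ∑ j ∈ Finset.range N, kCoeff (fun j : Fin n => w j.succ)
        (idealPiece (fun j : Fin n => w j.succ) ((polyIdeal I).leadingCoeffNth j))
          (a - w 0 - j • w 0) := by
  obtain ⟨f1, e1⟩ := kCoeff_filtPiece hI f a (N + 1)
  obtain ⟨f2, e2⟩ := kCoeff_filtPiece hI f (a - w 0) N
  let φ : MvPolynomial (Fin (n + 1)) k ≃ₗ[k] Polynomial (MvPolynomial (Fin n) k) :=
    (MvPolynomial.finSuccEquiv k n).toLinearEquiv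
  let y := LinearMap.mulLeft (MvPolynomial (Fin n) k)
    (Polynomial.X : Polynomial (MvPolynomial (Fin n) k))
  -- The cone on all of the ideal is replaced by multiplication by `x_0` from degree less than `N`
  -- to degree at most `N`. The bounds differ by one so that `x_0` respects them; stability beyond
  -- `N` gives the surjectivity modulo low degrees.
  obtain ⟨f3, e3⟩ := coneLen_of_filtration (w := w) (y := y)
    (F := filtPiece w (polyIdeal I) (N + 1)) (F' := filtPiece w (polyIdeal I) N)
    (G := polyPiece w (polyIdeal I)) X_smul_mem_filtPiece X_smul_mem_filtPiece
    X_smul_mem_polyPiece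
    (fun a p hp => by
      rw [mem_filtPiece] at hp ⊢
      exact ⟨X_mul_mem_polyPiece a p hp.1, degree_X_mul_lt_iff.2 hp.2⟩)
    X_mul_mem_polyPiece (fun a => inf_le_left) (fun a => inf_le_left)
    (fun a p hp h => by
      rw [mem_filtPiece] at h ⊢
      exact ⟨hp, degree_X_mul_lt_iff.1 h.2⟩)
    (fun a p hp => by
      obtain ⟨p₀, hp₀, hd, p', hp', e⟩ := exists_eq_add_X_mul hN p hp.1
      refine ⟨polyComp w a p₀, mem_filtPiece.2
        ⟨polyComp_mem_polyPiece hI hp₀ a, degree_polyComp_lt hd⟩, polyComp w (a - w 0) p',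
        polyComp_mem_polyPiece hI hp' _, ?_⟩
      rw [← polyComp_eq_self hp]
      ext1 i
      rw [LinearMap.mulLeft_apply, coeff_polyComp, e, Polynomial.coeff_add, Polynomial.coeff_add,
        map_add, coeff_polyComp]
      congr 1
      cases i with
      | zero => simp
      | succ i =>
        rw [Polynomial.coeff_X_mul, Polynomial.coeff_X_mul, coeff_polyComp, sub_sub a (w 0),
          add_smul, one_smul, add_comm (w 0)])
    a f1 f2
  -- Splitting chains by whether they involve `x_0` carries the Koszul complex of `I` to this cone.
  have hlen : ∀ i, kosLen w (idealPiece w I) a i =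
      hLen (coneD y) (conePiece w (polyPiece w (polyIdeal I)) (polyPiece w (polyIdeal I)) a) i := by
    intro i
    rw [kosLen, ← hLen_map (d' := coneD y) (splitChains φ).toLinearMap (splitChains φ).injective
      (koszulPiece_isCx X_smul_mem_idealPiece a)]
    · congr 1
      ext1 i
      rw [splitChains_koszulPiece]
      congr 1 <;> exact funext fun a => map_idealPiece w I a
    · intro p
      refine splitChains_koszulD φ (fun p => ?_) (fun j p => ?_) p
      · change MvPolynomial.finSuccEquiv k n (X 0 * p) = Polynomial.X * _
        rw [map_mul, finSuccEquiv_X_zero]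
        rfl
      · change MvPolynomial.finSuccEquiv k n (X j.succ * p) = _
        rw [map_mul, finSuccEquiv_X_succ, ← Polynomial.smul_eq_C_mul]
        rfl
  refine ⟨fun i => by rw [hlen]; exact f3 i, ?_⟩
  rw [kCoeff_eq_altSum, funext hlen, e3, e1, e2]

end Homogeneous

/-! ### Finiteness, the recursion for the `K`-series, and lowest-degree parts of power series. -/

section Series

variable {k : Type*} [Field k] {m n r : ℕ}

theorem finite_support_comp_sub {κ : (Fin r → ℤ) → ℤ} (h : (Function.support κ).Finite)
    (c : Fin r → ℤ) : (Function.support fun a => κ (a - c)).Finite := by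
  have : (Function.support fun a => κ (a - c)) = (fun a => a - c) ⁻¹' Function.support κ := rfl
  rw [this]
  exact h.preimage (sub_left_injective (b := c)).injOn

theorem finite_support_finset_sum {ι : Type*} (s : Finset ι) {κ : ι → (Fin r → ℤ) → ℤ}
    (h : ∀ i, (Function.support (κ i)).Finite) :
    (Function.support fun a => ∑ i ∈ s, κ i a).Finite := by
  refine (s.finite_toSet.biUnion fun i _ => h i).subset fun a ha => ?_
  obtain ⟨i, hi, hne⟩ := Finset.exists_ne_zero_of_sum_ne_zero ha
  exact Set.mem_biUnion hi hne

theorem finite_support_fun_sub {κ κ' : (Fin r → ℤ) → ℤ} (h : (Function.support κ).Finite)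
    (h' : (Function.support κ').Finite) : (Function.support fun a => κ a - κ' a).Finite := by
  refine (h.union h').subset fun a ha => ?_
  by_contra hc
  simp only [Set.mem_union, Function.mem_support, not_or, not_not] at hc
  exact ha (by simp [hc.1, hc.2])

/-- Koszul homology of homogeneous ideals is finite-dimensional, and concentrated in finitely many
degrees. -/
theorem IsHomog.finite {n : ℕ} {w : Fin n → Fin r → ℤ} {I : Ideal (MvPolynomial (Fin n) k)}
    (h : IsHomog w I) :
    (∀ a i, kosLen w (idealPiece w I) a i ≠ ⊤) ∧
      (Function.support (kCoeff w (idealPiece w I))).Finite := by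
  induction n with
  | zero =>
    have : Module.Finite k (MvPolynomial (Fin 0) k) :=
      Module.Finite.equiv (MvPolynomial.isEmptyAlgEquiv k (Fin 0)).symm.toLinearEquiv
    refine ⟨fun a i => relLen_ne_top, (Set.finite_singleton 0).subset fun a ha => ?_⟩
    by_contra hne
    refine ha ?_
    -- Without variables every polynomial is a constant of degree `0`, so nothing occurs in degree
    -- `a ≠ 0`.
    have hz : kosLen w (idealPiece w I) a = 0 := by
      ext1 i
      have : koszulPiece w (idealPiece w I) i a = ⊥ := by
        rw [eq_bot_iff]
        intro p hp
        rw [mem_koszulPiece] at hp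
        rw [Submodule.mem_bot]
        ext1 S
        by_cases hS : S.card = i
        · have h1 := (mem_idealPiece.1 ((hp S).1 hS)).2
          rw [Finset.eq_empty_of_isEmpty S, Finset.sum_empty, sub_zero] at h1
          rw [Finset.eq_empty_of_isEmpty S]
          by_contra h0
          exact hne (h1.inj_right h0 (isWeightedHomogeneous_of_isEmpty _ w _))
        · exact (hp S).2 hS
      refine relLen_eq_zero ?_
      simp only [this, inf_bot_eq]
      exact bot_le
    rw [kCoeff_eq_altSum, hz]
    simp [altSum]
  | succ n ih =>
    obtain ⟨N, hN⟩ := exists_stable_leadingCoeffNth (polyIdeal I)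
    have ih' := fun j => ih (h.leadingCoeffNth j)
    have key := kCoeff_idealPiece_succ h (fun j => (ih' j).1) hN
    refine ⟨fun a => (key a).1, ?_⟩
    rw [show kCoeff w (idealPiece w I) = _ from funext fun a => (key a).2]
    refine finite_support_fun_sub (finite_support_finset_sum _ fun j => ?_)
      (finite_support_finset_sum _ fun j => ?_)
    · exact finite_support_comp_sub (ih' j).2 _
    · exact finite_support_comp_sub (finite_support_comp_sub (ih' j).2 (j • w 0)) (w 0)

theorem isHomog_top (w : Fin m → Fin r → ℤ) : IsHomog w (⊤ : Ideal (MvPolynomial (Fin m) k)) :=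
  fun _ _ _ => trivial

theorem IsHomog.kCoeff_quotient {w : Fin m → Fin r → ℤ} {I : Ideal (MvPolynomial (Fin m) k)}
    (h : IsHomog w I) (a : Fin r → ℤ) :
    kCoeff w (gradedPiece w I) a = kCoeff w (idealPiece w (⊤ : Ideal (MvPolynomial (Fin m) k))) a -
      kCoeff w (idealPiece w I) a :=
  kCoeff_gradedPiece a (h.finite.1 a) ((isHomog_top w).finite.1 a)

theorem IsHomog.finite_support {w : Fin m → Fin r → ℤ} {I : Ideal (MvPolynomial (Fin m) k)}
    (h : IsHomog w I) : (Function.support (kCoeff w (gradedPiece w I))).Finite := by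
  rw [show kCoeff w (gradedPiece w I) = _ from funext h.kCoeff_quotient]
  exact finite_support_fun_sub (isHomog_top w).finite.2 h.finite.2

theorem leadingCoeffNth_top {A : Type*} [CommRing A] (i : ℕ) :
    (⊤ : Ideal (Polynomial A)).leadingCoeffNth i = ⊤ := by
  rw [Ideal.eq_top_iff_one, mem_leadingCoeffNth_iff_coeff]
  refine ⟨Polynomial.X ^ i, trivial, ?_, by simp⟩
  refine lt_of_le_of_lt (Polynomial.degree_X_pow_le i) ?_
  exact_mod_cast Nat.lt_succ_self i

/-- Subtract the recursion for `I` from that for the unit ideal. The leading coefficient ideals of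
the latter are all the unit ideal, so the same `N` serves both, and the difference turns ideals into
quotients term by term. -/
theorem IsHomog.kCoeff_succ {w : Fin (n + 1) → Fin r → ℤ}
    {I : Ideal (MvPolynomial (Fin (n + 1)) k)} (h : IsHomog w I) {N : ℕ}
    (hN : ∀ i, N ≤ i → (polyIdeal I).leadingCoeffNth i = (polyIdeal I).leadingCoeffNth N)
    (a : Fin r → ℤ) :
    kCoeff w (gradedPiece w I) a =
      ∑ j ∈ Finset.range (N + 1), kCoeff (fun j : Fin n => w j.succ)
        (gradedPiece (fun j : Fin n => w j.succ) ((polyIdeal I).leadingCoeffNth j))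
          (a - j • w 0) -
      ∑ j ∈ Finset.range N, kCoeff (fun j : Fin n => w j.succ)
        (gradedPiece (fun j : Fin n => w j.succ) ((polyIdeal I).leadingCoeffNth j))
          (a - w 0 - j • w 0) := by
  have htop : ∀ i, (polyIdeal (⊤ : Ideal (MvPolynomial (Fin (n + 1)) k))).leadingCoeffNth i = ⊤ :=
    leadingCoeffNth_top
  have e1 := (kCoeff_idealPiece_succ (isHomog_top w)
    (fun j => ((isHomog_top w).leadingCoeffNth j).finite.1) (N := N)
    (fun i _ => by rw [htop, htop]) a).2
  have e2 := (kCoeff_idealPiece_succ h (fun j => (h.leadingCoeffNth j).finite.1) hN a).2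
  simp only [htop] at e1
  simp only [h.kCoeff_quotient, (h.leadingCoeffNth _).kCoeff_quotient, e1, e2,
    Finset.sum_sub_distrib]
  ring

/-- The power series `∑ κ_a (1 - t)^a`. -/
def kSum (κ : (Fin r → ℤ) → ℤ) : MvPowerSeries (Fin r) ℤ := ∑ᶠ a, κ a • oneSubPow a

theorem finite_support_smul {κ : (Fin r → ℤ) → ℤ} (h : (Function.support κ).Finite) :
    (Function.support fun a => κ a • oneSubPow a).Finite :=
  h.subset fun a ha h0 => ha (by simp only [h0, zero_smul])

theorem kSum_sub {κ κ' : (Fin r → ℤ) → ℤ} (h : (Function.support κ).Finite)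
    (h' : (Function.support κ').Finite) : kSum (fun a => κ a - κ' a) = kSum κ - kSum κ' := by
  simp only [kSum, sub_smul]
  exact finsum_sub_distrib (finite_support_smul h) (finite_support_smul h')

theorem kSum_sum {ι : Type*} (s : Finset ι) {κ : ι → (Fin r → ℤ) → ℤ}
    (h : ∀ i, (Function.support (κ i)).Finite) :
    kSum (fun a => ∑ i ∈ s, κ i a) = ∑ i ∈ s, kSum (κ i) := by
  simp only [kSum, Finset.sum_smul]
  exact finsum_sum_comm s _ fun i _ => finite_support_smul (h i)

theorem oneSubPow_add (a b : Fin r → ℤ) : oneSubPow (a + b) = oneSubPow a * oneSubPow b := by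
  simp only [oneSubPow, Pi.add_apply, zpow_add, Finset.prod_mul_distrib, Units.val_mul]

theorem oneSubPow_zero : oneSubPow (0 : Fin r → ℤ) = 1 := by
  simp [oneSubPow]

theorem oneSubPow_nsmul (j : ℕ) (a : Fin r → ℤ) : oneSubPow (j • a) = oneSubPow a ^ j := by
  induction j with
  | zero => rw [zero_smul, pow_zero, oneSubPow_zero]
  | succ j ih => rw [add_smul, one_smul, oneSubPow_add, ih, pow_succ]

theorem kSum_comp_sub {κ : (Fin r → ℤ) → ℤ} (h : (Function.support κ).Finite) (c : Fin r → ℤ) :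
    kSum (fun a => κ (a - c)) = oneSubPow c * kSum κ := by
  rw [kSum, kSum, mul_finsum' _ _ (finite_support_smul h),
    ← finsum_comp_equiv (Equiv.addRight c)]
  refine finsum_congr fun a => ?_
  simp only [Equiv.coe_addRight, add_sub_cancel_right]
  rw [add_comm a, oneSubPow_add, mul_smul_comm]

/-- The series `K(R/I; 1 - t)` in terms of the ideals of leading coefficients. -/
theorem IsHomog.kSeries_succ {w : Fin (n + 1) → Fin r → ℤ}
    {I : Ideal (MvPolynomial (Fin (n + 1)) k)} (h : IsHomog w I) {N : ℕ}
    (hN : ∀ i, N ≤ i → (polyIdeal I).leadingCoeffNth i = (polyIdeal I).leadingCoeffNth N) :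
    kSeries w I = (1 - oneSubPow (w 0)) * ∑ j ∈ Finset.range N, oneSubPow (w 0) ^ j *
        kSeries (fun j : Fin n => w j.succ) ((polyIdeal I).leadingCoeffNth j) +
      oneSubPow (w 0) ^ N *
        kSeries (fun j : Fin n => w j.succ) ((polyIdeal I).leadingCoeffNth N) := by
  have hf := fun j => (h.leadingCoeffNth j).finite_support
  have hk : ∀ j, kSeries (fun j : Fin n => w j.succ) ((polyIdeal I).leadingCoeffNth j) =
    kSum (kCoeff (fun j : Fin n => w j.succ)
      (gradedPiece (fun j : Fin n => w j.succ) ((polyIdeal I).leadingCoeffNth j))) := fun j => rfl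
  change kSum (kCoeff w (gradedPiece w I)) = _
  rw [show kCoeff w (gradedPiece w I) = _ from funext (h.kCoeff_succ hN), kSum_sub, kSum_sum,
    kSum_sum]
  · have e1 : ∀ j : ℕ, kSum (fun a => kCoeff (fun j : Fin n => w j.succ)
        (gradedPiece (fun j : Fin n => w j.succ) ((polyIdeal I).leadingCoeffNth j))
          (a - j • w 0)) = oneSubPow (w 0) ^ j *
        kSeries (fun j : Fin n => w j.succ) ((polyIdeal I).leadingCoeffNth j) := fun j => by
      rw [kSum_comp_sub (hf j), oneSubPow_nsmul, hk]
    have e2 : ∀ j : ℕ, kSum (fun a => kCoeff (fun j : Fin n => w j.succ)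
        (gradedPiece (fun j : Fin n => w j.succ) ((polyIdeal I).leadingCoeffNth j))
          (a - w 0 - j • w 0)) = oneSubPow (w 0) * (oneSubPow (w 0) ^ j *
        kSeries (fun j : Fin n => w j.succ) ((polyIdeal I).leadingCoeffNth j)) := fun j => by
      rw [kSum_comp_sub (finite_support_comp_sub (hf j) (j • w 0)), e1]
    -- The terms with `j < N` occur in both sums and combine to the factor `1 - oneSubPow (w 0)`;
    -- the term `j = N` stands alone.
    simp only [e1, e2, Finset.sum_range_succ, ← Finset.mul_sum]
    ring
  · exact fun j => finite_support_comp_sub (finite_support_comp_sub (hf j) (j • w 0)) (w 0)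
  · exact fun j => finite_support_comp_sub (hf j) (j • w 0)
  · exact finite_support_finset_sum _ fun j => finite_support_comp_sub (hf j) (j • w 0)
  · exact finite_support_finset_sum _ fun j =>
      finite_support_comp_sub (finite_support_comp_sub (hf j) (j • w 0)) (w 0)

/-- The sum of the terms of degree `c` of a power series. -/
def homPart (c : ℕ) : MvPowerSeries (Fin r) ℤ →+ MvPolynomial (Fin r) ℤ where
  toFun f := ∑ e ∈ (Finset.univ : Finset (Fin r)).finsuppAntidiag c,
    monomial e (MvPowerSeries.coeff e f)
  map_zero' := by simp
  map_add' f g := by simp [Finset.sum_add_distrib]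

theorem multidegree_eq_homPart (w : Fin m → Fin r → ℤ) (I : Ideal (MvPolynomial (Fin m) k)) :
    multidegree w I = homPart I.height.toNat (kSeries w I) := rfl

theorem mem_finsuppAntidiag_univ {c : ℕ} {e : Fin r →₀ ℕ} :
    e ∈ (Finset.univ : Finset (Fin r)).finsuppAntidiag c ↔ e.degree = c := by
  rw [Finset.mem_finsuppAntidiag, Finsupp.degree_eq_sum]
  simp

theorem coeff_homPart (c : ℕ) (f : MvPowerSeries (Fin r) ℤ) (e : Fin r →₀ ℕ) :
    coeff e (homPart c f) = if e.degree = c then MvPowerSeries.coeff e f else 0 := by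
  change coeff e (∑ e ∈ (Finset.univ : Finset (Fin r)).finsuppAntidiag c,
    monomial e (MvPowerSeries.coeff e f)) = _
  simp only [coeff_sum, coeff_monomial, Finset.sum_ite_eq', mem_finsuppAntidiag_univ]

/-- The power series `f` has no terms of degree less than `c`. -/
def OrdGE (c : ℕ) (f : MvPowerSeries (Fin r) ℤ) : Prop :=
  ∀ e : Fin r →₀ ℕ, e.degree < c → MvPowerSeries.coeff e f = 0

theorem OrdGE.zero (f : MvPowerSeries (Fin r) ℤ) : OrdGE 0 f := fun _ he => (by omega)

theorem OrdGE.add {c : ℕ} {f g : MvPowerSeries (Fin r) ℤ} (hf : OrdGE c f) (hg : OrdGE c g) :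
    OrdGE c (f + g) := fun e he => by rw [map_add, hf e he, hg e he, add_zero]

theorem OrdGE.sum {ι : Type*} {c : ℕ} (s : Finset ι) {f : ι → MvPowerSeries (Fin r) ℤ}
    (hf : ∀ i ∈ s, OrdGE c (f i)) : OrdGE c (∑ i ∈ s, f i) := fun e he => by
  rw [map_sum, Finset.sum_eq_zero fun i hi => hf i hi e he]

theorem OrdGE.homPart_eq_zero {c d : ℕ} {f : MvPowerSeries (Fin r) ℤ} (h : OrdGE c f)
    (hd : d < c) : homPart d f = 0 := by
  ext e
  rw [coeff_homPart, coeff_zero]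
  split_ifs with he
  · exact h e (he ▸ hd)
  · rfl

theorem OrdGE.mul {c d : ℕ} {f g : MvPowerSeries (Fin r) ℤ} (hf : OrdGE c f) (hg : OrdGE d g) :
    OrdGE (c + d) (f * g) := by
  classical
  intro e he
  rw [MvPowerSeries.coeff_mul]
  refine Finset.sum_eq_zero fun p hp => ?_
  rw [Finset.HasAntidiagonal.mem_antidiagonal] at hp
  have := congrArg Finsupp.degree hp
  rw [map_add] at this
  rcases lt_or_ge p.1.degree c with h | h
  · rw [hf _ h, zero_mul]
  · rw [hg p.2 (by omega), mul_zero]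

/-- In the total degree `c + d`, any splitting other than degrees `c` and `d` puts one factor below
its order, where it vanishes. -/
theorem OrdGE.homPart_mul {c d : ℕ} {f g : MvPowerSeries (Fin r) ℤ} (hf : OrdGE c f)
    (hg : OrdGE d g) : homPart (c + d) (f * g) = homPart c f * homPart d g := by
  classical
  ext e
  rw [coeff_homPart, MvPolynomial.coeff_mul]
  simp only [coeff_homPart]
  split_ifs with he
  · rw [MvPowerSeries.coeff_mul]
    refine Finset.sum_congr rfl fun p hp => ?_
    rw [Finset.HasAntidiagonal.mem_antidiagonal] at hp
    have := congrArg Finsupp.degree hp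
    rw [map_add] at this
    rcases lt_trichotomy p.1.degree c with h | h | h
    · rw [hf _ h, zero_mul, if_neg h.ne, zero_mul]
    · rw [if_pos h, if_pos (by omega)]
    · rw [hg p.2 (by omega), mul_zero, if_neg h.ne', zero_mul]
  · refine (Finset.sum_eq_zero fun p hp => ?_).symm
    rw [Finset.HasAntidiagonal.mem_antidiagonal] at hp
    have := congrArg Finsupp.degree hp
    rw [map_add] at this
    split_ifs
    · omega
    · rw [mul_zero]
    · rw [zero_mul]
    · rw [zero_mul]

theorem homPart_zero_eq (f : MvPowerSeries (Fin r) ℤ) :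
    homPart 0 f = C (MvPowerSeries.constantCoeff f) := by
  classical
  ext e
  rw [coeff_homPart, coeff_C]
  by_cases he : e = 0
  · subst he
    rw [if_pos rfl, if_pos (map_zero _), MvPowerSeries.coeff_zero_eq_constantCoeff_apply]
  · rw [if_neg (Ne.symm he), if_neg (by rwa [Finsupp.degree_eq_zero_iff])]

theorem wt_add (a b : Fin r → ℤ) : wt (a + b) = wt a + wt b := by
  simp only [wt, Pi.add_apply, C_add, add_mul, Finset.sum_add_distrib]

theorem wt_neg (a : Fin r → ℤ) : wt (-a) = -wt a := by
  simp only [wt, Pi.neg_apply, C_neg, neg_mul, Finset.sum_neg_distrib]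

theorem wt_single (j : Fin r) : wt (Pi.single j 1) = X j := by
  rw [wt, Finset.sum_eq_single j]
  · simp
  · intro i _ hi
    simp [hi]
  · simp

/-- The power series `f` agrees with `1 - wt a` up to terms of degree at least `2`. -/
def HasLinear (f : MvPowerSeries (Fin r) ℤ) (a : Fin r → ℤ) : Prop :=
  OrdGE 1 (1 - f) ∧ homPart 1 (1 - f) = wt a

theorem HasLinear.constantCoeff {f : MvPowerSeries (Fin r) ℤ} {a : Fin r → ℤ}
    (h : HasLinear f a) : MvPowerSeries.constantCoeff f = 1 := by
  have := h.1 0 (by simp)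
  rw [map_sub, sub_eq_zero] at this
  simpa using this.symm

theorem hasLinear_one : HasLinear (1 : MvPowerSeries (Fin r) ℤ) 0 := by
  refine ⟨fun e _ => by simp, by simp [wt]⟩

theorem HasLinear.mul {f g : MvPowerSeries (Fin r) ℤ} {a b : Fin r → ℤ} (hf : HasLinear f a)
    (hg : HasLinear g b) : HasLinear (f * g) (a + b) := by
  have e : 1 - f * g = (1 - f) + f * (1 - g) := by ring
  have h := (OrdGE.zero f).mul hg.1
  have h' := (OrdGE.zero f).homPart_mul hg.1
  rw [zero_add] at h h'
  rw [homPart_zero_eq, hf.constantCoeff, C_1, one_mul, hg.2] at h'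
  refine ⟨e ▸ hf.1.add h, ?_⟩
  rw [e, map_add, hf.2, h', wt_add]

/-- From `1 - g = -g (1 - f)` and the constant term `1` of `g`. This gives the negative exponents of
weights in `ℤ^r`. -/
theorem HasLinear.of_mul_eq_one {f g : MvPowerSeries (Fin r) ℤ} {a : Fin r → ℤ}
    (hf : HasLinear f a) (hg : g * f = 1) : HasLinear g (-a) := by
  have hc : MvPowerSeries.constantCoeff g = 1 := by
    have := congrArg MvPowerSeries.constantCoeff hg
    rwa [map_mul, hf.constantCoeff, mul_one, map_one] at this
  have e : 1 - g = g * (-(1 - f)) := by rw [mul_neg, mul_sub, hg]; ring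
  have hneg : OrdGE 1 (-(1 - f)) := fun d hd => by rw [map_neg, hf.1 d hd, neg_zero]
  have h := (OrdGE.zero g).mul hneg
  have h' := (OrdGE.zero g).homPart_mul hneg
  rw [zero_add] at h h'
  rw [homPart_zero_eq, hc, C_1, one_mul, map_neg, hf.2] at h'
  refine ⟨e ▸ h, ?_⟩
  rw [e, h', wt_neg]

theorem HasLinear.pow {f : MvPowerSeries (Fin r) ℤ} {a : Fin r → ℤ} (hf : HasLinear f a) (j : ℕ) :
    HasLinear (f ^ j) (j • a) := by
  induction j with
  | zero => rw [pow_zero, zero_smul]; exact hasLinear_one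
  | succ j ih => rw [pow_succ, add_smul, one_smul]; exact ih.mul hf

theorem HasLinear.zpow {u : (MvPowerSeries (Fin r) ℤ)ˣ} {a : Fin r → ℤ}
    (hu : HasLinear (u : MvPowerSeries (Fin r) ℤ) a) (z : ℤ) :
    HasLinear ((u ^ z : (MvPowerSeries (Fin r) ℤ)ˣ) : MvPowerSeries (Fin r) ℤ) (z • a) := by
  obtain ⟨j, rfl | rfl⟩ := z.eq_nat_or_neg
  · rw [zpow_natCast, Units.val_pow_eq_pow_val, natCast_zsmul]
    exact hu.pow j
  · rw [neg_smul, natCast_zsmul]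
    refine (hu.pow j).of_mul_eq_one ?_
    rw [zpow_neg, zpow_natCast, ← Units.val_pow_eq_pow_val, Units.inv_mul]

theorem hasLinear_one_sub_X (j : Fin r) :
    HasLinear (1 - MvPowerSeries.X j : MvPowerSeries (Fin r) ℤ) (Pi.single j 1) := by
  classical
  rw [HasLinear, sub_sub_cancel, wt_single]
  constructor
  · intro e he
    rw [MvPowerSeries.coeff_X, if_neg]
    rintro rfl
    simp at he
  · ext e
    rw [coeff_homPart, MvPowerSeries.coeff_X, coeff_X]
    by_cases h : e = Finsupp.single j 1
    · subst h
      simp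
    · rw [if_neg h, if_neg (Ne.symm h), ite_self]

/-- The constant and linear terms of `(1 - t)^a`. -/
theorem hasLinear_oneSubPow (a : Fin r → ℤ) : HasLinear (oneSubPow a) a := by
  have key : ∀ s : Finset (Fin r), HasLinear
      ((∏ j ∈ s, (isUnit_one_sub_X j).unit ^ a j : (MvPowerSeries (Fin r) ℤ)ˣ) :
        MvPowerSeries (Fin r) ℤ) (∑ j ∈ s, a j • Pi.single j 1) := by
    intro s
    induction s using Finset.induction_on with
    | empty => simpa using hasLinear_one
    | insert i s hi ih =>
      rw [Finset.prod_insert hi, Finset.sum_insert hi, Units.val_mul]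
      exact (HasLinear.zpow (u := (isUnit_one_sub_X i).unit) (hasLinear_one_sub_X i) _).mul ih
  have := key Finset.univ
  rwa [show ∑ j, a j • (Pi.single j 1 : Fin r → ℤ) = a by
    ext i; simp [Finset.sum_apply, Pi.single_apply]] at this

/-- The multiplier has constant term `1`; hence the shifts `T^j` in the recursion do not affect
lowest terms. -/
theorem OrdGE.oneSubPow_mul {c : ℕ} {f : MvPowerSeries (Fin r) ℤ} (hf : OrdGE c f)
    (a : Fin r → ℤ) (j : ℕ) : OrdGE c (oneSubPow a ^ j * f) ∧
      homPart c (oneSubPow a ^ j * f) = homPart c f := by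
  have h0 := OrdGE.zero (oneSubPow a ^ j)
  refine ⟨by simpa using h0.mul hf, ?_⟩
  have := h0.homPart_mul hf
  rw [zero_add, homPart_zero_eq, map_pow, (hasLinear_oneSubPow a).constantCoeff] at this
  simpa using this

end Series

/-! ### Heights of ideals in `A[y]`, their contractions and their leading coefficient ideals. -/

theorem map_C_comap_C_le {A : Type*} [CommRing A] (I : Ideal (Polynomial A)) :
    (I.comap Polynomial.C).map Polynomial.C ≤ I := Ideal.map_comap_le

theorem comap_C_le_leadingCoeff {A : Type*} [CommRing A] (I : Ideal (Polynomial A)) :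
    I.comap Polynomial.C ≤ I.leadingCoeff := by
  intro x hx
  rw [Ideal.mem_leadingCoeff]
  exact ⟨_, hx, Polynomial.leadingCoeff_C x⟩

/-- If every leading coefficient lay in `I ∩ A`, stripping leading terms one by one would stay
inside `I` and show that `I` is extended from `A`. This is how the hypothesis that `I` is not
extended is used throughout. -/
theorem exists_leadingCoeff_notMem {A : Type*} [CommRing A] {I : Ideal (Polynomial A)}
    (h : I ≠ (I.comap Polynomial.C).map Polynomial.C) :
    ∃ f ∈ I, f.leadingCoeff ∉ I.comap Polynomial.C := by
  by_contra! hc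
  refine h (le_antisymm (fun f hf => ?_) (map_C_comap_C_le I))
  suffices ∀ d, ∀ f ∈ I, f.natDegree < d → f ∈ (I.comap Polynomial.C).map Polynomial.C from
    this _ f hf (Nat.lt_succ_self _)
  intro d
  induction d with
  | zero => intro f _ h; omega
  | succ d ih =>
    intro f hf hd
    have h1 : Polynomial.C f.leadingCoeff ∈ (I.comap Polynomial.C).map Polynomial.C :=
      Ideal.mem_map_of_mem _ (hc f hf)
    have h2 : Polynomial.C f.leadingCoeff * Polynomial.X ^ f.natDegree ∈
        (I.comap Polynomial.C).map Polynomial.C := Ideal.mul_mem_right _ _ h1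
    rw [← f.eraseLead_add_C_mul_X_pow]
    refine Ideal.add_mem _ ?_ h2
    rcases Nat.eq_zero_or_pos f.natDegree with h0 | h0
    · rw [Polynomial.eq_C_of_natDegree_eq_zero h0, Polynomial.eraseLead_C]
      exact Ideal.zero_mem _
    · refine ih _ ?_ ?_
      · rw [← Polynomial.self_sub_C_mul_X_pow]
        exact I.sub_mem hf (map_C_comap_C_le I h2)
      · exact lt_of_le_of_lt f.eraseLead_natDegree_le (by omega)

theorem comap_C_lt_of_leadingCoeff_le {A : Type*} [CommRing A] {P : Ideal (Polynomial A)}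
    (h : P ≠ (P.comap Polynomial.C).map Polynomial.C) {q : Ideal A} (hq : P.leadingCoeff ≤ q) :
    P.comap Polynomial.C < q := by
  obtain ⟨f, hf, hlc⟩ := exists_leadingCoeff_notMem h
  refine lt_of_le_of_ne ((comap_C_le_leadingCoeff P).trans hq) ?_
  rintro rfl
  exact hlc (hq (P.mem_leadingCoeff _ |>.2 ⟨f, hf, rfl⟩))

section Heights

variable {A : Type*} [CommRing A] [IsNoetherianRing A]

-- After localising at the contraction `p`, which changes neither height, `p` becomes maximal. A
-- maximal ideal above `P` then still lies over `p`, and its height is exactly one more than that of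
-- `p`.
attribute [local instance] Polynomial.algebra Polynomial.isLocalization in
theorem height_le_height_comap_C_add_one (P : Ideal (Polynomial A)) [P.IsPrime] :
    P.height ≤ (P.comap Polynomial.C).height + 1 := by
  set p : Ideal A := P.comap Polynomial.C with hp
  have : p.IsPrime := Ideal.IsPrime.comap _
  have : P.LiesOver p := ⟨hp⟩
  let Aₚ := Localization.AtPrime p
  set p' : Ideal Aₚ := p.map (algebraMap A Aₚ) with p'_def
  have hmax : p'.IsMaximal := by
    rw [p'_def, Localization.AtPrime.map_eq_maximalIdeal]
    exact IsLocalRing.maximalIdeal.isMaximal Aₚ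
  let P' : Ideal (Polynomial Aₚ) := P.map (algebraMap (Polynomial A) (Polynomial Aₚ))
  have disj : Disjoint (p.primeCompl.map Polynomial.C : Set (Polynomial A)) P := by
    refine Set.disjoint_left.mpr fun a ⟨b, hb⟩ ha ↦ hb.1 ?_
    rw [SetLike.mem_coe, hp, Ideal.mem_comap]
    rw [hb.2]
    exact ha
  have hP' : P'.IsPrime :=
    IsLocalization.isPrime_of_isPrime_disjoint (p.primeCompl.map Polynomial.C) _ P ‹_› disj
  have : P'.LiesOver p' :=
    IsLocalization.liesOver_of_isPrime_of_disjoint p.primeCompl _ _ disj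
  have eq1 : p.height = p'.height := by
    rw [IsLocalization.height_map_of_disjoint p.primeCompl]
    exact Disjoint.symm <| Set.disjoint_left.mpr fun _ a b ↦ b a
  have eq2 : P.height = P'.height := by
    rw [IsLocalization.height_map_of_disjoint (Submonoid.map Polynomial.C <| p.primeCompl) _ disj]
  obtain ⟨M, hM, hle⟩ := P'.exists_le_maximal hP'.ne_top
  have : M.LiesOver p' := by
    refine ⟨hmax.eq_of_le ?_ ?_⟩
    · exact (Ideal.IsPrime.comap _ (hK := hM.isPrime)).ne_top
    · rw [Ideal.LiesOver.over (P := P') (p := p')]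
      exact Ideal.comap_mono hle
  rw [eq1, eq2, ← Polynomial.height_eq_height_add_one p' M]
  exact Ideal.height_mono hle

/-- Going down for `A → A[y]` gives the height as that of `p` plus the height of the image in `A[y]
/ p A[y]`, and this image is zero. -/
theorem height_map_C_of_isPrime (p : Ideal A) [p.IsPrime] :
    (p.map (Polynomial.C : A →+* Polynomial A)).height = p.height := by
  have hprime : (p.map (Polynomial.C : A →+* Polynomial A)).IsPrime :=
    Ideal.isPrime_map_C_of_isPrime
  have : (p.map (Polynomial.C : A →+* Polynomial A)).LiesOver p := by
    refine ⟨?_⟩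
    ext x
    rw [Ideal.under_def, Ideal.mem_comap, Polynomial.algebraMap_eq, Ideal.mem_map_C_iff]
    refine ⟨fun h n => ?_, fun h => by simpa using h 0⟩
    rw [Polynomial.coeff_C]
    split_ifs
    · exact h
    · exact p.zero_mem
  have hne : Nontrivial (Polynomial A ⧸ p.map (algebraMap A (Polynomial A))) :=
    Ideal.Quotient.nontrivial_iff.2 hprime.ne_top
  rw [Ideal.height_eq_height_add_of_liesOver_of_hasGoingDown p, Polynomial.algebraMap_eq,
    Ideal.map_quotient_self]
  rw [Polynomial.algebraMap_eq] at hne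
  rw [Ideal.height_bot, add_zero]

theorem height_map_C_eq (J : Ideal A) :
    (J.map (Polynomial.C : A →+* Polynomial A)).height = J.height := by
  refine le_antisymm ?_ ?_
  · rw [J.height_eq_inf_minimalPrimes]
    refine le_iInf₂ fun p hp => ?_
    have := hp.isPrime
    rw [← height_map_C_of_isPrime p]
    exact Ideal.height_mono (Ideal.map_mono hp.1.2)
  · rw [(J.map _).height_eq_inf_minimalPrimes]
    refine le_iInf₂ fun P hP => ?_
    have := hP.isPrime
    have : (P.comap Polynomial.C).IsPrime := Ideal.IsPrime.comap _
    refine le_trans (Ideal.height_mono (Ideal.map_le_iff_le_comap.1 hP.1.2)) ?_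
    rw [← height_map_C_of_isPrime]
    exact Ideal.height_mono (map_C_comap_C_le P)

/-- Reduction to primes: a minimal prime over the contraction of `I` is itself the contraction of
some prime containing `I`, and one can be found below a prime that attains the height of the
contraction. -/
theorem height_le_height_comap_C_add_one' (I : Ideal (Polynomial A)) :
    I.height ≤ (I.comap Polynomial.C).height + 1 := by
  rcases eq_or_ne (I.comap Polynomial.C) ⊤ with h | h
  · rw [h, Ideal.height_top]
    simp
  have hfin := Ideal.height_ne_top h
  obtain ⟨c, hc⟩ := ENat.ne_top_iff_exists.1 hfin
  obtain ⟨q, hq, hle, hqc⟩ := Ideal.exists_isPrime_height_eq hc.symm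
  obtain ⟨q', hq', hle'⟩ := Ideal.exists_minimalPrimes_le hle
  obtain ⟨P, hP, hIP, rfl⟩ := Ideal.exists_comap_eq_of_mem_minimalPrimes Polynomial.C q' hq'
  calc I.height ≤ P.height := Ideal.height_mono hIP
    _ ≤ (P.comap Polynomial.C).height + 1 := height_le_height_comap_C_add_one P
    _ ≤ q.height + 1 := by gcongr
    _ = _ := by rw [hqc, hc]

/-- If `P` is extended from `A`, its height is that of its contraction. If not, the height may grow
by one, but some leading coefficient is then outside the contraction, so `q` is strictly larger than
the contraction and makes up for it. -/
theorem height_le_of_leadingCoeff_le_of_isPrime (P : Ideal (Polynomial A)) [P.IsPrime]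
    (q : Ideal A) [q.IsPrime] (hq : P.leadingCoeff ≤ q) : P.height ≤ q.height := by
  have : (P.comap Polynomial.C).IsPrime := Ideal.IsPrime.comap _
  by_cases h : P = (P.comap Polynomial.C).map Polynomial.C
  · rw [h, height_map_C_of_isPrime]
    exact Ideal.height_mono ((comap_C_le_leadingCoeff P).trans hq)
  · refine (height_le_height_comap_C_add_one P).trans ?_
    exact Ideal.height_add_one_le_of_lt_of_isPrime (comap_C_lt_of_leadingCoeff_le h hq)

/-- Passing to leading coefficients does not lower the height. -/
theorem height_le_height_leadingCoeff (I : Ideal (Polynomial A)) :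
    I.height ≤ I.leadingCoeff.height := by
  rw [I.leadingCoeff.height_eq_inf_minimalPrimes]
  refine le_iInf₂ fun q hq => ?_
  have hqp := hq.isPrime
  suffices ∃ P ∈ I.minimalPrimes, P.leadingCoeff ≤ q by
    obtain ⟨P, hP, hle⟩ := this
    have := hP.isPrime
    exact (Ideal.height_mono hP.1.2).trans (height_le_of_leadingCoeff_le_of_isPrime P q hle)
  -- If no minimal prime of `I` had its leading coefficients in `q`, choosing in each an element
  -- with leading coefficient outside `q` and multiplying would give an element of the radical, a
  -- power of which lies in `I`.
  by_contra! hc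
  have hex : ∀ P ∈ I.minimalPrimes, ∃ f ∈ P, f.leadingCoeff ∉ q := by
    intro P hP
    obtain ⟨x, hx, hxq⟩ := SetLike.not_le_iff_exists.1 (hc P hP)
    obtain ⟨f, hf, rfl⟩ := (P.mem_leadingCoeff x).1 hx
    exact ⟨f, hf, hxq⟩
  choose! F hF hFq using hex
  have hfin := Ideal.finite_minimalPrimes_of_isNoetherianRing (Polynomial A) I
  have hprod : ∏ P ∈ hfin.toFinset, (F P).leadingCoeff ∉ q := by
    rw [hqp.prod_mem_iff]
    rintro ⟨P, hP, hmem⟩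
    exact hFq P (hfin.mem_toFinset.1 hP) hmem
  have hne : ∏ P ∈ hfin.toFinset, (F P).leadingCoeff ≠ 0 := fun h0 => hprod (h0 ▸ q.zero_mem)
  have hrad : ∏ P ∈ hfin.toFinset, F P ∈ I.radical := by
    rw [← Ideal.sInf_minimalPrimes, Ideal.mem_sInf]
    intro P hP
    exact P.mem_of_dvd (Finset.dvd_prod_of_mem F (hfin.mem_toFinset.2 hP)) (hF P hP)
  obtain ⟨j, hj⟩ := hrad
  have hpow : (∏ P ∈ hfin.toFinset, (F P).leadingCoeff) ^ j ∉ q := fun h =>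
    hprod (hqp.mem_of_pow_mem _ h)
  refine hpow (hq.1.2 ((I.mem_leadingCoeff _).2 ⟨_, hj, ?_⟩))
  -- `A` need not be a domain: leading coefficients multiply here because their product, and its
  -- power, avoid `q` and so are nonzero.
  rw [Polynomial.leadingCoeff_pow', Polynomial.leadingCoeff_prod' _ _ hne]
  rw [Polynomial.leadingCoeff_prod' _ _ hne]
  exact fun h0 => hpow (h0 ▸ q.zero_mem)

/-- The extension of the contraction is a prime strictly below `P` with the height of the
contraction. -/
theorem height_eq_height_comap_C_add_one {P : Ideal (Polynomial A)} [P.IsPrime]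
    (h : P ≠ (P.comap Polynomial.C).map Polynomial.C) :
    P.height = (P.comap Polynomial.C).height + 1 := by
  have : (P.comap Polynomial.C).IsPrime := Ideal.IsPrime.comap _
  have : ((P.comap Polynomial.C).map (Polynomial.C : A →+* Polynomial A)).IsPrime :=
    Ideal.isPrime_map_C_of_isPrime
  refine le_antisymm (height_le_height_comap_C_add_one P) ?_
  rw [← height_map_C_of_isPrime]
  exact Ideal.height_add_one_le_of_lt_of_isPrime
    (lt_of_le_of_ne (map_C_comap_C_le P) (Ne.symm h))

end Heights

/-! ### Transcendence degrees, the dimension formula, and hyperplane sections. -/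

section Trdeg

open Cardinal

universe u

theorem trdeg_eq_of_isAlgebraic (k A B : Type u) [Field k] [CommRing A] [CommRing B]
    [IsDomain B] [Algebra k A] [Algebra k B] [Algebra A B] [IsScalarTower k A B]
    (hinj : Function.Injective (algebraMap A B)) [Algebra.IsAlgebraic A B] :
    Algebra.trdeg k B = Algebra.trdeg k A := by
  have : FaithfulSMul A B := (faithfulSMul_iff_algebraMap_injective A B).2 hinj
  have : Nontrivial A := (algebraMap A B).domain_nontrivial
  have := trdeg_add_eq (R := k) (S := A) (A := B)
  rw [← this, trdeg_eq_zero (R := A) (A := B), add_zero]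

/-- An element of `P₁` whose leading coefficient is not in `p` reduces to a nonzero polynomial over
`A ⧸ p` that vanishes at the class of the variable, and this class generates. -/
theorem isAlgebraic_quotient {A : Type*} [CommRing A] [IsNoetherianRing A]
    (P₁ : Ideal (Polynomial A)) [P₁.IsPrime] (p : Ideal A) [p.IsPrime]
    (hp : p = P₁.comap Polynomial.C) [P₁.LiesOver p] (h : P₁ ≠ p.map Polynomial.C) :
    Algebra.IsAlgebraic (A ⧸ p) (Polynomial A ⧸ P₁) := by
  obtain ⟨f, hf, hlc⟩ := exists_leadingCoeff_notMem (hp ▸ h)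
  have hx : IsAlgebraic (A ⧸ p)
      (Ideal.Quotient.mk P₁ Polynomial.X) := by
    refine ⟨f.map (Ideal.Quotient.mk p), fun h0 => hlc ?_, ?_⟩
    · rw [← hp, ← Ideal.Quotient.eq_zero_iff_mem, ← Polynomial.coeff_natDegree,
        ← Polynomial.coeff_map, h0, Polynomial.coeff_zero]
    · rw [Polynomial.aeval_def, Polynomial.eval₂_map]
      have : ((algebraMap (A ⧸ p)
          (Polynomial A ⧸ P₁)).comp (Ideal.Quotient.mk p)) =
          (Ideal.Quotient.mk P₁).comp Polynomial.C := rfl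
      rw [this, ← Polynomial.hom_eval₂, Polynomial.eval₂_C_X]
      exact Ideal.Quotient.eq_zero_iff_mem.2 hf
  refine ⟨fun x => ?_⟩
  obtain ⟨x, rfl⟩ := Ideal.Quotient.mk_surjective x
  induction x using Polynomial.induction_on' with
  | add f g hf hg => rw [map_add]; exact hf.add hg
  | monomial i c =>
    rw [← Polynomial.C_mul_X_pow_eq_monomial, map_mul, map_pow]
    exact (isAlgebraic_algebraMap (Ideal.Quotient.mk p c)).mul (hx.pow i)

theorem trdeg_quotient_of_ne_map {k A : Type u} [Field k] [CommRing A] [IsNoetherianRing A]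
    [Algebra k A] (P₁ : Ideal (Polynomial A)) [P₁.IsPrime]
    (h : P₁ ≠ (P₁.comap Polynomial.C).map Polynomial.C) :
    Algebra.trdeg k (Polynomial A ⧸ P₁) = Algebra.trdeg k (A ⧸ P₁.comap Polynomial.C) := by
  have : (P₁.comap Polynomial.C).IsPrime := Ideal.IsPrime.comap _
  have : P₁.LiesOver (P₁.comap Polynomial.C) := ⟨rfl⟩
  have : IsScalarTower k (A ⧸ P₁.comap Polynomial.C) (Polynomial A ⧸ P₁) :=
    Ideal.Quotient.isScalarTower_of_liesOver k P₁ (P₁.comap Polynomial.C)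
  have := isAlgebraic_quotient P₁ (P₁.comap Polynomial.C) rfl h
  exact trdeg_eq_of_isAlgebraic k _ _ (FaithfulSMul.algebraMap_injective _ _)

theorem trdeg_polynomial (k D : Type u) [Field k] [CommRing D] [IsDomain D] [Algebra k D] :
    Algebra.trdeg k (Polynomial D) = Algebra.trdeg k D + 1 := by
  rw [← trdeg_add_eq (R := k) (S := D) (A := Polynomial D), Polynomial.trdeg_of_isDomain]

theorem trdeg_quotient_of_ker {k A B : Type u} [Field k] [CommRing A] [CommRing B]
    [Algebra k A] [Algebra k B] (φ : A →ₐ[k] B) (hφ : Function.Surjective φ) {P : Ideal A}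
    (hker : RingHom.ker φ = P) : Algebra.trdeg k (A ⧸ P) = Algebra.trdeg k B := by
  subst hker
  exact AlgEquiv.trdeg_eq (A := A ⧸ RingHom.ker φ) (A' := B)
    (Ideal.quotientKerAlgEquivOfSurjective hφ)

theorem trdeg_quotient_map_C {k A : Type u} [Field k] [CommRing A] [Algebra k A]
    (p : Ideal A) [p.IsPrime] :
    Algebra.trdeg k (Polynomial A ⧸ p.map (Polynomial.C : A →+* Polynomial A)) =
      Algebra.trdeg k (A ⧸ p) + 1 := by
  let φ : Polynomial A →ₐ[k] Polynomial (A ⧸ p) := Polynomial.mapAlgHom (Ideal.Quotient.mkₐ k p)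
  have hφ : Function.Surjective φ :=
    Polynomial.map_surjective (Ideal.Quotient.mk p) Ideal.Quotient.mk_surjective
  have hker : RingHom.ker φ = p.map (Polynomial.C : A →+* Polynomial A) := by
    ext f
    rw [RingHom.mem_ker, Ideal.mem_map_C_iff, Polynomial.ext_iff]
    refine forall_congr' fun i => ?_
    rw [← Ideal.Quotient.eq_zero_iff_mem]
    simp [φ]
  rw [trdeg_quotient_of_ker φ hφ hker, trdeg_polynomial]

/-- The dimension formula in a polynomial ring over a field. -/
theorem exists_trdeg_add_height {k : Type u} [Field k] {n : ℕ}
    (P : Ideal (MvPolynomial (Fin n) k)) [P.IsPrime] :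
    ∃ t : ℕ, Algebra.trdeg k (MvPolynomial (Fin n) k ⧸ P) = t ∧ P.height + t = n := by
  induction n with
  | zero =>
    refine ⟨0, ?_, ?_⟩
    · have hs : Function.Surjective (algebraMap k (MvPolynomial (Fin 0) k ⧸ P)) := by
        rw [IsScalarTower.algebraMap_eq k (MvPolynomial (Fin 0) k)]
        exact Ideal.Quotient.mk_surjective.comp (MvPolynomial.C_surjective (Fin 0))
      have : Algebra.IsAlgebraic k (MvPolynomial (Fin 0) k ⧸ P) :=
        ⟨fun x => by obtain ⟨c, rfl⟩ := hs x; exact isAlgebraic_algebraMap c⟩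
      rw [trdeg_eq_zero, Nat.cast_zero]
    · have := (MvPolynomial.isEmptyRingEquiv k (Fin 0)).toMulEquiv.isField (Field.toIsField k)
      rw [Nat.cast_zero, add_zero]
      have hbot : P = ⊥ := by
        let _ := this.toField
        exact (Ideal.eq_bot_or_top P).resolve_right Ideal.IsPrime.ne_top'
      rw [hbot, Ideal.height_bot]
  | succ n ih =>
    have hprime : (polyIdeal P).IsPrime := Ideal.IsPrime.comap _
    have hh : (polyIdeal P).height = P.height :=
      RingEquiv.height_comap (MvPolynomial.finSuccEquiv k n).symm.toRingEquiv P
    have htr : Algebra.trdeg k (MvPolynomial (Fin (n + 1)) k ⧸ P) =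
        Algebra.trdeg k (Polynomial (MvPolynomial (Fin n) k) ⧸ polyIdeal P) := by
      refine (Ideal.quotientEquivAlg (polyIdeal P) P
        (MvPolynomial.finSuccEquiv k n).symm ?_).symm.trdeg_eq
      exact (Ideal.map_comap_of_surjective _ (MvPolynomial.finSuccEquiv k n).symm.surjective
        P).symm
    rw [← hh, htr]
    generalize polyIdeal P = P₁ at *
    set p := P₁.comap Polynomial.C with hp
    have hpp : p.IsPrime := Ideal.IsPrime.comap _
    obtain ⟨t, ht, hpt⟩ := ih p
    -- One more variable raises exactly one of the two numbers: the transcendence degree if `P₁` is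
    -- extended, the height if it is not.
    by_cases h : P₁ = p.map Polynomial.C
    · refine ⟨t + 1, ?_, ?_⟩
      · rw [h, trdeg_quotient_map_C, ht]
        norm_cast
      · rw [h, height_map_C_of_isPrime]
        push_cast
        rw [← add_assoc, hpt]
    · refine ⟨t, ?_, ?_⟩
      · rw [trdeg_quotient_of_ne_map P₁ h, ht]
      · rw [height_eq_height_comap_C_add_one h, add_right_comm, hpt]
        norm_cast

/-- Noether normalisation makes `D` finite over a polynomial ring. The contraction of `M` has height
at most one by Krull's theorem and going down, and is nonzero because `z` is integral. The dimension
formula in the polynomial ring applies, and finite extensions preserve transcendence degree. -/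
theorem trdeg_quotient_add_one {k D : Type u} [Field k] [CommRing D] [IsDomain D] [Algebra k D]
    [Algebra.FiniteType k D] {z : D} (hz : z ≠ 0) {M : Ideal D}
    (hM : M ∈ (Ideal.span {z}).minimalPrimes) :
    Algebra.trdeg k (D ⧸ M) + 1 = Algebra.trdeg k D := by
  obtain ⟨s, g, hg, hfin⟩ := exists_finite_inj_algHom_of_fg k D
  have hMp := hM.isPrime
  have hnoeth : IsNoetherianRing D := Algebra.FiniteType.isNoetherianRing k D
  algebraize [g.toRingHom]
  have hinj : Function.Injective (algebraMap (MvPolynomial (Fin s) k) D) := hg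
  have : FaithfulSMul (MvPolynomial (Fin s) k) D :=
    (faithfulSMul_iff_algebraMap_injective _ _).2 hinj
  have hint : Algebra.IsIntegral (MvPolynomial (Fin s) k) D :=
    ⟨fun x => RingHom.Finite.to_isIntegral hfin x⟩
  set p := M.under (MvPolynomial (Fin s) k) with hp
  have hlies : M.LiesOver p := ⟨rfl⟩
  have hpp : p.IsPrime := Ideal.IsPrime.under _ M
  have h1 : p.height ≤ 1 := by
    have := Ideal.height_eq_height_add_of_liesOver_of_hasGoingDown p M
    exact (this ▸ le_self_add).trans
      (Ideal.height_le_one_of_isPrincipal_of_mem_minimalPrimes _ M hM)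
  have h2 : p ≠ ⊥ := by
    intro h0
    exact Ideal.comap_ne_bot_of_integral_mem hz (hM.1.2 (Ideal.mem_span_singleton_self z))
      (hint.isIntegral z) h0
  have h3 : p.height = 1 := by
    refine le_antisymm h1 ?_
    have := Ideal.height_add_one_le_of_lt_of_isPrime
      (bot_lt_iff_ne_bot.2 h2 : (⊥ : Ideal (MvPolynomial (Fin s) k)) < p)
    rwa [Ideal.height_bot, zero_add] at this
  obtain ⟨t, ht, hpt⟩ := exists_trdeg_add_height p
  have hs : t + 1 = s := by
    rw [h3, add_comm] at hpt
    exact_mod_cast hpt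
  have e1 : Algebra.trdeg k (D ⧸ M) = Algebra.trdeg k (MvPolynomial (Fin s) k ⧸ p) := by
    have : IsScalarTower k (MvPolynomial (Fin s) k ⧸ p) (D ⧸ M) :=
      Ideal.Quotient.isScalarTower_of_liesOver k M p
    exact trdeg_eq_of_isAlgebraic k _ _ (FaithfulSMul.algebraMap_injective _ _)
  have e2 : Algebra.trdeg k D = Algebra.trdeg k (MvPolynomial (Fin s) k) :=
    trdeg_eq_of_isAlgebraic k _ _ hinj
  rw [e1, e2, ht, MvPolynomial.trdeg_of_isDomain, Cardinal.mk_fin, Cardinal.lift_natCast, ← hs]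
  norm_cast

/-- Restriction of functions to the hyperplane `X 0 = 0`. -/
def restrictHyperplane (k : Type*) [Field k] (n : ℕ) :
    MvPolynomial (Fin (n + 1)) k →ₐ[k] MvPolynomial (Fin n) k :=
  aeval (Fin.cons 0 X)

theorem restrictHyperplane_X_zero (k : Type*) [Field k] (n : ℕ) :
    restrictHyperplane k n (X 0) = 0 := by
  simp [restrictHyperplane]

theorem restrictHyperplane_proj {k : Type*} [Field k] {n : ℕ} (f : MvPolynomial (Fin n) k) :
    restrictHyperplane k n (proj k n f) = f := by
  have : (restrictHyperplane k n).comp (proj k n) = AlgHom.id k _ := by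
    ext i
    simp [restrictHyperplane, proj]
  exact DFunLike.congr_fun this f

theorem mk_proj_restrictHyperplane {k : Type*} [Field k] {n : ℕ}
    {I : Ideal (MvPolynomial (Fin (n + 1)) k)} (hI : X 0 ∈ I) (f : MvPolynomial (Fin (n + 1)) k) :
    Ideal.Quotient.mk I (proj k n (restrictHyperplane k n f)) = Ideal.Quotient.mk I f := by
  have : (Ideal.Quotient.mkₐ k I).comp ((proj k n).comp (restrictHyperplane k n)) =
      Ideal.Quotient.mkₐ k I := by
    ext i
    refine Fin.cases ?_ (fun i => ?_) i
    · simpa [restrictHyperplane, proj] using (Ideal.Quotient.eq_zero_iff_mem.2 hI).symm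
    · simp [restrictHyperplane, proj]
  exact DFunLike.congr_fun this f

/-- A component of the section of the variety of `P` by `X 0 = 0` has dimension one less, and so has
the ambient space; hence its height in the hyperplane equals the height of `P`. Its ideal contains
the restriction of `P`. -/
theorem height_map_restrictHyperplane_le {k : Type u} [Field k] {n : ℕ}
    (P : Ideal (MvPolynomial (Fin (n + 1)) k)) [P.IsPrime] (hP : X 0 ∉ P)
    (hne : P.map (restrictHyperplane k n) ≠ ⊤) :
    (P.map (restrictHyperplane k n)).height ≤ P.height := by
  have hsup : P ⊔ Ideal.span {X 0} ≠ ⊤ := by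
    intro h
    refine hne ?_
    have := congrArg (Ideal.map (restrictHyperplane k n)) h
    rwa [Ideal.map_sup, Ideal.map_span, Set.image_singleton, restrictHyperplane_X_zero,
      Ideal.span_singleton_zero, sup_bot_eq, Ideal.map_top] at this
  have hz : Ideal.Quotient.mk P (X 0) ≠ 0 := fun h => hP (Ideal.Quotient.eq_zero_iff_mem.1 h)
  have hspan : Ideal.span {Ideal.Quotient.mk P (X 0)} ≠ ⊤ := by
    intro h
    refine hsup ?_
    rw [sup_comm, ← Ideal.comap_map_mk (I := P) le_sup_right, Ideal.map_sup,
      Ideal.map_quotient_self, sup_bot_eq, Ideal.map_span, Set.image_singleton, h, Ideal.comap_top]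
  obtain ⟨N, hN⟩ := Ideal.nonempty_minimalPrimes hspan
  have hNp := hN.isPrime
  set M := N.comap (Ideal.Quotient.mk P) with hM
  have hMp : M.IsPrime := Ideal.IsPrime.comap _
  have hPM : P ≤ M := fun f hf => by
    rw [hM, Ideal.mem_comap, Ideal.Quotient.eq_zero_iff_mem.2 hf]
    exact N.zero_mem
  have hXM : X 0 ∈ M := hN.1.2 (Ideal.mem_span_singleton_self _)
  have hq : (M.comap (proj k n)).IsPrime := Ideal.IsPrime.comap _
  have e1 : Algebra.trdeg k (MvPolynomial (Fin n) k ⧸ M.comap (proj k n)) =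
      Algebra.trdeg k (MvPolynomial (Fin (n + 1)) k ⧸ M) := by
    refine trdeg_quotient_of_ker ((Ideal.Quotient.mkₐ k M).comp (proj k n)) (fun x => ?_) ?_
    · obtain ⟨f, rfl⟩ := Ideal.Quotient.mk_surjective x
      exact ⟨restrictHyperplane k n f, mk_proj_restrictHyperplane hXM f⟩
    · ext f
      exact Ideal.Quotient.eq_zero_iff_mem
  have e2 : Algebra.trdeg k (MvPolynomial (Fin (n + 1)) k ⧸ M) + 1 =
      Algebra.trdeg k (MvPolynomial (Fin (n + 1)) k ⧸ P) := by
    rw [← trdeg_quotient_add_one (k := k) hz hN]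
    congr 1
    refine trdeg_quotient_of_ker ((Ideal.Quotient.mkₐ k N).comp (Ideal.Quotient.mkₐ k P)) ?_ ?_
    · exact Ideal.Quotient.mk_surjective.comp Ideal.Quotient.mk_surjective
    · ext f
      exact Ideal.Quotient.eq_zero_iff_mem
  obtain ⟨t, ht, hqt⟩ := exists_trdeg_add_height (M.comap (proj k n))
  obtain ⟨t', ht', hPt⟩ := exists_trdeg_add_height P
  have htt : t + 1 = t' := by
    rw [← e1, ht, ht'] at e2
    exact_mod_cast e2
  have hle : P.map (restrictHyperplane k n) ≤ M.comap (proj k n) := by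
    refine Ideal.map_le_iff_le_comap.2 fun f hf => ?_
    rw [Ideal.mem_comap, Ideal.mem_comap, ← Ideal.Quotient.eq_zero_iff_mem,
      mk_proj_restrictHyperplane hXM]
    exact Ideal.Quotient.eq_zero_iff_mem.2 (hPM hf)
  refine (Ideal.height_mono hle).trans ?_
  have h1 : (M.comap (proj k n)).height + (t + 1 : ℕ) = P.height + (t + 1 : ℕ) := by
    rw [htt, hPt, ← htt]
    push_cast
    rw [← add_assoc, hqt]
  exact (WithTop.add_right_cancel (ENat.natCast_ne_top _) h1).le

end Trdeg

/-! ### Order of the `K`-series, and the subschemes `Z × L` and `Z × {0}`. -/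

section Hyperplane

variable {k : Type*} [Field k] {m n r : ℕ}

theorem height_polyIdeal (I : Ideal (MvPolynomial (Fin (n + 1)) k)) :
    (polyIdeal I).height = I.height :=
  RingEquiv.height_comap (MvPolynomial.finSuccEquiv k n).symm.toRingEquiv I

theorem kSeries_top (w : Fin m → Fin r → ℤ) :
    kSeries w (⊤ : Ideal (MvPolynomial (Fin m) k)) = 0 := by
  rw [kSeries, finsum_eq_zero_of_forall_eq_zero]
  intro a
  rw [(isHomog_top w).kCoeff_quotient, sub_self, zero_smul]

theorem comap_C_eq_leadingCoeffNth_zero {A : Type*} [CommRing A] (J : Ideal (Polynomial A)) :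
    J.comap Polynomial.C = J.leadingCoeffNth 0 := by
  ext x
  rw [Ideal.mem_leadingCoeffNth_zero, Ideal.mem_comap]

/-- The series `K(R/I; 1 - t)` has no terms of degree less than the codimension. -/
theorem IsHomog.ordGE_kSeries {w : Fin n → Fin r → ℤ} {I : Ideal (MvPolynomial (Fin n) k)}
    (h : IsHomog w I) {c : ℕ} (hc : (c : ℕ∞) ≤ I.height) : OrdGE c (kSeries w I) := by
  induction n generalizing c with
  | zero =>
    have := (MvPolynomial.isEmptyRingEquiv k (Fin 0)).toMulEquiv.isField (Field.toIsField k)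
    let _ := this.toField
    rcases Ideal.eq_bot_or_top I with rfl | rfl
    · rw [Ideal.height_bot, nonpos_iff_eq_zero, Nat.cast_eq_zero] at hc
      subst hc
      exact OrdGE.zero _
    · rw [kSeries_top]
      exact fun _ _ => map_zero _
  | succ n ih =>
    obtain ⟨N, hN⟩ := exists_stable_leadingCoeffNth (polyIdeal I)
    cases c with
    | zero => exact OrdGE.zero _
    | succ c =>
      rw [h.kSeries_succ hN]
      rw [← height_polyIdeal] at hc
      -- In the sum, contraction may lower the height by one, and the factor `1 - oneSubPow (w 0)`
      -- restores one order. The last term has no such factor, but the leading coefficient ideal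
      -- loses no height.
      refine OrdGE.add ?_ ?_
      · rw [add_comm c 1]
        refine (hasLinear_oneSubPow (w 0)).1.mul (OrdGE.sum _ fun j _ => ?_)
        refine (OrdGE.oneSubPow_mul (ih (h.leadingCoeffNth j) ?_) _ _).1
        have h1 := hc.trans (height_le_height_comap_C_add_one' (polyIdeal I))
        rw [Nat.cast_add, Nat.cast_one, comap_C_eq_leadingCoeffNth_zero] at h1
        exact ((ENat.add_le_add_iff_right ENat.one_ne_top).1 h1).trans
          (Ideal.height_mono ((polyIdeal I).leadingCoeffNth_mono (Nat.zero_le j)))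
      · refine (OrdGE.oneSubPow_mul (ih (h.leadingCoeffNth N) ?_) _ _).1
        rw [← leadingCoeff_eq_of_stable hN]
        exact hc.trans (height_le_height_leadingCoeff _)

theorem finSuccEquiv_proj (f : MvPolynomial (Fin n) k) :
    MvPolynomial.finSuccEquiv k n (proj k n f) = Polynomial.C f := by
  have : ((MvPolynomial.finSuccEquiv k n).toAlgHom.comp (proj k n)) =
      IsScalarTower.toAlgHom k (MvPolynomial (Fin n) k) (Polynomial (MvPolynomial (Fin n) k)) := by
    ext1 i
    simp [proj, MvPolynomial.finSuccEquiv_X_succ]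
  exact DFunLike.congr_fun this f

theorem projPart_eq_comap_C (I : Ideal (MvPolynomial (Fin (n + 1)) k)) :
    projPart I = (polyIdeal I).comap Polynomial.C := by
  ext f
  rw [Ideal.mem_comap, ← finSuccEquiv_proj, finSuccEquiv_mem_polyIdeal]
  rfl

theorem polyIdeal_eq_map (I : Ideal (MvPolynomial (Fin (n + 1)) k)) :
    polyIdeal I = I.map (MvPolynomial.finSuccEquiv k n) :=
  Ideal.comap_symm (MvPolynomial.finSuccEquiv k n).toRingEquiv

theorem polyIdeal_timesLine (J : Ideal (MvPolynomial (Fin n) k)) :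
    polyIdeal (timesLine J) = J.map Polynomial.C := by
  have : (MvPolynomial.finSuccEquiv k n : MvPolynomial (Fin (n + 1)) k →+* _).comp
      (proj k n : MvPolynomial (Fin n) k →+* MvPolynomial (Fin (n + 1)) k) = Polynomial.C :=
    RingHom.ext finSuccEquiv_proj
  rw [polyIdeal_eq_map, timesLine, ← this, ← Ideal.map_map]
  rfl

theorem map_C_sup_span_X {A : Type*} [CommRing A] (J : Ideal A) :
    J.map Polynomial.C ⊔ Ideal.span {Polynomial.X} = J.comap Polynomial.constantCoeff := by
  refine le_antisymm (sup_le (Ideal.map_le_iff_le_comap.2 fun x hx => ?_) ?_) fun p hp => ?_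
  · simpa using hx
  · rw [Ideal.span_singleton_le_iff_mem]
    simp
  · rw [← Polynomial.divX_mul_X_add p]
    refine Ideal.add_mem _ (Ideal.mem_sup_right ?_) (Ideal.mem_sup_left (Ideal.mem_map_of_mem _ hp))
    exact Ideal.mul_mem_left _ _ (Ideal.mem_span_singleton_self _)

theorem polyIdeal_inHyperplane (J : Ideal (MvPolynomial (Fin n) k)) :
    polyIdeal (inHyperplane J) = J.comap Polynomial.constantCoeff := by
  rw [← map_C_sup_span_X, ← polyIdeal_timesLine, polyIdeal_eq_map, polyIdeal_eq_map, inHyperplane,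
    Ideal.map_sup, Ideal.map_span, Set.image_singleton, MvPolynomial.finSuccEquiv_X_zero]

theorem isHomog_of_polyComp_mem {w : Fin (n + 1) → Fin r → ℤ}
    {I : Ideal (MvPolynomial (Fin (n + 1)) k)}
    (h : ∀ f ∈ polyIdeal I, ∀ a, polyComp w a f ∈ polyIdeal I) : IsHomog w I := by
  intro f hf a
  have := h _ (finSuccEquiv_mem_polyIdeal.2 hf) a
  rwa [polyComp, AlgEquiv.symm_apply_apply, finSuccEquiv_mem_polyIdeal] at this

theorem IsHomog.timesLine {w : Fin (n + 1) → Fin r → ℤ} {J : Ideal (MvPolynomial (Fin n) k)}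
    (h : IsHomog (fun i => w i.succ) J) : IsHomog w (timesLine J) := by
  refine isHomog_of_polyComp_mem fun f hf a => ?_
  rw [polyIdeal_timesLine, Ideal.mem_map_C_iff] at hf ⊢
  intro i
  rw [coeff_polyComp]
  exact h _ (hf i) _

theorem IsHomog.inHyperplane {w : Fin (n + 1) → Fin r → ℤ} {J : Ideal (MvPolynomial (Fin n) k)}
    (h : IsHomog (fun i => w i.succ) J) : IsHomog w (inHyperplane J) := by
  refine isHomog_of_polyComp_mem fun f hf a => ?_
  rw [polyIdeal_inHyperplane, Ideal.mem_comap, Polynomial.constantCoeff_apply] at hf ⊢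
  rw [coeff_polyComp]
  exact h _ hf _

theorem leadingCoeffNth_map_C {A : Type*} [CommRing A] (J : Ideal A) (i : ℕ) :
    (J.map (Polynomial.C : A →+* Polynomial A)).leadingCoeffNth i = J := by
  ext x
  rw [mem_leadingCoeffNth_iff_coeff]
  constructor
  · rintro ⟨p, hp, -, rfl⟩
    exact Ideal.mem_map_C_iff.1 hp i
  · intro hx
    refine ⟨Polynomial.monomial i x, Ideal.mem_map_C_iff.2 fun j => ?_, ?_, by simp⟩
    · rw [Polynomial.coeff_monomial]
      split_ifs
      exacts [hx, J.zero_mem]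
    · exact lt_of_le_of_lt (Polynomial.degree_monomial_le i x) (by exact_mod_cast i.lt_succ_self)

theorem constantCoeff_comp_C (A : Type*) [CommRing A] :
    (Polynomial.constantCoeff : Polynomial A →+* A).comp Polynomial.C = RingHom.id A :=
  RingHom.ext fun _ => Polynomial.coeff_C_zero

theorem leadingCoeffNth_comap_constantCoeff_zero {A : Type*} [CommRing A] (J : Ideal A) :
    (J.comap (Polynomial.constantCoeff : Polynomial A →+* A)).leadingCoeffNth 0 = J := by
  rw [← comap_C_eq_leadingCoeffNth_zero, Ideal.comap_comap, constantCoeff_comp_C,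
    Ideal.comap_id]

theorem leadingCoeffNth_comap_constantCoeff {A : Type*} [CommRing A] (J : Ideal A) {i : ℕ}
    (hi : 1 ≤ i) :
    (J.comap (Polynomial.constantCoeff : Polynomial A →+* A)).leadingCoeffNth i = ⊤ := by
  rw [Ideal.eq_top_iff_one, mem_leadingCoeffNth_iff_coeff]
  refine ⟨Polynomial.X ^ i, ?_, ?_, by simp⟩
  · rw [Ideal.mem_comap, Polynomial.constantCoeff_apply, Polynomial.coeff_X_pow,
      if_neg (by omega)]
    exact J.zero_mem
  · exact lt_of_le_of_lt (Polynomial.degree_X_pow_le i) (by exact_mod_cast i.lt_succ_self)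

theorem kSeries_timesLine {w : Fin (n + 1) → Fin r → ℤ} {J : Ideal (MvPolynomial (Fin n) k)}
    (h : IsHomog (fun i => w i.succ) J) :
    kSeries w (timesLine J) = kSeries (fun i => w i.succ) J := by
  rw [h.timesLine.kSeries_succ (N := 0)]
  · simp [polyIdeal_timesLine, leadingCoeffNth_map_C]
  · simp [polyIdeal_timesLine, leadingCoeffNth_map_C]

/-- The leading coefficient ideals are `J` in degree `0` and the unit ideal from degree `1` on, so
the recursion with `N = 1` keeps a single term. -/
theorem kSeries_inHyperplane {w : Fin (n + 1) → Fin r → ℤ} {J : Ideal (MvPolynomial (Fin n) k)}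
    (h : IsHomog (fun i => w i.succ) J) :
    kSeries w (inHyperplane J) = (1 - oneSubPow (w 0)) * kSeries (fun i => w i.succ) J := by
  rw [h.inHyperplane.kSeries_succ (N := 1)]
  · rw [polyIdeal_inHyperplane, leadingCoeffNth_comap_constantCoeff _ le_rfl, kSeries_top]
    simp [leadingCoeffNth_comap_constantCoeff_zero]
  · intro i hi
    rw [polyIdeal_inHyperplane, leadingCoeffNth_comap_constantCoeff _ hi,
      leadingCoeffNth_comap_constantCoeff _ le_rfl]

theorem height_timesLine (J : Ideal (MvPolynomial (Fin n) k)) :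
    (timesLine J).height = J.height := by
  rw [← height_polyIdeal, polyIdeal_timesLine, height_map_C_eq]

theorem height_inHyperplane (Q : Ideal (MvPolynomial (Fin n) k)) [Q.IsPrime] :
    (inHyperplane Q).height = Q.height + 1 := by
  rw [← height_polyIdeal, polyIdeal_inHyperplane]
  have hp : (Q.comap (Polynomial.constantCoeff (R := MvPolynomial (Fin n) k))).IsPrime :=
    Ideal.IsPrime.comap _
  have hc : (Q.comap (Polynomial.constantCoeff (R := MvPolynomial (Fin n) k))).comap
      Polynomial.C = Q := by
    rw [Ideal.comap_comap, constantCoeff_comp_C, Ideal.comap_id]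
  rw [height_eq_height_comap_C_add_one, hc]
  rw [hc]
  intro h
  have hX : (Polynomial.X : Polynomial (MvPolynomial (Fin n) k)) ∈
      Q.comap (Polynomial.constantCoeff (R := MvPolynomial (Fin n) k)) := by
    simp
  rw [h, Ideal.mem_map_C_iff] at hX
  have := hX 1
  rw [Polynomial.coeff_X_one] at this
  exact Ideal.IsPrime.ne_top ‹Q.IsPrime› ((Ideal.eq_top_iff_one _).2 this)

theorem multidegree_timesLine {w : Fin (n + 1) → Fin r → ℤ} {J : Ideal (MvPolynomial (Fin n) k)}
    (h : IsHomog (fun i => w i.succ) J) :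
    multidegree w (timesLine J) = multidegree (fun i => w i.succ) J := by
  rw [multidegree_eq_homPart, multidegree_eq_homPart, height_timesLine, kSeries_timesLine h]

theorem multidegree_inHyperplane {w : Fin (n + 1) → Fin r → ℤ}
    {Q : Ideal (MvPolynomial (Fin n) k)} [Q.IsPrime] (h : IsHomog (fun i => w i.succ) Q) :
    multidegree w (inHyperplane Q) = multidegree (fun i => w i.succ) Q * wt (w 0) := by
  have hfin : Q.height ≠ ⊤ := Ideal.height_ne_top_of_isPrime
  have hQ : ((Q.height.toNat : ℕ) : ℕ∞) = Q.height := ENat.natCast_toNat hfin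
  have hh : (inHyperplane Q).height.toNat = 1 + Q.height.toNat := by
    rw [height_inHyperplane, ENat.toNat_add hfin ENat.one_ne_top, add_comm]
    rfl
  rw [multidegree_eq_homPart, multidegree_eq_homPart, hh, kSeries_inHyperplane h,
    OrdGE.homPart_mul (hasLinear_oneSubPow (w 0)).1 (h.ordGE_kSeries hQ.le),
    (hasLinear_oneSubPow (w 0)).2, mul_comm]

end Hyperplane

/-! ### The ideal of `Λ` as a leading coefficient ideal, and its height. -/

section ConePart

universe u

variable {k : Type u} [Field k] {n : ℕ}

/-- The coordinate ring of the locus `y ≠ 0` in `V`. -/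
abbrev HyperplaneCompl (k : Type u) [Field k] (n : ℕ) : Type u :=
  Localization.Away (X 0 : MvPolynomial (Fin (n + 1)) k)

theorem eval₂_finSuccEquiv {B : Type*} [CommRing B] (φ : MvPolynomial (Fin (n + 1)) k →+* B)
    (f : MvPolynomial (Fin (n + 1)) k) :
    (MvPolynomial.finSuccEquiv k n f).eval₂ (φ.comp (RingHomClass.toRingHom (proj k n))) (φ (X 0)) =
      φ f := by
  have : (Polynomial.eval₂RingHom (φ.comp (RingHomClass.toRingHom (proj k n))) (φ (X 0))).comp
      (RingHomClass.toRingHom (MvPolynomial.finSuccEquiv k n)) = φ := by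
    refine MvPolynomial.ringHom_ext (fun c => ?_) (fun i => ?_)
    · simp [MvPolynomial.finSuccEquiv_apply, proj]
    · refine Fin.cases ?_ (fun i => ?_) i
      · simp [MvPolynomial.finSuccEquiv_X_zero]
      · simp [MvPolynomial.finSuccEquiv_X_succ, proj]
  exact DFunLike.congr_fun this f

theorem chartAtInfinity_X_zero :
    chartAtInfinity k n (X 0) =
      IsLocalization.Away.invSelf (X 0 : MvPolynomial (Fin (n + 1)) k) := by
  simp [chartAtInfinity]

theorem chartAtInfinity_proj (f : MvPolynomial (Fin n) k) :
    chartAtInfinity k n (proj k n f) = algebraMap _ _ (proj k n f) := by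
  have : (chartAtInfinity k n).comp (proj k n) =
      (IsScalarTower.toAlgHom k (MvPolynomial (Fin (n + 1)) k) _).comp (proj k n) := by
    ext i
    simp [chartAtInfinity, proj]
  exact DFunLike.congr_fun this f

theorem chartAtInfinity_comp_proj :
    (RingHomClass.toRingHom (chartAtInfinity k n)).comp (RingHomClass.toRingHom (proj k n)) =
      (algebraMap (MvPolynomial (Fin (n + 1)) k)
        (HyperplaneCompl k n)).comp (RingHomClass.toRingHom (proj k n)) :=
  RingHom.ext chartAtInfinity_proj

theorem restrictHyperplane_eq_coeff (f : MvPolynomial (Fin (n + 1)) k) :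
    restrictHyperplane k n f = (MvPolynomial.finSuccEquiv k n f).coeff 0 := by
  have := eval₂_finSuccEquiv (RingHomClass.toRingHom (restrictHyperplane k n)) f
  have hid : (RingHomClass.toRingHom (restrictHyperplane k n)).comp
      (RingHomClass.toRingHom (proj k n)) =
      RingHom.id _ := RingHom.ext restrictHyperplane_proj
  rw [hid] at this
  simp only [RingHom.coe_coe, restrictHyperplane_X_zero] at this
  rw [← this, Polynomial.coeff_zero_eq_eval_zero]
  rfl

/-- Clearing denominators from a function on the chart at infinity. -/
theorem chartAtInfinity_mul_pow (g : MvPolynomial (Fin (n + 1)) k) {N : ℕ}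
    (hN : (MvPolynomial.finSuccEquiv k n g).natDegree ≤ N) :
    chartAtInfinity k n g *
        algebraMap (MvPolynomial (Fin (n + 1)) k) (HyperplaneCompl k n) (X 0) ^ N =
      algebraMap (MvPolynomial (Fin (n + 1)) k) (HyperplaneCompl k n)
      ((MvPolynomial.finSuccEquiv k n).symm ((MvPolynomial.finSuccEquiv k n g).reflect N)) := by
  set y := algebraMap (MvPolynomial (Fin (n + 1)) k)
    (HyperplaneCompl k n) (X 0) with hy
  set z := IsLocalization.Away.invSelf (S := HyperplaneCompl k n)
    (X 0 : MvPolynomial (Fin (n + 1)) k) with hz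
  have hyz : y * z = 1 := IsLocalization.Away.mul_invSelf _
  let _ : Invertible z := ⟨y, hyz, by rw [mul_comm, hyz]⟩
  have key := Polynomial.eval₂_reflect_mul_pow ((algebraMap (MvPolynomial (Fin (n + 1)) k)
    (HyperplaneCompl k n)).comp (RingHomClass.toRingHom (proj k n))) z N
    (MvPolynomial.finSuccEquiv k n g) hN
  have h1 := eval₂_finSuccEquiv (RingHomClass.toRingHom (chartAtInfinity k n)) g
  have h2 := eval₂_finSuccEquiv (algebraMap (MvPolynomial (Fin (n + 1)) k)
    (HyperplaneCompl k n))
      ((MvPolynomial.finSuccEquiv k n).symm ((MvPolynomial.finSuccEquiv k n g).reflect N))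
  rw [AlgEquiv.apply_symm_apply] at h2
  rw [chartAtInfinity_comp_proj] at h1
  simp only [RingHom.coe_coe, chartAtInfinity_X_zero] at h1
  rw [← h1, ← h2, ← hz, ← key, mul_assoc, ← mul_pow, mul_comm z y, hyz, one_pow, mul_one]
  rfl

/-- Up to a power of the unit `y`, passing to the chart `z = 1/y` reverses the coefficients in `y`,
so the value at `z = 0` is a leading coefficient. -/
theorem conePart_eq_leadingCoeff (I : Ideal (MvPolynomial (Fin (n + 1)) k)) :
    conePart I = (polyIdeal I).leadingCoeff := by
  have hu : IsUnit (algebraMap (MvPolynomial (Fin (n + 1)) k)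
    (HyperplaneCompl k n) (X 0)) :=
      IsLocalization.Away.algebraMap_isUnit _
  have hinj : Function.Injective (algebraMap (MvPolynomial (Fin (n + 1)) k)
    (HyperplaneCompl k n)) :=
      IsLocalization.injective _ (powers_le_nonZeroDivisors_of_noZeroDivisors (X_ne_zero 0))
  refine le_antisymm (Ideal.map_le_iff_le_comap.2 fun g hg => ?_) fun x hx => ?_
  · change restrictHyperplane k n g ∈ (polyIdeal I).leadingCoeff
    set p := MvPolynomial.finSuccEquiv k n g with hp
    rw [closureAtInfinity, Ideal.mem_comap,
      IsLocalization.mem_map_algebraMap_iff (Submonoid.powers (X 0))] at hg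
    obtain ⟨⟨⟨h, hh⟩, ⟨_, m, rfl⟩⟩, hg⟩ := hg
    have hN := chartAtInfinity_mul_pow g (le_refl p.natDegree)
    -- Here `y^m` clears the denominator coming from the localisation. The value of `g` at `z = 0`
    -- is the coefficient in degree `p.natDegree + m`; it may vanish, which is why `leadingCoeffNth`
    -- and not the true leading coefficient is used.
    have hmem : p.reflect p.natDegree * Polynomial.X ^ m ∈ polyIdeal I := by
      rw [mem_polyIdeal, map_mul, map_pow, ← MvPolynomial.finSuccEquiv_X_zero,
        AlgEquiv.symm_apply_apply]
      have : (MvPolynomial.finSuccEquiv k n).symm (p.reflect p.natDegree) * X 0 ^ m =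
          h * X 0 ^ p.natDegree := by
        apply hinj
        rw [map_mul, ← hN, map_mul, ← hg]
        simp only [map_pow]
        ring
      rw [this]
      exact I.mul_mem_right _ hh
    have hlc : restrictHyperplane k n g ∈ (polyIdeal I).leadingCoeffNth (p.natDegree + m) := by
      rw [mem_leadingCoeffNth_iff_coeff]
      refine ⟨_, hmem, ?_, ?_⟩
      · rw [Polynomial.degree_lt_iff_coeff_zero]
        intro i hi
        rw [Polynomial.coeff_mul_X_pow', if_pos (by omega), Polynomial.coeff_reflect,
          Polynomial.revAt_eq_self_of_lt (by omega)]
        exact Polynomial.coeff_eq_zero_of_natDegree_lt (by omega)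
      · rw [Polynomial.coeff_mul_X_pow, Polynomial.coeff_reflect, Polynomial.revAt_le le_rfl,
          Nat.sub_self, restrictHyperplane_eq_coeff]
    exact (le_iSup (polyIdeal I).leadingCoeffNth _) hlc
  · obtain ⟨f, hf, rfl⟩ := ((polyIdeal I).mem_leadingCoeff x).1 hx
    set g := (MvPolynomial.finSuccEquiv k n).symm (f.reflect f.natDegree) with hg
    have hgf : MvPolynomial.finSuccEquiv k n g = f.reflect f.natDegree := by
      rw [hg, AlgEquiv.apply_symm_apply]
    have hN := chartAtInfinity_mul_pow g (N := f.natDegree) (by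
      rw [hgf]
      exact Polynomial.natDegree_reflect_le.trans (max_le le_rfl le_rfl))
    have hinv : (f.reflect f.natDegree).reflect f.natDegree = f := by
      ext i
      rw [Polynomial.coeff_reflect, Polynomial.coeff_reflect, Polynomial.revAt_invol]
    rw [hgf, hinv] at hN
    have hmem : g ∈ closureAtInfinity I := by
      rw [closureAtInfinity, Ideal.mem_comap]
      refine (Ideal.mul_unit_mem_iff_mem _ (hu.pow f.natDegree)).1 ?_
      rw [hN]
      exact Ideal.mem_map_of_mem _ (mem_polyIdeal.1 hf)
    have hr : restrictHyperplane k n g = f.leadingCoeff := by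
      rw [restrictHyperplane_eq_coeff, hgf, Polynomial.coeff_reflect, Polynomial.revAt_zero]
      rfl
    rw [← hr]
    exact Ideal.mem_map_of_mem _ hmem

/-- The involution of the locus `y ≠ 0` that exchanges `y` and `1 / y`. -/
def chartSwap (k : Type u) [Field k] (n : ℕ) :
    HyperplaneCompl k n →+*
      HyperplaneCompl k n :=
  IsLocalization.Away.lift (X 0 : MvPolynomial (Fin (n + 1)) k)
    (g := RingHomClass.toRingHom (chartAtInfinity k n)) (by
    rw [RingHom.coe_coe, chartAtInfinity_X_zero]
    exact IsUnit.of_mul_eq_one_right _ (IsLocalization.Away.mul_invSelf _))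

theorem chartSwap_algebraMap (f : MvPolynomial (Fin (n + 1)) k) :
    chartSwap k n (algebraMap _ _ f) = chartAtInfinity k n f :=
  IsLocalization.Away.lift_eq (X 0 : MvPolynomial (Fin (n + 1)) k) _ f

theorem chartSwap_comp_chartSwap : (chartSwap k n).comp (chartSwap k n) = RingHom.id _ := by
  refine IsLocalization.ringHom_ext (Submonoid.powers (X 0 : MvPolynomial (Fin (n + 1)) k)) ?_
  refine MvPolynomial.ringHom_ext (fun c => ?_) (fun i => ?_)
  · simp only [RingHom.comp_apply, chartSwap_algebraMap, RingHom.id_apply]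
    have := chartAtInfinity_proj (n := n) (C c)
    simp only [proj, rename_C] at this
    rw [this, chartSwap_algebraMap, this]
  · refine Fin.cases ?_ (fun i => ?_) i
    · simp only [RingHom.comp_apply, chartSwap_algebraMap, RingHom.id_apply,
        chartAtInfinity_X_zero]
      have h1 : algebraMap (MvPolynomial (Fin (n + 1)) k)
        (HyperplaneCompl k n) (X 0) *
          IsLocalization.Away.invSelf (X 0 : MvPolynomial (Fin (n + 1)) k) = 1 :=
        IsLocalization.Away.mul_invSelf _
      have h2 := congrArg (chartSwap k n) h1
      rw [map_mul, map_one, chartSwap_algebraMap, chartAtInfinity_X_zero] at h2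
      rw [← mul_one (chartSwap k n _), ← h1, mul_comm (algebraMap _ _ _), ← mul_assoc,
        mul_comm (chartSwap k n _), h2, one_mul]
    · simp only [RingHom.comp_apply, chartSwap_algebraMap, RingHom.id_apply]
      have := chartAtInfinity_proj (n := n) (k := k) (X i)
      simp only [proj, rename_X] at this
      rw [this, chartSwap_algebraMap, this]

def chartSwapEquiv (k : Type u) [Field k] (n : ℕ) :
    HyperplaneCompl k n ≃+*
      HyperplaneCompl k n :=
  RingEquiv.ofRingHom (chartSwap k n) (chartSwap k n) chartSwap_comp_chartSwap
    chartSwap_comp_chartSwap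

/-- Expressing the closure by localisation, an automorphism and contraction makes its height
accessible, since each of these operations is compatible with heights. -/
theorem closureAtInfinity_eq_under (I : Ideal (MvPolynomial (Fin (n + 1)) k)) :
    closureAtInfinity I = (((I.map (algebraMap _
      (HyperplaneCompl k n))).comap
        (chartSwapEquiv k n)).under (MvPolynomial (Fin (n + 1)) k)) := by
  ext f
  rw [Ideal.mem_under, closureAtInfinity, Ideal.mem_comap, Ideal.mem_comap]
  change _ ↔ chartSwap k n _ ∈ _
  rw [chartSwap_algebraMap]

/-- The closure in the chart at infinity is prime, does not contain `z`, and has the same height as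
`I`; `Λ` is its section by `z = 0`. -/
theorem height_conePart_le (I : Ideal (MvPolynomial (Fin (n + 1)) k)) [I.IsPrime]
    (h : conePart I ≠ ⊤) : (conePart I).height ≤ I.height := by
  -- If `y ∈ I`, then `1` is a leading coefficient and `Λ` is empty, against `h`.
  have hX : X 0 ∉ I := fun hX => by
    refine h ?_
    rw [conePart_eq_leadingCoeff, Ideal.eq_top_iff_one, Ideal.mem_leadingCoeff]
    refine ⟨Polynomial.X, ?_, Polynomial.leadingCoeff_X⟩
    rwa [← MvPolynomial.finSuccEquiv_X_zero, finSuccEquiv_mem_polyIdeal]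
  have hdis : Disjoint (Submonoid.powers (X 0 : MvPolynomial (Fin (n + 1)) k) :
      Set (MvPolynomial (Fin (n + 1)) k)) (I : Set (MvPolynomial (Fin (n + 1)) k)) :=
    (Ideal.disjoint_powers_iff_notMem _ (Ideal.IsPrime.isRadical ‹_›)).2 hX
  have hp : (I.map (algebraMap _
      (HyperplaneCompl k n))).IsPrime :=
    IsLocalization.isPrime_of_isPrime_disjoint (Submonoid.powers (X 0)) _ I ‹_› hdis
  have hcl : (closureAtInfinity I).IsPrime := Ideal.IsPrime.comap _
  have hz : X 0 ∉ closureAtInfinity I := by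
    intro hz
    rw [closureAtInfinity, Ideal.mem_comap, chartAtInfinity_X_zero] at hz
    exact hp.ne_top (Ideal.eq_top_of_isUnit_mem _ hz
      (IsUnit.of_mul_eq_one_right _ (IsLocalization.Away.mul_invSelf _)))
  refine (height_map_restrictHyperplane_le (closureAtInfinity I) hz h).trans ?_
  rw [closureAtInfinity_eq_under, IsLocalization.height_under (Submonoid.powers (X 0)),
    RingEquiv.height_comap,
    ← IsLocalization.height_under (Submonoid.powers (X 0 : MvPolynomial (Fin (n + 1)) k)),
    IsLocalization.under_map_of_isPrime_disjoint _ _ ‹_› hdis]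

end ConePart

/-! ### Leading coefficients and the degree of a simple field extension. -/

section SimpleExtension

variable {S K F : Type*} [CommRing S] [Field K] [Field F] [Algebra K F]

theorem exists_map_eq_C_mul (ι : S →+* K)
    (hK : ∀ x : K, ∃ a b : S, ι b ≠ 0 ∧ x = ι a / ι b) (f : Polynomial K) :
    ∃ b : S, ι b ≠ 0 ∧ ∃ p : Polynomial S, p.map ι = Polynomial.C (ι b) * f := by
  induction f using Polynomial.induction_on' with
  | add f g hf hg =>
    obtain ⟨b, hb, p, hp⟩ := hf
    obtain ⟨c, hc, q, hq⟩ := hg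
    refine ⟨b * c, ?_, Polynomial.C c * p + Polynomial.C b * q, ?_⟩
    · rw [map_mul]
      exact mul_ne_zero hb hc
    · simp only [Polynomial.map_add, Polynomial.map_mul, Polynomial.map_C, hp, hq, map_mul]
      ring
  | monomial i x =>
    obtain ⟨a, b, hb, rfl⟩ := hK x
    refine ⟨b, hb, Polynomial.monomial i a, ?_⟩
    rw [Polynomial.map_monomial, Polynomial.C_mul_monomial, mul_div_cancel₀ _ hb]

variable {ι : S →+* K} {y : F} {J : Ideal (Polynomial S)}

theorem exists_mem_coeff_natDegree_minpoly (hJ : ∀ p, p ∈ J ↔ Polynomial.aeval y (p.map ι) = 0)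
    (hK : ∀ x : K, ∃ a b : S, ι b ≠ 0 ∧ x = ι a / ι b) (hy : IsIntegral K y) :
    ∃ p ∈ J, p.degree = (minpoly K y).natDegree ∧
      ι (p.coeff (minpoly K y).natDegree) ≠ 0 := by
  obtain ⟨b, hb, p, hp⟩ := exists_map_eq_C_mul ι hK (minpoly K y)
  -- The lift `p` may have spurious higher terms with coefficients in the kernel of `ι`; it is
  -- replaced by one of the degree of the minimal polynomial.
  obtain ⟨q, hq, hdeg⟩ := Polynomial.exists_degree_eq_of_mem_lifts
    ((Polynomial.mem_lifts (f := ι) _).2 ⟨p, hp⟩)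
  refine ⟨q, ?_, ?_, ?_⟩
  · rw [hJ, hq, map_mul, minpoly.aeval, mul_zero]
  · rw [hdeg, Polynomial.degree_C_mul hb, Polynomial.degree_eq_natDegree (minpoly.ne_zero hy)]
  · rw [← Polynomial.coeff_map, hq, Polynomial.coeff_C_mul, (minpoly.monic hy).coeff_natDegree,
      mul_one]
    exact hb

theorem finrank_eq_natDegree_minpoly
    (hF : ∀ x : F, ∃ f g : Polynomial K, x = Polynomial.aeval y f / Polynomial.aeval y g)
    (hy : IsIntegral K y) : Module.finrank K F = (minpoly K y).natDegree := by
  have htop : IntermediateField.adjoin K {y} = ⊤ := by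
    refine eq_top_iff.2 fun x _ => ?_
    obtain ⟨f, g, rfl⟩ := hF x
    exact div_mem
      (IntermediateField.algebra_adjoin_le_adjoin K _ (Polynomial.aeval_mem_adjoin_singleton K y))
      (IntermediateField.algebra_adjoin_le_adjoin K _ (Polynomial.aeval_mem_adjoin_singleton K y))
  rw [← IntermediateField.adjoin.finrank hy, htop, IntermediateField.finrank_top']

/-- If `J` is extended, `y` satisfies no equation over `K`. The extension is then infinite, and
`Module.finrank` takes its default value `0`, which is the convention for `d`. -/
theorem finrank_eq_zero_of_eq_map_C (hJ : ∀ p, p ∈ J ↔ Polynomial.aeval y (p.map ι) = 0)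
    (hK : ∀ x : K, ∃ a b : S, ι b ≠ 0 ∧ x = ι a / ι b)
    (h : J = (RingHom.ker ι).map Polynomial.C) : Module.finrank K F = 0 := by
  by_contra hne
  have := Module.finite_of_finrank_pos (Nat.pos_of_ne_zero hne)
  obtain ⟨p, hp, -, hne⟩ := exists_mem_coeff_natDegree_minpoly hJ hK (IsIntegral.of_finite K y)
  rw [h, Ideal.mem_map_C_iff] at hp
  exact hne (hp _)

/-- Since `F = K(y)`, the degree is that of the minimal polynomial of `y`. An element of `J` of
smaller degree must vanish over `K`, so its coefficients lie in the kernel. In that degree itself,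
the minimal polynomial with denominators cleared has its leading coefficient outside the kernel. -/
theorem leadingCoeffNth_eq_ker_iff_lt_finrank [IsNoetherianRing S]
    (hJ : ∀ p, p ∈ J ↔ Polynomial.aeval y (p.map ι) = 0)
    (hK : ∀ x : K, ∃ a b : S, ι b ≠ 0 ∧ x = ι a / ι b)
    (hF : ∀ x : F, ∃ f g : Polynomial K, x = Polynomial.aeval y f / Polynomial.aeval y g)
    (hker : J.comap Polynomial.C = RingHom.ker ι)
    (h : J ≠ (RingHom.ker ι).map Polynomial.C) (j : ℕ) :
    J.leadingCoeffNth j = RingHom.ker ι ↔ j < Module.finrank K F := by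
  obtain ⟨f, hf, hlc⟩ := exists_leadingCoeff_notMem (hker ▸ h)
  rw [hker, RingHom.mem_ker] at hlc
  have hy : IsIntegral K y := by
    refine IsAlgebraic.isIntegral ⟨f.map ι, fun h0 => hlc ?_, (hJ f).1 hf⟩
    rw [← Polynomial.coeff_natDegree, ← Polynomial.coeff_map, h0, Polynomial.coeff_zero]
  rw [finrank_eq_natDegree_minpoly hF hy]
  constructor
  · intro hj
    by_contra hlt
    obtain ⟨p, hp, hdeg, hne⟩ := exists_mem_coeff_natDegree_minpoly hJ hK hy
    have hmem : p.coeff (minpoly K y).natDegree ∈ J.leadingCoeffNth (minpoly K y).natDegree := by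
      rw [mem_leadingCoeffNth_iff_coeff]
      refine ⟨p, hp, ?_, rfl⟩
      rw [hdeg]
      exact_mod_cast Nat.lt_succ_self _
    have := J.leadingCoeffNth_mono (not_lt.1 hlt) hmem
    rw [hj] at this
    exact hne this
  · intro hj
    refine le_antisymm (fun x hx => ?_) ?_
    · obtain ⟨p, hp, hdeg, rfl⟩ := mem_leadingCoeffNth_iff_coeff.1 hx
      have h0 : p.map ι = 0 := by
        by_contra h0
        have h1 := minpoly.degree_le_of_ne_zero K y h0 ((hJ p).1 hp)
        rw [Polynomial.degree_eq_natDegree (minpoly.ne_zero hy)] at h1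
        have h2 := h1.trans_lt (Polynomial.degree_map_le.trans_lt hdeg)
        have h3 : (minpoly K y).natDegree < j + 1 := by exact_mod_cast h2
        omega
      rw [RingHom.mem_ker, ← Polynomial.coeff_map, h0, Polynomial.coeff_zero]
    · rw [← hker, comap_C_eq_leadingCoeffNth_zero]
      exact J.leadingCoeffNth_mono (Nat.zero_le j)

end SimpleExtension

/-! ### The degree of the projection, read off from the leading coefficient ideals. -/

section ProjDegree

variable {k : Type*} [Field k] {n : ℕ} (I : Ideal (MvPolynomial (Fin (n + 1)) k)) [I.IsPrime]

/-- Restriction of functions on `H` to rational functions on `Π`. -/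
def toFunctionFieldProjPart :
    MvPolynomial (Fin n) k →+* FractionRing (MvPolynomial (Fin n) k ⧸ projPart I) :=
  (algebraMap _ _).comp (Ideal.Quotient.mk (projPart I))

/-- Restriction of functions on `V` to rational functions on `X`. -/
def toFunctionField :
    MvPolynomial (Fin (n + 1)) k →+* FractionRing (MvPolynomial (Fin (n + 1)) k ⧸ I) :=
  (algebraMap _ _).comp (Ideal.Quotient.mk I)

theorem ker_toFunctionFieldProjPart : RingHom.ker (toFunctionFieldProjPart I) = projPart I := by
  ext f
  rw [RingHom.mem_ker, toFunctionFieldProjPart, RingHom.comp_apply,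
    FaithfulSMul.algebraMap_eq_zero_iff, Ideal.Quotient.eq_zero_iff_mem]

theorem toFunctionField_eq_zero_iff (f : MvPolynomial (Fin (n + 1)) k) :
    toFunctionField I f = 0 ↔ f ∈ I := by
  rw [toFunctionField, RingHom.comp_apply, FaithfulSMul.algebraMap_eq_zero_iff,
    Ideal.Quotient.eq_zero_iff_mem]

theorem functionFieldMap_comp :
    (functionFieldMap I).comp (toFunctionFieldProjPart I) =
      (toFunctionField I).comp (RingHomClass.toRingHom (proj k n)) := by
  refine RingHom.ext fun f => ?_
  · simp only [RingHom.comp_apply, toFunctionFieldProjPart, toFunctionField, functionFieldMap,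
      IsFractionRing.map, IsLocalization.map_eq]
    rfl

theorem exists_eq_div_toFunctionFieldProjPart
    (x : FractionRing (MvPolynomial (Fin n) k ⧸ projPart I)) :
    ∃ a b, toFunctionFieldProjPart I b ≠ 0 ∧
      x = toFunctionFieldProjPart I a / toFunctionFieldProjPart I b := by
  obtain ⟨a, b, hb, rfl⟩ := IsFractionRing.div_surjective (MvPolynomial (Fin n) k ⧸ projPart I) x
  obtain ⟨a, rfl⟩ := Ideal.Quotient.mk_surjective a
  obtain ⟨b, rfl⟩ := Ideal.Quotient.mk_surjective b
  refine ⟨a, b, ?_, rfl⟩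
  rw [toFunctionFieldProjPart, RingHom.comp_apply, Ne, FaithfulSMul.algebraMap_eq_zero_iff]
  exact nonZeroDivisors.ne_zero hb

/-- The degree of `X → Π` is the number of ideals of leading coefficients equal to the ideal of `Π`,
unless `X = Π × L`. -/
theorem projDegree_spec :
    (polyIdeal I = (projPart I).map Polynomial.C → projDegree I = 0) ∧
    (polyIdeal I ≠ (projPart I).map Polynomial.C →
      ∀ j, (polyIdeal I).leadingCoeffNth j = projPart I ↔ j < projDegree I) := by
  let _ := (functionFieldMap I).toAlgebra
  set y := toFunctionField I (X 0) with hy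
  have hev (f : MvPolynomial (Fin (n + 1)) k) : Polynomial.aeval y
      ((MvPolynomial.finSuccEquiv k n f).map (toFunctionFieldProjPart I)) =
        toFunctionField I f := by
    rw [← eval₂_finSuccEquiv (toFunctionField I) f, ← functionFieldMap_comp,
      Polynomial.aeval_def, Polynomial.eval₂_map]
    rfl
  have hJ (p) : p ∈ polyIdeal I ↔
      Polynomial.aeval y (p.map (toFunctionFieldProjPart I)) = 0 := by
    rw [mem_polyIdeal, ← toFunctionField_eq_zero_iff, ← hev, AlgEquiv.apply_symm_apply]
  have hF (x : FractionRing (MvPolynomial (Fin (n + 1)) k ⧸ I)) :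
      ∃ f g : Polynomial (FractionRing (MvPolynomial (Fin n) k ⧸ projPart I)),
        x = Polynomial.aeval y f / Polynomial.aeval y g := by
    obtain ⟨a, b, -, rfl⟩ := IsFractionRing.div_surjective (MvPolynomial (Fin (n + 1)) k ⧸ I) x
    obtain ⟨a, rfl⟩ := Ideal.Quotient.mk_surjective a
    obtain ⟨b, rfl⟩ := Ideal.Quotient.mk_surjective b
    exact ⟨(MvPolynomial.finSuccEquiv k n a).map _, (MvPolynomial.finSuccEquiv k n b).map _,
      by rw [hev a, hev b]; rfl⟩
  have hK := exists_eq_div_toFunctionFieldProjPart I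
  have hker := ker_toFunctionFieldProjPart I
  constructor
  · intro h
    exact finrank_eq_zero_of_eq_map_C hJ hK (by rw [hker, h])
  · intro h j
    have := leadingCoeffNth_eq_ker_iff_lt_finrank hJ hK hF
      (by rw [hker, projPart_eq_comap_C]) (by rwa [hker]) j
    rwa [hker] at this

end ProjDegree

/-! ### Extraction of the multidegree from the recursion. -/

section Degeneration

universe u

variable {k : Type u} [Field k] {n r : ℕ} {w : Fin (n + 1) → Fin r → ℤ}
  {I : Ideal (MvPolynomial (Fin (n + 1)) k)}

theorem height_add_one_le_of_lt {A : Type*} [CommRing A] {Q J : Ideal A} [Q.IsPrime] (h : Q < J) :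
    Q.height + 1 ≤ J.height := by
  rw [J.height_eq_inf_minimalPrimes]
  refine le_iInf₂ fun P hP => ?_
  have := hP.isPrime
  exact Ideal.height_add_one_le_of_lt_of_isPrime (h.trans_le hP.1.2)

theorem eq_timesLine_projPart (h : polyIdeal I = (projPart I).map Polynomial.C) :
    I = timesLine (projPart I) := by
  rw [← polyIdeal_timesLine] at h
  ext f
  rw [← finSuccEquiv_mem_polyIdeal, h, finSuccEquiv_mem_polyIdeal]

theorem leadingCoeff_map_C {A : Type*} [CommRing A] (J : Ideal A) :
    (J.map (Polynomial.C : A →+* Polynomial A)).leadingCoeff = J := by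
  rw [leadingCoeff_eq_of_stable (N := 0) (by simp [leadingCoeffNth_map_C]), leadingCoeffNth_map_C]

theorem IsHomog.projPart (h : IsHomog w I) : IsHomog (fun i => w i.succ) (projPart I) := by
  rw [projPart_eq_comap_C, comap_C_eq_leadingCoeffNth_zero]
  exact h.leadingCoeffNth 0

theorem IsHomog.conePart (h : IsHomog w I) : IsHomog (fun i => w i.succ) (conePart I) := by
  obtain ⟨N, hN⟩ := exists_stable_leadingCoeffNth (polyIdeal I)
  rw [conePart_eq_leadingCoeff, leadingCoeff_eq_of_stable hN]
  exact h.leadingCoeffNth N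

/-- The recursion is read in degree `codim X`, the multidegree of `Λ` in degree `codim Λ`. The two
agree when `Λ` is nonempty; otherwise the series vanishes. -/
theorem homPart_kSeries_conePart [I.IsPrime] (w : Fin n → Fin r → ℤ) :
    homPart I.height.toNat (kSeries w (conePart I)) = multidegree w (conePart I) := by
  rw [multidegree_eq_homPart]
  by_cases h : conePart I = ⊤
  · rw [h, kSeries_top, map_zero, map_zero]
  · rw [le_antisymm (height_conePart_le I h)]
    rw [conePart_eq_leadingCoeff, ← height_polyIdeal]
    exact height_le_height_leadingCoeff _

/-- An ideal strictly containing the prime `Q` has height at least one more, so its series starts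
beyond the degree in question. -/
theorem IsHomog.homPart_kSeries_of_le {w : Fin n → Fin r → ℤ} {Q J : Ideal (MvPolynomial (Fin n) k)}
    [Q.IsPrime] (h : IsHomog w J) (hle : Q ≤ J) :
    OrdGE Q.height.toNat (kSeries w J) ∧
      homPart Q.height.toNat (kSeries w J) = if J = Q then multidegree w Q else 0 := by
  have hQ : ((Q.height.toNat : ℕ) : ℕ∞) = Q.height :=
    ENat.natCast_toNat Ideal.height_ne_top_of_isPrime
  refine ⟨h.ordGE_kSeries (hQ.le.trans (Ideal.height_mono hle)), ?_⟩
  split_ifs with hJ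
  · rw [hJ, multidegree_eq_homPart]
  · refine OrdGE.homPart_eq_zero (h.ordGE_kSeries (c := Q.height.toNat + 1) ?_) (Nat.lt_succ_self _)
    rw [Nat.cast_add, hQ, Nat.cast_one]
    exact height_add_one_le_of_lt (lt_of_le_of_ne hle (Ne.symm hJ))

theorem IsHomog.multidegree_eq [I.IsPrime] (h : IsHomog w I) :
    multidegree w I = (projDegree I : MvPolynomial (Fin r) ℤ) *
      multidegree w (GVD.inHyperplane (GVD.projPart I)) +
        multidegree w (GVD.timesLine (GVD.conePart I)) := by
  -- In the extended case `X = Π × L`, every leading coefficient ideal is that of `Π`, so `Λ = Π`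
  -- and `d = 0`.
  by_cases hmap : polyIdeal I = (GVD.projPart I).map Polynomial.C
  · rw [(projDegree_spec I).1 hmap, Nat.cast_zero, zero_mul, zero_add, conePart_eq_leadingCoeff,
      hmap, leadingCoeff_map_C, ← eq_timesLine_projPart hmap]
  have hdeg := (projDegree_spec I).2 hmap
  have hprime : (polyIdeal I).IsPrime := Ideal.IsPrime.comap _
  have hh : I.height.toNat = 1 + (GVD.projPart I).height.toNat := by
    rw [← height_polyIdeal, height_eq_height_comap_C_add_one (by rwa [← projPart_eq_comap_C]),
      ← projPart_eq_comap_C, ENat.toNat_add Ideal.height_ne_top_of_isPrime ENat.one_ne_top,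
      add_comm]
    rfl
  obtain ⟨N₀, hN₀⟩ := exists_stable_leadingCoeffNth (polyIdeal I)
  -- The maximum ensures that the sum over `j < N` includes every `j < projDegree I`.
  set N := max N₀ (projDegree I) with hNdef
  have hN : ∀ i, N ≤ i → (polyIdeal I).leadingCoeffNth i = (polyIdeal I).leadingCoeffNth N :=
    fun i hi => (hN₀ i ((le_max_left _ _).trans hi)).trans (hN₀ N (le_max_left _ _)).symm
  have hle (j : ℕ) : GVD.projPart I ≤ (polyIdeal I).leadingCoeffNth j := by
    rw [projPart_eq_comap_C, comap_C_eq_leadingCoeffNth_zero]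
    exact (polyIdeal I).leadingCoeffNth_mono (Nat.zero_le j)
  have hterm (j : ℕ) := (h.leadingCoeffNth j).homPart_kSeries_of_le (hle j)
  rw [multidegree_timesLine h.conePart, multidegree_inHyperplane h.projPart,
    ← homPart_kSeries_conePart, multidegree_eq_homPart, h.kSeries_succ hN, map_add]
  congr 1
  · rw [hh, OrdGE.homPart_mul (hasLinear_oneSubPow (w 0)).1
      (OrdGE.sum _ fun j _ => ((hterm j).1.oneSubPow_mul _ _).1), (hasLinear_oneSubPow (w 0)).2,
      map_sum]
    -- Each `j` with leading coefficient ideal equal to `projPart I` contributes one copy of the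
    -- multidegree of `Π`; counting them gives the factor `projDegree I`.
    simp only [((hterm _).1.oneSubPow_mul _ _).2, (hterm _).2, hdeg]
    rw [Finset.sum_ite, Finset.sum_const_zero, add_zero, Finset.sum_const, nsmul_eq_mul]
    have hcard : {j ∈ Finset.range N | j < projDegree I} = Finset.range (projDegree I) := by
      ext j
      simp only [Finset.mem_filter, Finset.mem_range, hNdef, lt_max_iff]
      tauto
    rw [hcard, Finset.card_range]
    ring
  · rw [conePart_eq_leadingCoeff, leadingCoeff_eq_of_stable hN]
    refine (OrdGE.oneSubPow_mul ((h.leadingCoeffNth N).ordGE_kSeries ?_) _ _).2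
    rw [ENat.natCast_toNat Ideal.height_ne_top_of_isPrime, ← leadingCoeff_eq_of_stable hN,
      ← height_polyIdeal]
    exact height_le_height_leadingCoeff _

end Degeneration

end GVD

end

theorem mainTheorem7 {k : Type*} [Field k] (n r : ℕ) (w : Fin (n + 1) → Fin r → ℤ)
    (I : Ideal (MvPolynomial (Fin (n + 1)) k)) [I.IsPrime] (hI : GVD.IsInvariant w I) :
    (GVD.IsInvariant (fun i : Fin n => w i.succ) (GVD.projPart I) ∧
      GVD.IsInvariant (fun i : Fin n => w i.succ) (GVD.conePart I)) ∧
    GVD.multidegree w I =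
      (GVD.projDegree I : MvPolynomial (Fin r) ℤ) *
          GVD.multidegree w (GVD.inHyperplane (GVD.projPart I)) +
        GVD.multidegree w (GVD.timesLine (GVD.conePart I)) ∧
    GVD.multidegree w (GVD.inHyperplane (GVD.projPart I)) =
      GVD.multidegree w (GVD.timesLine (GVD.projPart I)) * GVD.wt (w 0) := by
  have h := (GVD.isInvariant_iff_isHomog w I).1 hI
  refine ⟨⟨(GVD.isInvariant_iff_isHomog _ _).2 h.projPart,
    (GVD.isInvariant_iff_isHomog _ _).2 h.conePart⟩, h.multidegree_eq, ?_⟩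
  rw [GVD.multidegree_inHyperplane h.projPart, GVD.multidegree_timesLine h.projPart]
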